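/- Let $m,n,u,v\ge 0$ be integers with $m+n>0$ and $u+v>0$. **Conventions.** $\mathbf B_{m|n}=\{\overline m<\cdots<\overline 1<1<\cdots<n\}$, with $|b|=0$ for barred and $|b|=1$ for unbarred letters, is the crystal of the natural representation of $\mathfrak{gl}_{m|n}$, with arrows from each letter to the next; the set of finite words $w_1\cdots w_r=w_1\otimes\cdots\otimes w_r$ is a $\mathfrak{gl}_{m|n}$-crystal by the tensor product rule of Benkart–Kang–Kashiwara. $\mathcal P_{m|n}$ is the set of partitions $\lambda$ with $\lambda_{m+1}\le n$, and $\lambda'$ is the conjugate of $\lambda$. For $\lambda\in\mathcal P_{m|n}$, $\mathbf B_{m|n}(\lambda)$ is the set of tableaux of shape $\lambda$ with entries in $\mathbf B_{m|n}$, weakly increasing along rows and down columns, with barred entries strictly increasing down columns and unbarred entries strictly increasing along rows; it is a subcrystal of the words via the column reading (columns from right to left, each from top to bottom). $H^\lambda_{m|n}\in\mathbf B_{m|n}(\lambda)$ is its highest weight tableau: row $k\le m$ is filled with $\overline{m-k+1}$, and below row $m$ column $j$ is filled with $j$. The hook Schur function is $hs_\lambda(x)=\sum_{T\in\mathbf B_{m|n}(\lambda)}x^{\mathrm{wt}\,T}$.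 $P(w)$ is the tableau obtained from a word $w$ by Schensted column insertion of $w_1,w_2,\dots$ (a barred letter $b$ bumps the first entry $\ge b$ of a column, an unbarred $b$ the first entry $>b$). Let $\mathbf M^\sharp$ be the set of matrices $A=(a_{bb'})_{b\in\mathbf B_{m|n},\,b'\in\mathbf B_{u|v}}$ over $\mathbb Z_{\ge0}$ with $a_{bb'}\le1$ whenever $|b|=|b'|$. List the pairs $(b,b')$, each $a_{bb'}$ times, by increasing $b'$ and, for equal $b'$, by increasing $b$ if $b'$ is barred and by decreasing $b$ if $b'$ is unbarred; this gives a pair of words $(\mathbf i,\mathbf j)$. List them by decreasing $b$ and, for equal $b$, by increasing $b'$ if $b$ is barred and by decreasing $b'$ if $b$ is unbarred; this gives $(\mathbf k,\mathbf l)$. The operators $e_i,f_i$ of $\mathfrak{gl}_{m|n}$ act on $A$ through $\mathbf i$ (with $\mathbf j$ fixed), and the operators $e_j^*,f_j^*$ of $\mathfrak{gl}_{u|v}$ through $\mathbf l$ (with $\mathbf k$ fixed). Put $\pi^\sharp(A)=(P(\mathbf i),P(\mathbf l))$ and $$\mathbf M^\sharp_{\rm h.w.}=\{A\in\mathbf M^\sharp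 : \pi^\sharp(A)=(H^\lambda_{m|n},H^\mu_{u|v})\text{ for some }\lambda\in\mathcal P_{m|n},\ \mu\in\mathcal P_{u|v}\}.$$ For $\lambda\in\mathcal P_{m|n}\cap\mathcal P_{v|u}$ let $\ell=\lambda_{m+1}$ and let $\nu_1,\dots,\nu_\ell\ge0$ be such that $(\nu_1+\cdots+\nu_\ell,\ \nu_2+\cdots+\nu_\ell,\dots,\nu_\ell)$ is the conjugate of $(\lambda_{m+1},\lambda_{m+2},\dots)$; put $\nu_c=0$ for $c>\ell$. Define $A^\sharp_\lambda\in\mathbf M^\sharp$, for $0\le k<m$, $0\le l<u$, $1\le s\le n$, $1\le t\le v$, by * $a^\sharp_{\overline{m-k}\,\overline{u-l}}=1$ if $\lambda_{k+1}\ge l+1$, and $0$ otherwise; * $a^\sharp_{\overline{m-k}\,t}=\max(\lambda_t-u,0)$ if $t=k+1$, and $0$ otherwise; * $a^\sharp_{s\,\overline{u-l}}=\nu_{s+l}$; * $a^\sharp_{s\,t}=1$ if $t>m$ and $\lambda_t\ge u+s$, and $0$ otherwise (so this block is zero if $m\ge v$ or $n\le u$). **Theorem.** $\mathbf M^\sharp$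 and the sets $\mathbf B_{m|n}(\lambda)$, $\mathbf B_{u|v}(\lambda')$ for $\lambda\in\mathcal P_{m|n}\cap\mathcal P_{v|u}$ are stable under the operators above, and $\mathbf M^\sharp$ is a $(\mathfrak{gl}_{m|n},\mathfrak{gl}_{u|v})$-bicrystal. Moreover $$\mathbf M^\sharp_{\rm h.w.}=\{A^\sharp_\lambda : \lambda\in\mathcal P_{m|n}\cap\mathcal P_{v|u}\},$$ and $\pi^\sharp$ is an isomorphism of $(\mathfrak{gl}_{m|n},\mathfrak{gl}_{u|v})$-bicrystals $$\pi^\sharp:\mathbf M^\sharp\longrightarrow\bigoplus_{\lambda\in\mathcal P_{m|n}\cap\mathcal P_{v|u}}\mathbf B_{m|n}(\lambda)\times\mathbf B_{u|v}(\lambda').$$ Consequently, as formal power series in $x_b$ ($b\in\mathbf B_{m|n}$) and $y_{b'}$ ($b'\in\mathbf B_{u|v}$), $$\frac{\prod_{|b|=|b'|}(1+x_by_{b'})}{\prod_{|b|\ne|b'|}(1-x_by_{b'})}=\sum_{\lambda\in\mathcal P_{m|n}\cap\mathcal P_{v|u}}hs_\lambda(x)\,hs_{\lambda'}(y).$$ 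-/

import Mathlib

namespace HookCrystal

/-! ### The alphabet, weights, roots and coroots -/

/-- The linearly ordered alphabet `m̄ < ⋯ < 1̄ < 1 < ⋯ < n` of `gl_{m|n}`, encoded by position:
the letter `0 ≤ k < m` is the barred letter of index `m - k`, and the letter `m + s` with
`0 ≤ s < n` is the unbarred letter `s + 1`. -/
abbrev Letter (m n : ℕ) : Type := Fin (m + n)

/-- The barred letter of index `m - k`. -/
def barred (m n : ℕ) (k : Fin m) : Letter m n := Fin.castAdd n k

/-- The unbarred letter `s + 1`. -/
def unbarred (m n : ℕ) (s : Fin n) : Letter m n := Fin.natAdd m s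

/-- The degree `|b|`: `0` on barred (even) letters, `1` on unbarred (odd) letters. -/
def deg (m n : ℕ) (b : Letter m n) : ℕ := if b.val < m then 0 else 1

/-- The weight lattice: the free abelian group on the `ε_b`. -/
abbrev Weight (m n : ℕ) : Type := Letter m n → ℤ

/-- The index set of the simple roots. The index `i` is the arrow from the letter in
position `i` to the letter in position `i + 1`. It is a barred index if `i + 1 < m`, the
index `0` (odd root) if `i + 1 = m`, and an unbarred index if `m ≤ i`. -/
abbrev Idx (m n : ℕ) : Type := Fin (m + n - 1)

/-- The source of the arrow `i`. -/
def lo (m n : ℕ) (i : Idx m n) : Letter m n := ⟨i.val, by omega⟩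

/-- The target of the arrow `i`. -/
def hi (m n : ℕ) (i : Idx m n) : Letter m n := ⟨i.val + 1, by omega⟩

/-- The simple root `α_i`. -/
def simpleRoot (m n : ℕ) (i : Idx m n) : Weight m n :=
  Pi.single (lo m n i) 1 - Pi.single (hi m n i) 1

/-- The symmetric form with `(ε_b, ε_{b'}) = (-1)^{|b|} δ_{bb'}`. -/
def form (m n : ℕ) (μ ν : Weight m n) : ℤ := ∑ b, (-1) ^ deg m n b * μ b * ν b

/-- The pairing `⟨h_i, μ⟩` with the simple coroot. -/
def coroot (m n : ℕ) (i : Idx m n) (μ : Weight m n) : ℤ :=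
  if i.val < m then form m n (simpleRoot m n i) μ else -form m n (simpleRoot m n i) μ

/-! ### Crystals -/

/-- The maps of a `gl_{m|n}`-crystal; the formal symbol `0` is `none`. -/
structure CrystalData (m n : ℕ) (B : Type*) where
  wt : B → Weight m n
  ε : Idx m n → B → ℕ
  φ : Idx m n → B → ℕ
  e : Idx m n → B → Option B
  f : Idx m n → B → Option B

/-- The axioms of a `gl_{m|n}`-crystal. -/
structure CrystalData.IsCrystal {m n : ℕ} {B : Type*} (C : CrystalData m n B) : Prop where
  string : ∀ (i : Idx m n) (b : B), i.val + 1 ≠ m →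
    (C.φ i b : ℤ) - C.ε i b = coroot m n i (C.wt b)
  odd_nonneg : ∀ (i : Idx m n) (b : B), i.val + 1 = m → 0 ≤ coroot m n i (C.wt b)
  odd_string : ∀ (i : Idx m n) (b : B), i.val + 1 = m →
    C.φ i b + C.ε i b = if coroot m n i (C.wt b) = 0 then 0 else 1
  e_ε : ∀ i b b', C.e i b = some b' → (C.ε i b' : ℤ) = C.ε i b - 1
  e_φ : ∀ i b b', C.e i b = some b' → C.φ i b' = C.φ i b + 1
  e_wt : ∀ i b b', C.e i b = some b' → C.wt b' = C.wt b + simpleRoot m n i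
  f_ε : ∀ i b b', C.f i b = some b' → C.ε i b' = C.ε i b + 1
  f_φ : ∀ i b b', C.f i b = some b' → (C.φ i b' : ℤ) = C.φ i b - 1
  f_wt : ∀ i b b', C.f i b = some b' → C.wt b' = C.wt b - simpleRoot m n i
  f_iff_e : ∀ i b b', C.f i b = some b' ↔ C.e i b' = some b

/-- Both structures are crystals, and the Kashiwara operators of one commute with those of the
other, as maps on `B ∪ {0}`. -/
structure IsBicrystal {m n u v : ℕ} {B : Type*} (C : CrystalData m n B)
    (D : CrystalData u v B) : Prop where
  left : C.IsCrystal
  right : D.IsCrystal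
  e_e : ∀ i j b, (C.e i b).bind (D.e j) = (D.e j b).bind (C.e i)
  e_f : ∀ i j b, (C.e i b).bind (D.f j) = (D.f j b).bind (C.e i)
  f_e : ∀ i j b, (C.f i b).bind (D.e j) = (D.e j b).bind (C.f i)
  f_f : ∀ i j b, (C.f i b).bind (D.f j) = (D.f j b).bind (C.f i)

/-- An isomorphism of crystals: a bijection that preserves the coloured arrows in both
directions, the weights, and the functions `ε_i`, `φ_i`. -/
structure IsCrystalIso {m n : ℕ} {X Y : Type*} (C : CrystalData m n X) (D : CrystalData m n Y)
    (Φ : X ≃ Y) : Prop where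
  wt : ∀ x, D.wt (Φ x) = C.wt x
  ε : ∀ i x, D.ε i (Φ x) = C.ε i x
  φ : ∀ i x, D.φ i (Φ x) = C.φ i x
  e : ∀ i x, D.e i (Φ x) = (C.e i x).map Φ
  f : ∀ i x, D.f i (Φ x) = (C.f i x).map Φ

/-- The structure on `B × B'` that acts on the first factor. -/
def CrystalData.onFst {m n : ℕ} {B : Type*} (C : CrystalData m n B) (B' : Type*) :
    CrystalData m n (B × B') where
  wt p := C.wt p.1
  ε i p := C.ε i p.1
  φ i p := C.φ i p.1
  e i p := (C.e i p.1).map fun b => (b, p.2)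
  f i p := (C.f i p.1).map fun b => (b, p.2)

/-- The structure on `B' × B` that acts on the second factor. -/
def CrystalData.onSnd {m n : ℕ} {B : Type*} (C : CrystalData m n B) (B' : Type*) :
    CrystalData m n (B' × B) where
  wt p := C.wt p.2
  ε i p := C.ε i p.2
  φ i p := C.φ i p.2
  e i p := (C.e i p.2).map fun b => (p.1, b)
  f i p := (C.f i p.2).map fun b => (p.1, b)

/-- The direct sum (disjoint union). -/
def CrystalData.directSum {m n : ℕ} {ι : Type*} {B : ι → Type*}
    (C : ∀ k, CrystalData m n (B k)) : CrystalData m n (Σ k, B k) where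
  wt p := (C p.1).wt p.2
  ε i p := (C p.1).ε i p.2
  φ i p := (C p.1).φ i p.2
  e i p := ((C p.1).e i p.2).map fun b => ⟨p.1, b⟩
  f i p := ((C p.1).f i p.2).map fun b => ⟨p.1, b⟩

open Classical in
/-- The structure induced on `X` when `X` is identified with a subset of `B` by an injective
map `r : X → B` whose range is stable (see `IsSubcrystal`). -/
noncomputable def CrystalData.pullback {m n : ℕ} {B X : Type*} (C : CrystalData m n B)
    (r : X → B) : CrystalData m n X where
  wt x := C.wt (r x)
  ε i x := C.ε i (r x)
  φ i x := C.φ i (r x)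
  e i x := if h : ∃ y, C.e i (r x) = some (r y) then some h.choose else none
  f i x := if h : ∃ y, C.f i (r x) = some (r y) then some h.choose else none

/-- `r` identifies `X` with a subcrystal of `B`: it is injective, its range together with `0`
is stable under the Kashiwara operators, and the induced structure satisfies the axioms. -/
structure IsSubcrystal {m n : ℕ} {B X : Type*} (C : CrystalData m n B) (r : X → B) : Prop where
  injective : Function.Injective r
  e_mem : ∀ i x b, C.e i (r x) = some b → b ∈ Set.range r
  f_mem : ∀ i x b, C.f i (r x) = some b → b ∈ Set.range r
  isCrystal : (C.pullback r).IsCrystal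

/-! ### The crystal of words -/

/-- The crystal of the natural representation. -/
def letterCrystal (m n : ℕ) : CrystalData m n (Letter m n) where
  wt b := Pi.single b 1
  ε i b := if b = hi m n i then 1 else 0
  φ i b := if b = lo m n i then 1 else 0
  e i b := if b = hi m n i then some (lo m n i) else none
  f i b := if b = lo m n i then some (hi m n i) else none

/-- The weight of a word: the number of occurrences of each letter. -/
def wordWt (m n : ℕ) (w : List (Letter m n)) : Weight m n := fun b => (w.count b : ℤ)

/-- `ε_i` on words. The word `a :: w` is `a ⊗ w`, so this is the tensor product rule, with
separate cases for `i` barred, `i = 0`, and `i` unbarred. The two maxima are nonnegative. -/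
def wordε (m n : ℕ) (i : Idx m n) : List (Letter m n) → ℕ
  | [] => 0
  | a :: w =>
    if i.val + 1 < m then
      (max ((letterCrystal m n).ε i a : ℤ)
        (wordε m n i w - coroot m n i ((letterCrystal m n).wt a))).toNat
    else if i.val + 1 = m then
      if 0 < coroot m n i ((letterCrystal m n).wt a) then (letterCrystal m n).ε i a
      else wordε m n i w
    else
      (max ((letterCrystal m n).ε i a - coroot m n i (wordWt m n w))
        (wordε m n i w : ℤ)).toNat

/-- `φ_i` on words, by the tensor product rule. -/
def wordφ (m n : ℕ) (i : Idx m n) : List (Letter m n) → ℕ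
  | [] => 0
  | a :: w =>
    if i.val + 1 < m then
      (max ((letterCrystal m n).φ i a + coroot m n i (wordWt m n w))
        (wordφ m n i w : ℤ)).toNat
    else if i.val + 1 = m then
      if 0 < coroot m n i ((letterCrystal m n).wt a) then (letterCrystal m n).φ i a
      else wordφ m n i w
    else
      (max ((letterCrystal m n).φ i a : ℤ)
        (wordφ m n i w + coroot m n i ((letterCrystal m n).wt a))).toNat

/-- `e_i` on words, by the tensor product rule. -/
def wordE (m n : ℕ) (i : Idx m n) : List (Letter m n) → Option (List (Letter m n))
  | [] => none
  | a :: w =>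
    let inFirst : Bool :=
      if i.val + 1 < m then decide (wordε m n i w ≤ (letterCrystal m n).φ i a)
      else if i.val + 1 = m then decide (0 < coroot m n i ((letterCrystal m n).wt a))
      else decide (wordφ m n i w < (letterCrystal m n).ε i a)
    if inFirst then ((letterCrystal m n).e i a).map (fun a' => a' :: w)
    else (wordE m n i w).map (fun w' => a :: w')

/-- `f_i` on words, by the tensor product rule. -/
def wordF (m n : ℕ) (i : Idx m n) : List (Letter m n) → Option (List (Letter m n))
  | [] => none
  | a :: w =>
    let inFirst : Bool :=
      if i.val + 1 < m then decide (wordε m n i w < (letterCrystal m n).φ i a)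
      else if i.val + 1 = m then decide (0 < coroot m n i ((letterCrystal m n).wt a))
      else decide (wordφ m n i w ≤ (letterCrystal m n).ε i a)
    if inFirst then ((letterCrystal m n).f i a).map (fun a' => a' :: w)
    else (wordF m n i w).map (fun w' => a :: w')

/-- The crystal of all finite words, the empty word being trivial. -/
def wordCrystal (m n : ℕ) : CrystalData m n (List (Letter m n)) where
  wt := wordWt m n
  ε := wordε m n
  φ := wordφ m n
  e := wordE m n
  f := wordF m n

/-! ### Partitions and hook semistandard tableaux -/

/-- The `(m,n)`-hook partitions: `λ_{m+1} ≤ n` (rows are numbered from `0` here). -/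
def hookPartitions (m n : ℕ) : Set YoungDiagram := {lam | lam.rowLen m ≤ n}

/-- A filling is stored as the list of its columns from left to right, each column being the
list of its entries from top to bottom. This is the entry in row `i` and column `j`. -/
def entry {α : Type*} (T : List (List α)) (i j : ℕ) : Option α := (T[j]?).bind fun col => col[i]?

/-- The set `B_{m|n}(λ)` of `(m,n)`-hook semistandard tableaux of shape `λ`: rows and columns
weakly increase, barred entries strictly increase in columns, unbarred ones in rows. -/
def hookTableaux (m n : ℕ) (lam : YoungDiagram) : Set (List (List (Letter m n))) :=
  {T | [] ∉ T ∧ (∀ i j, (entry T i j).isSome ↔ (i, j) ∈ lam) ∧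
    (∀ i j j' a b, j < j' → entry T i j = some a → entry T i j' = some b →
      a < b ∨ a = b ∧ deg m n a = 0) ∧
    (∀ i i' j a b, i < i' → entry T i j = some a → entry T i' j = some b →
      a < b ∨ a = b ∧ deg m n a = 1)}

/-- Column reading: columns from right to left, each one from top to bottom. -/
def columnReading {α : Type*} (T : List (List α)) : List α := T.reverse.flatten

/-- The column reading on `B_{m|n}(λ)`. -/
def tableauWord (m n : ℕ) (lam : YoungDiagram) (T : hookTableaux m n lam) :
    List (Letter m n) := columnReading T.1

/-- The crystal `B_{m|n}(λ)`, a subcrystal of the words through the column reading. -/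
noncomputable def tableauCrystal (m n : ℕ) (lam : YoungDiagram) :
    CrystalData m n (hookTableaux m n lam) :=
  (wordCrystal m n).pullback (tableauWord m n lam)

/-- The highest weight tableau `H_{m|n}^λ`: for `k ≤ m` all entries of the `k`-th row are the
`k`-th letter, and below row `m` all entries of the `j`-th column are the unbarred letter `j`. -/
def highestTableau (m n : ℕ) (lam : YoungDiagram) (h : lam ∈ hookPartitions m n) :
    List (List (Letter m n)) :=
  List.ofFn fun j : Fin (lam.rowLen 0) => List.ofFn fun i : Fin (lam.colLen j) =>
    if hk : i.val < m then barred m n ⟨i, hk⟩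
    else unbarred m n ⟨j, by
      have h1 : (i.val, j.val) ∈ lam := YoungDiagram.mem_iff_lt_colLen.2 i.2
      have h2 : j.val < lam.rowLen i := YoungDiagram.mem_iff_lt_rowLen.1 h1
      have h3 : lam.rowLen i ≤ lam.rowLen m := lam.rowLen_anti _ _ (not_lt.1 hk)
      have h4 : lam.rowLen m ≤ n := h
      omega⟩

/-- The hook Schur function `hs_λ(x)`, the sum of `x^{wt T}` over `B_{m|n}(λ)`
(a finite set, see `hookTableaux_finite`). -/
noncomputable def hookSchur (m n : ℕ) (lam : YoungDiagram) {R : Type*} [CommRing R]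
    (x : Letter m n → R) : R :=
  ∑ᶠ T ∈ hookTableaux m n lam, ∏ b, x b ^ T.flatten.count b

theorem hookTableaux_finite (m n : ℕ) (lam : YoungDiagram) : (hookTableaux m n lam).Finite := by
  have hfin : {c : List (Letter m n) | c.length ≤ lam.colLen 0}.Finite :=
    List.finite_length_le _ _
  have : Finite {c : List (Letter m n) | c.length ≤ lam.colLen 0} := hfin
  refine ((List.finite_length_le {c : List (Letter m n) | c.length ≤ lam.colLen 0}
    (lam.rowLen 0)).image (List.map Subtype.val)).subset ?_
  rintro T ⟨h0, hs, -, -⟩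
  have hcol : ∀ c ∈ T, c.length ≤ lam.colLen 0 := by
    intro c hc
    obtain ⟨j, hj, rfl⟩ := List.getElem_of_mem hc
    by_contra hlt
    have h1 : (entry T (lam.colLen 0) j).isSome := by
      simp only [entry, List.getElem?_eq_getElem hj, Option.bind_some]
      rw [List.getElem?_eq_getElem (by omega)]; rfl
    have h2 := YoungDiagram.mem_iff_lt_colLen.1 ((hs _ _).1 h1)
    have h3 := lam.colLen_anti 0 j (Nat.zero_le _)
    omega
  have hlen : T.length ≤ lam.rowLen 0 := by
    by_contra hlt
    have hj : lam.rowLen 0 < T.length := by omega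
    have hne : T[lam.rowLen 0] ≠ [] := fun h => h0 (h ▸ List.getElem_mem hj)
    have h1 : (entry T 0 (lam.rowLen 0)).isSome := by
      simp only [entry, List.getElem?_eq_getElem hj, Option.bind_some]
      rw [List.getElem?_eq_getElem (List.length_pos_iff.2 hne)]; rfl
    have h2 := YoungDiagram.mem_iff_lt_rowLen.1 ((hs _ _).1 h1)
    omega
  exact ⟨T.attach.map fun c => ⟨c.1, hcol c.1 c.2⟩, by rw [Set.mem_ofPred_eq]; simpa using hlen, by simp⟩

/-! ### Column insertion -/

/-- Whether the letter `b` bumps the entry `c`: `b ≤ c` for `b` barred, `b < c` for `b`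
unbarred. -/
def bumps (m n : ℕ) (b c : Letter m n) : Bool :=
  if deg m n b = 0 then decide (b ≤ c) else decide (b < c)

/-- Insert `b` into a (weakly increasing) column: it replaces the smallest entry that it bumps,
in the highest position, or is put at the bottom. The second component is the entry bumped
out, if any. -/
def insertColumn (m n : ℕ) (b : Letter m n) :
    List (Letter m n) → List (Letter m n) × Option (Letter m n)
  | [] => ([b], none)
  | c :: cs =>
    if bumps m n b c then (b :: cs, some c)
    else (c :: (insertColumn m n b cs).1, (insertColumn m n b cs).2)

/-- Schensted's column bumping `T ← b`. -/
def insertTableau (m n : ℕ) (b : Letter m n) :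
    List (List (Letter m n)) → List (List (Letter m n))
  | [] => [[b]]
  | C :: T =>
    match (insertColumn m n b C).2 with
    | none => (insertColumn m n b C).1 :: T
    | some b' => (insertColumn m n b C).1 :: insertTableau m n b' T

/-- The tableau `P(w) = (⋯(w₁ ← w₂)⋯) ← w_r`. -/
def insertionTableau (m n : ℕ) (w : List (Letter m n)) : List (List (Letter m n)) :=
  w.foldl (fun T b => insertTableau m n b T) []

/-! ### The dual matrix set -/

/-- The set `M♯` of matrices of nonnegative integers, with entries at most `1` where the degrees
of the row and column index agree. -/
def MSharp (m n u v : ℕ) : Type :=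
  {A : Matrix (Letter m n) (Letter u v) ℕ // ∀ b b', deg m n b = deg u v b' → A b b' ≤ 1}

/-- The biword `(i, j)` of a matrix: `(b, b')` occurs `a_{bb'}` times; the pairs are sorted by
increasing `b'`, and for equal `b'` by increasing `b` if `b'` is barred and by decreasing `b` if
`b'` is unbarred. -/
def biword {m n u v : ℕ} (A : MSharp m n u v) : List (Letter m n × Letter u v) :=
  (List.finRange (u + v)).flatMap fun b' =>
    (if deg u v b' = 0 then List.finRange (m + n) else (List.finRange (m + n)).reverse).flatMap
      fun b => List.replicate (A.1 b b') (b, b')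

/-- The biword `(k, l)` of a matrix: `(b, b')` occurs `a_{bb'}` times; the pairs are sorted by
decreasing `b`, and for equal `b` by increasing `b'` if `b` is barred and by decreasing `b'` if
`b` is unbarred. -/
def biwordStar {m n u v : ℕ} (A : MSharp m n u v) : List (Letter m n × Letter u v) :=
  (List.finRange (m + n)).reverse.flatMap fun b =>
    (if deg m n b = 0 then List.finRange (u + v) else (List.finRange (u + v)).reverse).flatMap
      fun b' => List.replicate (A.1 b b') (b, b')

/-- The pair of words `(i, j)` of a matrix. -/
def words {m n u v : ℕ} (A : MSharp m n u v) : List (Letter m n) × List (Letter u v) :=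
  ((biword A).map Prod.fst, (biword A).map Prod.snd)

/-- The pair of words `(k, l)` of a matrix. -/
def wordsStar {m n u v : ℕ} (A : MSharp m n u v) : List (Letter m n) × List (Letter u v) :=
  ((biwordStar A).map Prod.fst, (biwordStar A).map Prod.snd)

/-- `gl_{m|n}` acts on pairs of words `(i, j)` through `i`. -/
def biwordCrystal (m n u v : ℕ) :
    CrystalData m n (List (Letter m n) × List (Letter u v)) :=
  (wordCrystal m n).onFst (List (Letter u v))

/-- `gl_{u|v}` acts on pairs of words `(k, l)` through `l`. -/
def biwordStarCrystal (m n u v : ℕ) :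
    CrystalData u v (List (Letter m n) × List (Letter u v)) :=
  (wordCrystal u v).onSnd (List (Letter m n))

/-- The `gl_{m|n}`-crystal `M♯`. -/
noncomputable def matrixCrystal (m n u v : ℕ) : CrystalData m n (MSharp m n u v) :=
  (biwordCrystal m n u v).pullback words

/-- The `gl_{u|v}`-crystal `M♯`. -/
noncomputable def matrixStarCrystal (m n u v : ℕ) : CrystalData u v (MSharp m n u v) :=
  (biwordStarCrystal m n u v).pullback wordsStar

/-- `π♯(A) = (P(i), P(l))`. -/
def piSharp {m n u v : ℕ} (A : MSharp m n u v) :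
    List (List (Letter m n)) × List (List (Letter u v)) :=
  (insertionTableau m n (words A).1, insertionTableau u v (wordsStar A).2)

/-- The set of highest weight elements of `M♯`. -/
def highestWeightElements (m n u v : ℕ) : Set (MSharp m n u v) :=
  {A | ∃ (lam : YoungDiagram) (hl : lam ∈ hookPartitions m n)
      (mu : YoungDiagram) (hm : mu ∈ hookPartitions u v),
      piSharp A = (highestTableau m n lam hl, highestTableau u v mu hm)}

/-- The number `ν_{c+1} = κ_{c+1} - κ_{c+2}`, where `κ` is the conjugate of the partition
`(λ_{m+1}, λ_{m+2}, …)`, so that `ν_{c+1} + ν_{c+2} + ⋯ = κ_{c+1}`. It is `0` for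
`c + 1 > λ_{m+1}`. -/
def nu (m : ℕ) (lam : YoungDiagram) (c : ℕ) : ℕ :=
  (lam.colLen c - m) - (lam.colLen (c + 1) - m)

/-- The matrix `A♯_λ`. With `k, l, s, t` counted from `0`, its four blocks are:
barred-barred, `1` if `l < λ_{k+1}`, else `0`;
barred-unbarred, the diagonal entries `max (λ_{t+1} - u) 0`;
unbarred-barred, `ν_{s+l+1}`;
unbarred-unbarred, `1` if `m ≤ t` and `u + s < λ_{t+1}`, else `0`.
The last block vanishes if `v ≤ m` or `n ≤ u`, see `aSharp_unbarred_unbarred`. -/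
def aSharp (m n u v : ℕ) (lam : YoungDiagram) : MSharp m n u v :=
  ⟨Matrix.of fun b b' =>
      Fin.addCases
        (fun k : Fin m => Fin.addCases
          (fun l : Fin u => if l.val < lam.rowLen k then 1 else 0)
          (fun t : Fin v => if k.val = t.val then lam.rowLen t - u else 0) b')
        (fun s : Fin n => Fin.addCases
          (fun l : Fin u => nu m lam (s + l))
          (fun t : Fin v => if m ≤ t.val ∧ u + s.val < lam.rowLen t then 1 else 0) b') b, by
    intro b b'
    refine Fin.addCases (fun k => ?_) (fun s => ?_) b <;>
      refine Fin.addCases (fun l => ?_) (fun t => ?_) b' <;>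
      simp [deg] <;> split_ifs <;> omega⟩

theorem aSharp_unbarred_unbarred (m n u v : ℕ) (lam : YoungDiagram)
    (h : lam ∈ hookPartitions m n) (hv : v ≤ m ∨ n ≤ u) (s : Fin n) (t : Fin v) :
    (aSharp m n u v lam).1 (unbarred m n s) (unbarred u v t) = 0 := by
  have h1 : lam.rowLen m ≤ n := h
  have h2 : m ≤ t.val → lam.rowLen t ≤ lam.rowLen m := fun hm => lam.rowLen_anti _ _ hm
  simp only [aSharp, unbarred, Matrix.of_apply, Fin.addCases_right]
  rw [if_neg]
  rintro ⟨h3, h4⟩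
  have := h2 h3
  have := t.2
  omega

/-- The partitions in `P_{m|n} ∩ P_{v|u}`. -/
abbrev CommonPartition (m n u v : ℕ) : Type :=
  {lam : YoungDiagram // lam ∈ hookPartitions m n ∩ hookPartitions v u}

/-- The underlying set of `⊕_λ B_{m|n}(λ) × B_{u|v}(λ')`. -/
abbrev TableauPairs (m n u v : ℕ) : Type :=
  Σ lam : CommonPartition m n u v,
    hookTableaux m n lam.1 × hookTableaux u v lam.1.transpose

/-- The `gl_{m|n}`-crystal `⊕_λ B_{m|n}(λ) × B_{u|v}(λ')`. -/
noncomputable def pairsCrystal (m n u v : ℕ) : CrystalData m n (TableauPairs m n u v) :=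
  CrystalData.directSum fun lam : CommonPartition m n u v =>
    (tableauCrystal m n lam.1).onFst (hookTableaux u v lam.1.transpose)

/-- The `gl_{u|v}`-crystal `⊕_λ B_{m|n}(λ) × B_{u|v}(λ')`. -/
noncomputable def pairsStarCrystal (m n u v : ℕ) : CrystalData u v (TableauPairs m n u v) :=
  CrystalData.directSum fun lam : CommonPartition m n u v =>
    (tableauCrystal u v lam.1.transpose).onSnd (hookTableaux m n lam.1)

/-- The ring of formal power series over `ℤ` in the variables `x_b` and `y_{b'}`. -/
abbrev Series (m n u v : ℕ) : Type := MvPowerSeries (Letter m n ⊕ Letter u v) ℤ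

/-- The variable `x_b`. -/
noncomputable def xVar (m n u v : ℕ) (b : Letter m n) : Series m n u v :=
  MvPowerSeries.X (Sum.inl b)

/-- The variable `y_{b'}`. -/
noncomputable def yVar (m n u v : ℕ) (b' : Letter u v) : Series m n u v :=
  MvPowerSeries.X (Sum.inr b')

/-- `∏_{|b| = |b'|} (1 + x_b y_{b'})`. -/
noncomputable def cauchyNumerator (m n u v : ℕ) : Series m n u v :=
  ∏ p : Letter m n × Letter u v with deg m n p.1 = deg u v p.2,
    (1 + xVar m n u v p.1 * yVar m n u v p.2)

/-- `∏_{|b| ≠ |b'|} (1 - x_b y_{b'})`. -/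
noncomputable def cauchyDenominator (m n u v : ℕ) : Series m n u v :=
  ∏ p : Letter m n × Letter u v with deg m n p.1 ≠ deg u v p.2,
    (1 - xVar m n u v p.1 * yVar m n u v p.2)

end HookCrystal

open HookCrystal
open scoped MvPowerSeries.WithPiTopology

/-! The map `π♯` is a Robinson–Schensted–Knuth correspondence in which both tableaux are insertion
tableaux, one for each reading of the matrix. Two facts about column insertion carry the proof.

Insertion commutes with the crystal operators. Replacing a word by the column reading of its tableau
(`normalForm`) is a composite of moves on three consecutive letters. Each such move is respected by
`f_i`; this is a finite check (`knuth_step`), because a letter other than the two ends of the arrow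
`i` compares in the same way with both ends. The tensor product rule sees a factor only through its
`ε_i` and `φ_i` (`word_append`), so relations respected by `f_i` may be concatenated and composed
(`Stable.concat`, `Stable.comp`). This gives `wordF_normalForm`, and also that `f_i` does not change
the shape of `P(w)`.

The tableaux `P(i)` and `P(l)` have conjugate shapes (`conj_words`). Standardization (`wordTab_map`)
reduces this to a finite set of points with distinct positions and distinct values
(`conj_strictShape`), and the induction deletes the last point and the lowest point. On one side
this deletes the last and the smallest letter, on the other the last and the largest. Deleting the
largest letter obeys an evident local rule: that letter ends a column and moves only when another
insertion ends there. Deleting the smallest letter obeys the transposed rule; this is harder and is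
obtained by an induction in which three kinds of local rules meet in a cube of shapes (`cube`,
`faces_word`).

Applied to a matrix whose columns are cut off at `c`, the symmetry says that the part of `P(l)` with
letters below `c` has the shape conjugate to that of the tableau of an initial segment of `i`
(`conj_restrictLens`). So `P(l)` records the growth of `P(i)`. An operator `f_i` acts on an initial
segment of `i` as `f_i` or not at all, hence keeps all these shapes and therefore `P(l)`; the other
action is symmetric. Moreover the segment of `i` that belongs to one letter `b'` is a column word or
a row word. Its insertion adds a strip with at most one box per row or per column, and can be undone
in exactly one way when the strip is known (`strip_unique`, `strip_exists`). Thus `π♯` is a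
bijection onto pairs of tableaux of conjugate shapes that intertwines both actions. On pairs the two
actions visibly commute, hence they commute on matrices.

For the highest weight elements, injectivity leaves only the evaluation of `π♯` at `A♯_λ`. The
tableau `P(l)` is computed column by column (`wordTab_rowWords`); then `P(i)` has shape `λ` by
symmetry, and its content leaves only the highest weight tableau (`eq_highestTableau`). The Cauchy
identity is the sum of the monomials of all matrices, expanded entry by entry on one side and
grouped by the shape of the tableaux on the other. -/

namespace HookCrystal

/-! ### Shapes as sequences of column lengths -/

section Shapes

/-- Add a box at the bottom of column `j`. -/
def addBox (c : ℕ → ℕ) (j : ℕ) : ℕ → ℕ := Function.update c j (c j + 1)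

theorem addBox_apply (c : ℕ → ℕ) (j k : ℕ) :
    addBox c j k = if k = j then c k + 1 else c k := by
  unfold addBox Function.update
  split_ifs with h
  · subst h; rfl
  · rfl

theorem addBox_comm (c : ℕ → ℕ) (i j : ℕ) : addBox (addBox c i) j = addBox (addBox c j) i := by
  funext k; simp only [addBox_apply]; split_ifs <;> omega

theorem addBox_inj {c : ℕ → ℕ} {i j : ℕ} (h : addBox c i = addBox c j) : i = j := by
  by_contra hne
  have := congrFun h i
  simp [addBox_apply, hne] at this

/-- The box after the one in column `j` that column bumping creates for the transposed local
rule: `k` is the column in which the row below the last box of column `j` ends. -/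
def IsNextRow (c : ℕ → ℕ) (j k : ℕ) : Prop := k ≤ j ∧ c k = c j ∧ ∀ i < k, c i ≠ c j

/-- The local rule of column insertion. -/
def ColFace (a b g d : ℕ → ℕ) : Prop :=
  ∃ i j, b = addBox a i ∧ g = addBox a j ∧ d = addBox b (if i = j then j + 1 else j)

/-- The local rule of row insertion. -/
def RowFace (a b g d : ℕ → ℕ) : Prop :=
  ∃ i j k, b = addBox a i ∧ g = addBox a j ∧ d = addBox b k ∧ (i ≠ j → k = j) ∧
    (i = j → IsNextRow b i k)

/-- The relation between the four shapes obtained by possibly removing the smallest and the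
largest letter. -/
def ExtremeFace (a b g d : ℕ → ℕ) : Prop :=
  ∃ i j k, b = addBox a i ∧ g = addBox a j ∧ d = addBox b k ∧ (i ≠ j → k = j) ∧
    (i = j → k = i ∨ (k = i + 1 ∧ a (i + 1) = a i))

/-- The eight shapes belong to a word with or without its largest letter `M`, its smallest letter
`m` and its last letter `x`; the letter `b` in place of `a` marks that `x` is appended. Four faces
of this cube are given, and they force the remaining two, the row face with `M` and the extreme face
with `x`. A face only tells which columns receive a box, so the proof compares the column `i` of
`M`, the column `g` of `m` and the column `x` of the last letter. -/
theorem cube {a aM am amM b bM bm bmM : ℕ → ℕ} (hN : ExtremeFace a aM am amM)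
    (hC : ColFace a b aM bM) (hR : RowFace a b am bm) (hC' : ColFace am bm amM bmM)
    (h1 : Antitone b) (h2 : Antitone aM) (h3 : Antitone am) (h4 : Antitone amM)
    (h5 : Antitone bm) :
    RowFace aM bM amM bmM ∧ ExtremeFace b bM bm bmM := by
  obtain ⟨i, g, d, rfl, rfl, rfl, hN1, hN2⟩ := hN
  obtain ⟨x, i', rfl, hi', rfl⟩ := hC
  obtain rfl := addBox_inj hi'
  obtain ⟨x', g', h, hx', hg', rfl, hR1, hR2⟩ := hR
  obtain rfl := addBox_inj hx'
  obtain rfl := addBox_inj hg'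
  obtain ⟨x'', d', hx'', hd', rfl⟩ := hC'
  by_cases hig : i = g
  · subst hig
    have hd := addBox_inj hd'
    subst hd
    by_cases hxi : x = i
    · -- all three boxes agree
      subst hxi
      have hh := addBox_inj hx''
      subst hh
      have hnext := hR2 rfl
      rcases hN2 rfl with rfl | ⟨rfl, hadj⟩
      · have hh : h = d := by
          by_contra hne
          have hlt : h < d := lt_of_le_of_ne hnext.1 hne
          have := hnext.2.1
          have h6 := h4 hlt.le
          simp only [addBox_apply] at this h6
          simp at this h6
          split_ifs at this h6 <;> omega
        subst hh
        simp only [if_true]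
        refine ⟨⟨h + 1, h, h, rfl, rfl, ?_, fun _ => rfl, fun h => by omega⟩,
          ⟨h + 1, h, h, rfl, rfl, ?_, fun _ => rfl, fun h => by omega⟩⟩ <;>
        (funext k; simp only [addBox_apply]; split_ifs <;> omega)
      · have hne : h ≠ x + 1 := by have := hnext.1; omega
        rw [if_pos rfl, if_neg hne]
        refine ⟨⟨x + 1, x + 1, h, rfl, rfl, ?_, fun hh => absurd rfl hh, fun _ => ⟨?_, ?_, ?_⟩⟩,
          ⟨x + 1, h, h, rfl, rfl, ?_, fun _ => rfl, fun hh => absurd hh.symm hne⟩⟩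
        · funext k; simp only [addBox_apply]; split_ifs <;> omega
        · have := hnext.1; omega
        · have h6 := hnext.2.1
          simp only [addBox_apply] at h6 ⊢
          simp [hne] at h6 ⊢
          split_ifs at h6 ⊢ <;> omega
        · intro k hk
          have h6 := hnext.2.2 k hk
          have h7 := hnext.1
          simp only [addBox_apply] at h6 ⊢
          simp at h6 ⊢
          split_ifs at h6 ⊢ <;> omega
        · funext k; simp only [addBox_apply]; split_ifs <;> omega
    · -- the new box is elsewhere
      have hh := hR1 hxi
      subst hh
      have hx3 : x'' = x := by
        rw [addBox_comm] at hx''; exact (addBox_inj hx'').symm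
      subst hx3
      have hxd : x'' ≠ d := by
        rintro rfl
        rcases hN2 rfl with hh | ⟨rfl, hadj⟩
        · exact hxi hh
        · have h6 := h1 (Nat.le_succ h)
          simp only [addBox_apply] at h6
          simp at h6
          omega
      rw [if_neg hxi, if_neg hxd]
      refine ⟨⟨x'', d, d, addBox_comm _ _ _, rfl, ?_, fun _ => rfl, fun hh => absurd hh hxd⟩,
        ⟨h, h, d, rfl, rfl, ?_, fun hh => absurd rfl hh, fun _ => ?_⟩⟩
      · rfl
      · rfl
      · rcases hN2 rfl with hh | ⟨rfl, hadj⟩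
        · exact Or.inl hh
        · refine Or.inr ⟨rfl, ?_⟩
          simp only [addBox_apply]
          rw [if_neg (Ne.symm hxd), if_neg (Ne.symm hxi)]; exact hadj
  · have hd := hN1 hig
    subst hd
    have hd2 : d' = i := by
      rw [addBox_comm] at hd'; exact (addBox_inj hd').symm
    subst hd2
    by_cases hxg : x = d
    · subst hxg
      have hh := addBox_inj hx''
      subst hh
      have hnext := hR2 rfl
      have hxd' : x ≠ d' := fun hh => hig hh.symm
      rw [if_neg hxd']
      by_cases hhd : h = d'
      · subst hhd
        -- Here `M` occupies the box to which the row rule sends the second box. The columns from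
        -- `h` to `x` have equal lengths once `x` is added, so the next place is the right neighbour
        -- `h + 1` in the same row, which is the second alternative of `ExtremeFace`.
        have hlt : h < x := lt_of_le_of_ne hnext.1 hig
        have hanti : Antitone (addBox a x) := h1
        have hmid : addBox a x (h + 1) = addBox a x h :=
          le_antisymm (hanti (Nat.le_succ h)) (by rw [hnext.2.1]; exact hanti hlt)
        simp only [if_true]
        refine ⟨⟨x, x, h + 1, addBox_comm _ _ _, rfl, rfl, fun hh => absurd rfl hh,
            fun _ => ⟨hlt, ?_, ?_⟩⟩,
          ⟨h, h, h + 1, rfl, rfl, rfl, fun hh => absurd rfl hh,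
            fun _ => Or.inr ⟨rfl, hmid⟩⟩⟩
        · rw [addBox_apply _ h, addBox_apply _ h, if_neg (by omega), if_neg (Ne.symm hig), hmid,
            hnext.2.1]
        · intro k hk
          rw [addBox_apply _ h, addBox_apply _ h, if_neg (Ne.symm hig)]
          have h8 := hnext.2.2 k
          by_cases hkh : k = h
          · rw [if_pos hkh, hkh, hnext.2.1]; omega
          · rw [if_neg hkh]; exact h8 (by omega)
      · rw [if_neg hhd]
        have h9 : addBox (addBox a x) d' = addBox (addBox a d') x := addBox_comm _ _ _
        refine ⟨⟨x, x, h, addBox_comm _ _ _, rfl, ?_, fun hh => absurd rfl hh,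
            fun _ => ⟨hnext.1, ?_, ?_⟩⟩,
          ⟨d', h, h, rfl, rfl, ?_, fun _ => rfl, fun hh => absurd hh.symm hhd⟩⟩
        · funext k; simp only [addBox_apply]; split_ifs <;> omega
        · rw [addBox_apply _ d', addBox_apply _ d', if_neg hhd, if_neg hxd']; exact hnext.2.1
        · intro k hk
          have h8 := hnext.2.2 k hk
          have h10 := h1 (hk.le.trans hnext.1)
          rw [addBox_apply _ d', addBox_apply _ d', if_neg hxd']
          split_ifs <;> omega
        · funext k; simp only [addBox_apply]; split_ifs <;> omega
    · have hh := hR1 hxg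
      subst hh
      have hx3 : x'' = x := by
        rw [addBox_comm] at hx''; exact (addBox_inj hx'').symm
      subst hx3
      by_cases hxi : x'' = d'
      · subst hxi
        simp only [if_true]
        refine ⟨⟨x'' + 1, h, h, rfl, rfl, ?_, fun _ => rfl, fun hh => ⟨by omega, by rw [hh], ?_⟩⟩,
          ⟨x'' + 1, h, h, rfl, rfl, ?_, fun _ => rfl, fun hh => Or.inl hh.symm⟩⟩
        · funext k; simp only [addBox_apply]; split_ifs <;> omega
        · subst hh
          intro k hk
          have h6 := h3 (Nat.le_succ x'')
          have h7 := h2 (Nat.lt_succ_iff.1 hk)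
          simp only [addBox_apply] at h6 h7 ⊢
          simp at h6 h7 ⊢
          split_ifs at h6 h7 ⊢ <;> omega
        · funext k; simp only [addBox_apply]; split_ifs <;> omega
      · rw [if_neg hxi]
        refine ⟨⟨x'', h, h, addBox_comm _ _ _, rfl, ?_, fun _ => rfl, fun hh => absurd hh hxg⟩,
          ⟨d', h, h, rfl, rfl, ?_, fun _ => rfl, fun hh => absurd hh hig⟩⟩ <;>
        (funext k; simp only [addBox_apply]; split_ifs <;> omega)

/-- Two sequences are conjugate partitions: column lengths and row lengths of one shape. -/
def Conj (c r : ℕ → ℕ) : Prop := ∀ i j, i < c j ↔ j < r i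

theorem Conj.symm {c r : ℕ → ℕ} (h : Conj c r) : Conj r c := fun i j => (h j i).symm

theorem Conj.antitone {c r : ℕ → ℕ} (h : Conj c r) : Antitone c := by
  intro a b hab
  by_contra hlt
  have h1 := (h (c a) b).1 (by omega)
  have h2 := (h (c a) a).2 (by omega)
  omega

theorem Conj.unique {c r r' : ℕ → ℕ} (h : Conj c r) (h' : Conj c r') : r = r' := by
  funext i
  apply le_antisymm <;> by_contra hlt
  · have := (h i (r' i)).2 (by omega); have := (h' i (r' i)).1 this; omega
  · have := (h' i (r i)).2 (by omega); have := (h i (r i)).1 this; omega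

/-- The hypothesis `hj` says that row `c j` ends just before column `j`, so that the new box is a
corner of both descriptions of the shape. -/
theorem Conj.addBox {c r : ℕ → ℕ} (h : Conj c r) {j : ℕ} (hj : r (c j) = j) :
    Conj (addBox c j) (addBox r (c j)) := by
  intro a b
  have h1 := h a b
  simp only [addBox_apply]
  split_ifs with h2 h3 h3
  · subst h2 h3; omega
  · subst h2; omega
  · subst h3
    rw [hj] at h1 ⊢; omega
  · exact h1

/-- The column of the box added to a shape is determined by the row, in conjugate shapes. -/
theorem Conj.box {c r : ℕ → ℕ} {i k : ℕ} (h : Conj c r)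
    (h' : Conj (HookCrystal.addBox c i) (HookCrystal.addBox r k)) : k = c i ∧ r k = i := by
  have h1 := (h' (c i) i).1 (by simp [addBox_apply])
  have h2 := (h (c i) i)
  have hk : k = c i := by
    by_contra hne
    rw [addBox_apply, if_neg (Ne.symm hne)] at h1
    have := h2.2 h1; omega
  refine ⟨hk, ?_⟩
  subst hk
  rw [addBox_apply, if_pos rfl] at h1
  omega

/-- The row rule is the column rule for conjugate shapes: when the two boxes coincide, the next one
goes to the end of the following row, which on the conjugate side is the bottom of the following
column. Hence conjugacy at three corners of a face implies it at the fourth. -/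
theorem Conj.of_faces {a b g d a' b' g' d' : ℕ → ℕ} (hR : RowFace a b g d)
    (hC : ColFace a' g' b' d') (ha : Conj a a') (hb : Conj b b') (hg : Conj g g') :
    Conj d d' := by
  obtain ⟨i, j, k, rfl, rfl, rfl, h1, h2⟩ := hR
  obtain ⟨j', i', rfl, rfl, rfl⟩ := hC
  obtain ⟨hi, hi'⟩ := ha.box hb
  obtain ⟨hj, hj'⟩ := ha.box hg
  by_cases hij : i = j
  · subst hij
    have : i' = j' := by omega
    subst this
    have hn := h2 rfl
    rw [if_pos rfl]
    have h3 : HookCrystal.addBox a i k = i' + 1 := by rw [hn.2.1, addBox_apply, if_pos rfl, hi]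
    rw [← h3]
    refine hb.addBox ?_
    rw [h3]
    apply le_antisymm
    · by_contra hlt
      have h5 := (hb (i' + 1) k).2 (by omega)
      omega
    · by_contra hlt
      have h6 : ¬ i' + 1 < HookCrystal.addBox a i (HookCrystal.addBox a' i' (i' + 1)) :=
        fun h => by have := (hb _ _).1 h; omega
      have h7 := hb.antitone (a := HookCrystal.addBox a' i' (i' + 1)) (b := k) (by omega)
      have h8 := hn.2.2 (HookCrystal.addBox a' i' (i' + 1)) (by omega)
      have h9 := hn.2.1
      omega
  · have hk := h1 hij
    subst hk
    have hne : j' ≠ i' := fun h => hij (by rw [← hi', ← hj', h])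
    rw [if_neg hne]
    have h3 : HookCrystal.addBox a i k = j' := by rw [addBox_apply, if_neg (Ne.symm hij), hj]
    rw [addBox_comm a' j' i']
    have h4 := hb.addBox (j := k) (by rw [h3, addBox_apply, if_neg hne, hj'])
    rwa [h3] at h4

end Shapes

end HookCrystal


namespace HookCrystal

/-! ### Column insertion over an ordered alphabet -/

section Insertion

variable {α : Type*}

/-- `colLens T j` is the length of the column `j` of `T`. -/
def colLens : List (List α) → ℕ → ℕ
  | [], _ => 0
  | C :: _, 0 => C.length
  | _ :: T, j + 1 => colLens T j

@[simp] theorem colLens_nil (j : ℕ) : colLens ([] : List (List α)) j = 0 := rfl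
@[simp] theorem colLens_cons_zero (C : List α) (T) : colLens (C :: T) 0 = C.length := rfl
@[simp] theorem colLens_cons_succ (C : List α) (T) (j : ℕ) :
    colLens (C :: T) (j + 1) = colLens T j := rfl

theorem colLens_eq (T : List (List α)) (j : ℕ) : colLens T j = (T[j]?.getD []).length := by
  induction T generalizing j with
  | nil => simp
  | cons C T ih => cases j <;> simp [ih]

theorem colLens_congr {β : Type*} {T : List (List α)} {U : List (List β)}
    (h : T.map List.length = U.map List.length) : colLens T = colLens U := by
  induction T generalizing U with
  | nil =>
    cases U with
    | nil => funext j; rfl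
    | cons D U => simp at h
  | cons C T ih =>
    cases U with
    | nil => simp at h
    | cons D U =>
      simp only [List.map_cons, List.cons.injEq] at h
      funext j
      cases j <;> simp [h.1, ih h.2]

/-- Insertion into a column with respect to a bumping relation. -/
def colInsert (r : α → α → Bool) (b : α) : List α → List α × Option α
  | [] => ([b], none)
  | c :: cs =>
    if r b c then (b :: cs, some c)
    else (c :: (colInsert r b cs).1, (colInsert r b cs).2)

/-- Column bumping with respect to a bumping relation. -/
def tabInsert (r : α → α → Bool) (b : α) : List (List α) → List (List α)
  | [] => [[b]]
  | C :: T =>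
    match (colInsert r b C).2 with
    | none => (colInsert r b C).1 :: T
    | some b' => (colInsert r b C).1 :: tabInsert r b' T

/-- The column in which the insertion of `b` ends. -/
def endCol (r : α → α → Bool) (b : α) : List (List α) → ℕ
  | [] => 0
  | C :: T =>
    match (colInsert r b C).2 with
    | none => 0
    | some b' => endCol r b' T + 1

/-- The insertion tableau of a word. -/
def wordTab (r : α → α → Bool) (w : List α) : List (List α) :=
  w.foldl (fun T b => tabInsert r b T) []

@[simp] theorem wordTab_nil (r : α → α → Bool) : wordTab r [] = [] := rfl

@[simp] theorem wordTab_concat (r : α → α → Bool) (w : List α) (b : α) :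
    wordTab r (w ++ [b]) = tabInsert r b (wordTab r w) := by
  simp [wordTab]

variable {r : α → α → Bool}

theorem tabInsert_cons_none {b : α} {C : List α} (T) (h : (colInsert r b C).2 = none) :
    tabInsert r b (C :: T) = (colInsert r b C).1 :: T := by
  simp only [tabInsert]; rw [h]

theorem tabInsert_cons_some {b b' : α} {C : List α} (T) (h : (colInsert r b C).2 = some b') :
    tabInsert r b (C :: T) = (colInsert r b C).1 :: tabInsert r b' T := by
  simp only [tabInsert]; rw [h]

theorem endCol_cons_none {b : α} {C : List α} (T) (h : (colInsert r b C).2 = none) :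
    endCol r b (C :: T) = 0 := by
  simp only [endCol]; rw [h]

theorem endCol_cons_some {b b' : α} {C : List α} (T) (h : (colInsert r b C).2 = some b') :
    endCol r b (C :: T) = endCol r b' T + 1 := by
  simp only [endCol]; rw [h]

theorem colInsert_none_iff {b : α} {C : List α} :
    (colInsert r b C).2 = none ↔ ∀ c ∈ C, r b c = false := by
  induction C with
  | nil => simp [colInsert]
  | cons c C ih =>
    by_cases h : r b c <;> simp [colInsert, h, ih]

theorem colInsert_fst_of_none {b : α} {C : List α} (h : (colInsert r b C).2 = none) :
    (colInsert r b C).1 = C ++ [b] := by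
  induction C with
  | nil => simp [colInsert]
  | cons c C ih =>
    by_cases hc : r b c
    · simp [colInsert, hc] at h
    · simp only [colInsert, hc] at h ⊢
      simp [ih h]

theorem colInsert_some {b c : α} {C : List α} (h : (colInsert r b C).2 = some c) :
    ∃ X Y, C = X ++ c :: Y ∧ (colInsert r b C).1 = X ++ b :: Y ∧ r b c = true ∧
      ∀ x ∈ X, r b x = false := by
  induction C with
  | nil => simp [colInsert] at h
  | cons d C ih =>
    by_cases hd : r b d
    · simp [colInsert, hd] at h
      subst h
      exact ⟨[], C, rfl, by simp [colInsert, hd], hd, by simp⟩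
    · simp only [colInsert, hd] at h
      obtain ⟨X, Y, h1, h2, h3, h4⟩ := ih h
      refine ⟨d :: X, Y, by simp [h1], by simp [colInsert, hd, h2], h3, ?_⟩
      intro x hx
      rcases List.mem_cons.1 hx with rfl | hx
      · simpa using hd
      · exact h4 x hx

theorem colInsert_length {b : α} {C : List α} :
    (colInsert r b C).1.length = C.length + (if (colInsert r b C).2 = none then 1 else 0) := by
  split_ifs with h
  · rw [colInsert_fst_of_none h]; simp
  · obtain ⟨c, hc⟩ := Option.ne_none_iff_exists'.1 h
    obtain ⟨X, Y, h1, h2, -⟩ := colInsert_some hc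
    rw [h2, h1]; simp

theorem colLens_tabInsert (b : α) (T : List (List α)) :
    colLens (tabInsert r b T) = addBox (colLens T) (endCol r b T) := by
  induction T generalizing b with
  | nil =>
    funext j
    cases j <;> simp [tabInsert, endCol, addBox_apply]
  | cons C T ih =>
    funext j
    cases h : (colInsert r b C).2 with
    | none =>
      rw [tabInsert_cons_none T h, endCol_cons_none T h]
      cases j <;> simp [addBox_apply, colInsert_fst_of_none h]
    | some b' =>
      rw [tabInsert_cons_some T h, endCol_cons_some T h]
      cases j <;> simp [addBox_apply, ih, colInsert_length, h]

theorem tabInsert_perm (b : α) (T : List (List α)) :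
    (tabInsert r b T).flatten.Perm (b :: T.flatten) := by
  induction T generalizing b with
  | nil => simp [tabInsert]
  | cons C T ih =>
    cases h : (colInsert r b C).2 with
    | none =>
      rw [tabInsert_cons_none T h, colInsert_fst_of_none h]
      simp only [List.flatten_cons, List.append_assoc, List.singleton_append]
      exact List.perm_middle
    | some b' =>
      rw [tabInsert_cons_some T h]
      obtain ⟨X, Y, h1, h2, -⟩ := colInsert_some h
      rw [h2, h1]
      simp only [List.flatten_cons, List.append_assoc, List.cons_append]
      refine List.perm_middle.trans (List.Perm.cons b ?_)
      refine List.Perm.append_left X ?_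
      refine (List.Perm.append_left Y (ih b')).trans ?_
      exact List.perm_middle

theorem wordTab_perm (w : List α) : (wordTab r w).flatten.Perm w := by
  induction w using List.reverseRecOn with
  | nil => simp
  | append_singleton w b ih =>
    rw [wordTab_concat]
    exact (tabInsert_perm b _).trans ((List.Perm.cons b ih).trans (List.perm_append_singleton b w).symm)

theorem mem_wordTab {r : α → α → Bool} {w : List α} {C : List α} {c : α} (hC : C ∈ wordTab r w)
    (hc : c ∈ C) : c ∈ w :=
  (wordTab_perm w).subset (List.mem_flatten.2 ⟨C, hC, hc⟩)

/-! ### Tableaux -/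

/-- Columns: no entry bumps an entry above it. -/
def IsCol (r : α → α → Bool) (C : List α) : Prop := C.Pairwise fun a b => r b a = false

/-- Compatibility of two adjacent columns: the right one is not longer, and each entry bumps its
right neighbour. -/
def RowOK (r : α → α → Bool) : List α → List α → Prop
  | _, [] => True
  | [], _ :: _ => False
  | c :: C, d :: D => r c d = true ∧ RowOK r C D

/-- Tableaux, as lists of columns. -/
def IsTab (r : α → α → Bool) : List (List α) → Prop
  | [] => True
  | C :: T => C ≠ [] ∧ IsCol r C ∧ RowOK r C (T.headD []) ∧ IsTab r T

@[simp] theorem rowOK_nil (C : List α) : RowOK r C [] := by cases C <;> simp [RowOK]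

theorem RowOK.length_le {C D : List α} (h : RowOK r C D) : D.length ≤ C.length := by
  induction C generalizing D with
  | nil => cases D <;> simp_all [RowOK]
  | cons c C ih =>
    cases D with
    | nil => simp
    | cons d D => simpa using ih h.2

theorem RowOK.append {C D : List α} (h : RowOK r C D) (E : List α) : RowOK r (C ++ E) D := by
  induction C generalizing D with
  | nil => cases D <;> simp_all [RowOK]
  | cons c C ih =>
    cases D with
    | nil => simp
    | cons d D => exact ⟨h.1, ih h.2⟩

theorem IsTab.tail {C : List α} {T} (h : IsTab r (C :: T)) : IsTab r T := h.2.2.2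

theorem IsTab.colLens_le {T : List (List α)} (h : IsTab r T) (j : ℕ) :
    colLens T (j + 1) ≤ colLens T j := by
  induction T generalizing j with
  | nil => simp
  | cons C T ih =>
    cases j with
    | zero =>
      have := h.2.2.1.length_le
      cases T <;> simp_all
    | succ j => simpa using ih h.tail j

theorem IsTab.antitone {T : List (List α)} (h : IsTab r T) : Antitone (colLens T) :=
  antitone_nat_of_succ_le h.colLens_le

/-- The properties of a bumping relation which the theory of insertion uses. -/
structure IsBump (r : α → α → Bool) : Prop where
  trans : ∀ x y z, r x y = true → r y z = true → r x z = true
  left : ∀ z y x, r z y = false → r z x = true → r y x = true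
  total : ∀ x y, r x y = true ∨ r y x = true ∨ x = y

theorem IsBump.neg_trans (hr : IsBump r) {x y z : α} (h1 : r x y = false) (h2 : r y z = false) :
    r x z = false := by
  by_contra h
  rw [Bool.not_eq_false] at h
  have h3 := hr.left _ _ _ h1 h
  rw [h2] at h3; cases h3

/-- If `z` bumps `x` and `y` does not bump `x`, then `y` does not bump `z`. -/
theorem IsBump.right (hr : IsBump r) {x y z : α} (h1 : r z x = true) (h2 : r y x = false) :
    r y z = false := by
  by_contra h
  rw [Bool.not_eq_false] at h
  rw [hr.trans _ _ _ h h1] at h2; cases h2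

theorem IsCol.insert (hr : IsBump r) {C : List α} (h : IsCol r C) (b : α) :
    IsCol r (colInsert r b C).1 := by
  cases hb : (colInsert r b C).2 with
  | none =>
    rw [colInsert_fst_of_none hb]
    rw [colInsert_none_iff] at hb
    simp only [IsCol, List.pairwise_append, List.pairwise_singleton, List.mem_singleton] at h ⊢
    exact ⟨h, trivial, fun x hx y hy => hy ▸ hb x hx⟩
  | some c =>
    obtain ⟨X, Y, h1, h2, h3, h4⟩ := colInsert_some hb
    rw [h2]
    subst h1
    simp only [IsCol, List.pairwise_append, List.pairwise_cons] at h ⊢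
    obtain ⟨hX, ⟨hc, hY⟩, hXY⟩ := h
    refine ⟨hX, ⟨fun y hy => ?_, hY⟩, fun x hx y hy => ?_⟩
    · exact hr.right h3 (hc y hy)
    · rcases List.mem_cons.1 hy with rfl | hy
      · exact h4 x hx
      · exact hXY x hx y (List.mem_cons_of_mem _ hy)

theorem RowOK.replace (hr : IsBump r) {X Y D : List α} {b c : α} (h : RowOK r (X ++ c :: Y) D)
    (hbc : r b c = true) : RowOK r (X ++ b :: Y) D := by
  induction X generalizing D with
  | nil =>
    cases D with
    | nil => simp
    | cons d D => exact ⟨hr.trans _ _ _ hbc h.1, h.2⟩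
  | cons x X ih =>
    cases D with
    | nil => simp
    | cons d D => exact ⟨h.1, ih h.2⟩

/-- The bumped letter `y` enters the next column in its old row or higher, because it bumps its old
right neighbour. In its old row its left neighbour is now `x`, which bumps it. In a higher row the
left neighbour is not bumped by `x` while `y` is, so `IsBump.left` applies. -/
theorem RowOK.insert (hr : IsBump r) {C D : List α} (h : RowOK r C D) {x y : α}
    (hy : (colInsert r x C).2 = some y) :
    RowOK r (colInsert r x C).1 (colInsert r y D).1 := by
  induction C generalizing D with
  | nil => simp [colInsert] at hy
  | cons c C ih =>
    by_cases hc : r x c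
    · simp only [colInsert, hc, if_true, Option.some.injEq] at hy ⊢
      subst hy
      cases D with
      | nil => exact ⟨hc, rowOK_nil _⟩
      | cons d D =>
        simp only [colInsert, h.1, if_true]
        exact ⟨hc, h.2⟩
    · have hc' : r x c = false := by simpa using hc
      simp only [colInsert, hc] at hy ⊢
      obtain ⟨X, Y, h1, h2, h3, h4⟩ := colInsert_some hy
      have hcy : r c y = true := hr.left _ _ _ hc' h3
      cases D with
      | nil => exact ⟨hcy, rowOK_nil _⟩
      | cons d D =>
        by_cases hd : r y d
        · simp only [colInsert, hd, if_true]
          refine ⟨hcy, ?_⟩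
          rw [h2]
          have := h.2
          rw [h1] at this
          exact this.replace hr h3
        · simp only [colInsert, hd]
          exact ⟨h.1, ih h.2 hy⟩

theorem IsTab.insert (hr : IsBump r) {T : List (List α)} (h : IsTab r T) (b : α) :
    IsTab r (tabInsert r b T) := by
  induction T generalizing b with
  | nil => simp [tabInsert, IsTab, IsCol]
  | cons C T ih =>
    have hne : (colInsert r b C).1 ≠ [] := by
      cases C <;> simp only [colInsert] <;> [simp; (split_ifs <;> simp)]
    cases hb : (colInsert r b C).2 with
    | none =>
      rw [tabInsert_cons_none T hb]
      refine ⟨hne, h.2.1.insert hr b, ?_, h.tail⟩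
      rw [colInsert_fst_of_none hb]
      exact h.2.2.1.append _
    | some c =>
      rw [tabInsert_cons_some T hb]
      refine ⟨hne, h.2.1.insert hr b, ?_, ih h.tail c⟩
      have h1 := h.2.2.1.insert hr hb
      cases T with
      | nil => simpa [tabInsert, colInsert] using h1
      | cons D T =>
        cases hc : (colInsert r c D).2 with
        | none => rw [tabInsert_cons_none T hc]; exact h1
        | some d => rw [tabInsert_cons_some T hc]; exact h1

theorem isTab_wordTab (hr : IsBump r) (w : List α) : IsTab r (wordTab r w) := by
  induction w using List.reverseRecOn with
  | nil => simp [IsTab]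
  | append_singleton w b ih => rw [wordTab_concat]; exact ih.insert hr b

/-! ### Removing the largest letter -/

/-- `AddMax M g T T'`: `T'` is `T` with `M` put at the bottom of column `g`. -/
inductive AddMax (M : α) : ℕ → List (List α) → List (List α) → Prop
  | nil : AddMax M 0 [] [[M]]
  | here (C T) : AddMax M 0 (C :: T) ((C ++ [M]) :: T)
  | there (C) {g T T'} : AddMax M g T T' → AddMax M (g + 1) (C :: T) (C :: T')

theorem AddMax.colLens_eq {M : α} {g : ℕ} {T T'} (h : AddMax M g T T') :
    colLens T' = addBox (colLens T) g := by
  induction h with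
  | nil => funext j; cases j <;> simp [addBox_apply]
  | here C T => funext j; cases j <;> simp [addBox_apply]
  | there C h ih => funext j; cases j <;> simp [addBox_apply, ih]

theorem colInsert_max {M : α} {C : List α} (h : ∀ c ∈ C, r M c = false) :
    colInsert r M C = (C ++ [M], none) := by
  have h1 := colInsert_none_iff.2 h
  exact Prod.ext (colInsert_fst_of_none h1) h1

theorem colInsert_append_of_none {x M : α} {C : List α} (h : (colInsert r x C).2 = none)
    (hM : r x M = true) : colInsert r x (C ++ [M]) = (C ++ [x], some M) := by
  induction C with
  | nil => simp [colInsert, hM]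
  | cons c C ih =>
    by_cases hc : r x c
    · simp [colInsert, hc] at h
    · simp only [colInsert, hc] at h
      simp [colInsert, hc, ih h]

theorem colInsert_append_of_some {x y M : α} {C : List α} (h : (colInsert r x C).2 = some y) :
    colInsert r x (C ++ [M]) = ((colInsert r x C).1 ++ [M], some y) := by
  induction C with
  | nil => simp [colInsert] at h
  | cons c C ih =>
    by_cases hc : r x c
    · simp [colInsert, hc] at h ⊢
      exact h
    · simp only [colInsert, hc] at h
      simp [colInsert, hc, ih h]

theorem addMax_tabInsert {M : α} {T : List (List α)} (h : ∀ C ∈ T, ∀ c ∈ C, r M c = false) :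
    AddMax M 0 T (tabInsert r M T) := by
  cases T with
  | nil => exact AddMax.nil
  | cons C T =>
    have h1 := colInsert_max (h C (by simp))
    rw [tabInsert_cons_none T (by rw [h1]), h1]
    exact AddMax.here C T

/-- Both insertions follow the same path unless the one into `T` ends in the column `g` of `M`. In
that case `M` is bumped and goes to the bottom of the next column. This is the source of `ColFace`.
-/
theorem AddMax.insert {M : α} {g : ℕ} {T T'} (h : AddMax M g T T') {x : α}
    (hx : r x M = true) (hT : ∀ C ∈ T, ∀ c ∈ C, r M c = false ∧ r c M = true) :
    AddMax M (if endCol r x T = g then g + 1 else g) (tabInsert r x T) (tabInsert r x T') := by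
  induction h generalizing x with
  | nil =>
    simp only [endCol, if_true, tabInsert, colInsert, hx]
    exact AddMax.there _ AddMax.nil
  | here C T =>
    cases hc : (colInsert r x C).2 with
    | none =>
      have h1 := colInsert_append_of_none hc hx
      rw [endCol_cons_none T hc, if_pos rfl, tabInsert_cons_none T hc,
        tabInsert_cons_some T (b' := M) (by rw [h1]), h1, colInsert_fst_of_none hc]
      exact AddMax.there _ (addMax_tabInsert fun D hD c hc => (hT D (by simp [hD]) c hc).1)
    | some y =>
      have h1 := colInsert_append_of_some (M := M) hc
      rw [endCol_cons_some T hc, if_neg (by omega), tabInsert_cons_some T hc,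
        tabInsert_cons_some T (b' := y) (by rw [h1]), h1]
      exact AddMax.here _ _
  | @there C g T T' h ih =>
    cases hc : (colInsert r x C).2 with
    | none =>
      rw [endCol_cons_none T hc, if_neg (by omega), tabInsert_cons_none T hc,
        tabInsert_cons_none T' hc]
      exact AddMax.there _ h
    | some y =>
      obtain ⟨X, Y, h1, -⟩ := colInsert_some hc
      have hy : y ∈ C := by rw [h1]; simp
      have := ih (hT C (by simp) y hy).2 (fun D hD => hT D (by simp [hD]))
      rw [endCol_cons_some T hc, tabInsert_cons_some T hc, tabInsert_cons_some T' hc]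
      have h2 := AddMax.there (colInsert r x C).1 this
      convert h2 using 1
      split_ifs <;> omega

/-! ### Removing the smallest letter -/

/-- Such a letter pushes the whole first row one step to the right, so a new column is opened. -/
theorem endCol_of_min {T : List (List α)} (hT : IsTab r T) {m : α}
    (hm : ∀ c, (T.headD []).head? = some c → r m c = true) : endCol r m T = T.length := by
  induction T generalizing m with
  | nil => rfl
  | cons C T ih =>
    obtain ⟨h1, h2, h3, h4⟩ := hT
    cases C with
    | nil => exact absurd rfl h1
    | cons c C =>
      have hc : r m c = true := hm c rfl
      have h5 : (colInsert r m (c :: C)).2 = some c := by simp [colInsert, hc]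
      rw [endCol_cons_some T h5, ih h4]
      · simp
      · intro d hd
        cases T with
        | nil => simp at hd
        | cons D T =>
          cases D with
          | nil => simp at hd
          | cons e D =>
            simp at hd
            subst hd
            exact h3.1

theorem IsTab.colLens_eq_zero_iff {T : List (List α)} (hT : IsTab r T) (j : ℕ) :
    colLens T j = 0 ↔ T.length ≤ j := by
  induction T generalizing j with
  | nil => simp
  | cons C T ih =>
    cases j with
    | zero => simpa using hT.1
    | succ j => simpa using ih hT.tail j

end Insertion

end HookCrystal


namespace HookCrystal

/-! ### Shapes of words without repetitions -/

section Faces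

variable {α : Type*} [LinearOrder α]

/-- The strict bumping relation. -/
def ltRel (x y : α) : Bool := decide (x < y)

theorem isBump_ltRel : IsBump (ltRel (α := α)) where
  trans x y z h1 h2 := by simp only [ltRel, decide_eq_true_eq] at *; exact h1.trans h2
  left z y x h1 h2 := by
    simp only [ltRel, decide_eq_true_eq, decide_eq_false_iff_not, not_lt] at *
    exact lt_of_le_of_lt h1 h2
  total x y := by
    simp only [ltRel, decide_eq_true_eq]
    rcases lt_trichotomy x y with h | h | h <;> simp [h]

/-- The column lengths of the insertion tableau of a word with respect to strict bumping. -/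
def strictShape (w : List α) : ℕ → ℕ := colLens (wordTab ltRel w)

theorem strictShape_antitone (w : List α) : Antitone (strictShape w) :=
  (isTab_wordTab isBump_ltRel w).antitone

/-- Remove a letter. -/
def del (m : α) (w : List α) : List α := w.filter fun y => decide (y ≠ m)

theorem mem_del {m y : α} {w : List α} : y ∈ del m w ↔ y ∈ w ∧ y ≠ m := by simp [del]

theorem del_append (m : α) (w w' : List α) : del m (w ++ w') = del m w ++ del m w' := by
  simp [del]

theorem del_self (m : α) : del m [m] = [] := by simp [del]

theorem del_of_ne {m x : α} (h : x ≠ m) : del m [x] = [x] := by simp [del, h]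

theorem del_eq_self {m : α} {w : List α} (h : m ∉ w) : del m w = w := by
  simp only [del, List.filter_eq_self, decide_eq_true_eq]
  rintro a ha rfl
  exact h ha

theorem del_comm (m x : α) (w : List α) : del m (del x w) = del x (del m w) := by
  simp [del, List.filter_filter, Bool.and_comm]

theorem nodup_del {w : List α} (h : w.Nodup) (m : α) : (del m w).Nodup := h.filter _

theorem length_del {m : α} {w : List α} (hw : w.Nodup) (h : m ∈ w) :
    (del m w).length + 1 = w.length := by
  have : del m w = w.erase m := by
    rw [hw.erase_eq_filter]
    simp only [del]
    congr 1
    funext y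
    by_cases hy : y = m <;> simp [hy]
  rw [this, List.length_erase_of_mem h]
  have := List.length_pos_of_mem h
  omega

/-- When `M` is inserted it goes to the bottom of the first column, and each later insertion leaves
it at the bottom of some column by `AddMax.insert`. -/
theorem exists_addMax {w : List α} (hw : w.Nodup) {M : α} (hM : M ∈ w) (hmax : ∀ y ∈ w, y ≤ M) :
    ∃ g, AddMax M g (wordTab ltRel (del M w)) (wordTab ltRel w) := by
  induction w using List.reverseRecOn with
  | nil => simp at hM
  | append_singleton w x ih =>
    have hnd := hw
    rw [List.nodup_append] at hnd
    by_cases hx : x = M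
    · subst hx
      have hxw : x ∉ w := fun h => (hnd.2.2 x h x (by simp)) rfl
      rw [del_append, del_self, List.append_nil, del_eq_self hxw, wordTab_concat]
      refine ⟨0, addMax_tabInsert fun C hC c hc => ?_⟩
      simp only [ltRel, decide_eq_false_iff_not, not_lt]
      exact hmax c (by simp [mem_wordTab hC hc])
    · have hMw : M ∈ w := by
        rcases List.mem_append.1 hM with h | h
        · exact h
        · exact absurd (List.mem_singleton.1 h).symm hx
      obtain ⟨g, hg⟩ := ih hnd.1 hMw (fun y hy => hmax y (by simp [hy]))
      rw [del_append, del_of_ne hx, wordTab_concat, wordTab_concat]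
      refine ⟨_, hg.insert (r := ltRel) ?_ ?_⟩
      · simp only [ltRel, decide_eq_true_eq]
        exact lt_of_le_of_ne (hmax x (by simp)) hx
      · intro C hC c hc
        have := mem_del.1 (mem_wordTab hC hc)
        have h2 := hmax c (by simp [this.1])
        simp only [ltRel, decide_eq_true_eq, decide_eq_false_iff_not, not_lt]
        exact ⟨h2, lt_of_le_of_ne h2 this.2⟩

theorem colFace_word {w : List α} {x M : α} (hw : (w ++ [x]).Nodup) (hM : M ∈ w)
    (hmax : ∀ y ∈ w ++ [x], y ≤ M) :
    ColFace (strictShape (del M w)) (strictShape (del M w ++ [x])) (strictShape w)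
      (strictShape (w ++ [x])) := by
  have hnd := hw
  rw [List.nodup_append] at hnd
  obtain ⟨g, hg⟩ := exists_addMax hnd.1 hM (fun y hy => hmax y (by simp [hy]))
  have hx : x ≠ M := fun h => (hnd.2.2 M hM x (by simp)) h.symm
  refine ⟨endCol ltRel x (wordTab ltRel (del M w)), g, ?_, hg.colLens_eq, ?_⟩
  · simp only [strictShape, wordTab_concat]; exact colLens_tabInsert _ _
  · have h := hg.insert (r := ltRel) (x := x) ?_ ?_
    · simp only [strictShape, wordTab_concat]
      exact h.colLens_eq
    · simp only [ltRel, decide_eq_true_eq]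
      exact lt_of_le_of_ne (hmax x (by simp)) hx
    · intro C hC c hc
      have := mem_del.1 (mem_wordTab hC hc)
      have h2 := hmax c (by simp [this.1])
      simp only [ltRel, decide_eq_true_eq, decide_eq_false_iff_not, not_lt]
      exact ⟨h2, lt_of_le_of_ne h2 this.2⟩

theorem strictShape_concat_max {w : List α} {M : α} (hmax : ∀ y ∈ w, y ≤ M) :
    strictShape (w ++ [M]) = addBox (strictShape w) 0 := by
  simp only [strictShape, wordTab_concat]
  refine (addMax_tabInsert fun C hC c hc => ?_).colLens_eq
  simp only [ltRel, decide_eq_false_iff_not, not_lt]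
  exact hmax c (mem_wordTab hC hc)

/-- The column `e` is the first empty one; the second clause characterises it by the shape alone. -/
theorem strictShape_concat_min {w : List α} {m : α} (hmin : ∀ y ∈ w, m < y) :
    ∃ e, strictShape (w ++ [m]) = addBox (strictShape w) e ∧ ∀ j, strictShape w j = 0 ↔ e ≤ j := by
  have hT := isTab_wordTab isBump_ltRel w
  refine ⟨(wordTab ltRel w).length, ?_, hT.colLens_eq_zero_iff⟩
  simp only [strictShape, wordTab_concat]
  rw [colLens_tabInsert, endCol_of_min hT]
  intro c hc
  simp only [ltRel, decide_eq_true_eq]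
  cases hw : wordTab ltRel w with
  | nil => simp [hw] at hc
  | cons C T =>
    simp only [hw, List.headD_cons] at hc
    exact hmin c (mem_wordTab (C := C) (r := ltRel) (by simp [hw]) (List.mem_of_head? hc))

theorem strictShape_nil : strictShape ([] : List α) = fun _ => 0 := by
  funext j; simp [strictShape]

/-- The three claims need each other, so they are proved together by induction on the length. If the
last letter `x` is neither smallest nor largest, the extreme face of `w0` and the row face of the
word without `M` come from shorter words, the column faces come from `colFace_word`, and `cube`
yields the two new faces. The first claim serves the case in which `x` is the largest letter. -/
theorem faces_word (w : List α) (hw : w.Nodup) {m : α} (hm : m ∈ w) (hmin : ∀ y ∈ w, m ≤ y) :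
    (∃ g, strictShape w = addBox (strictShape (del m w)) g) ∧
    (∀ M ∈ w, M ≠ m → (∀ y ∈ w, y ≤ M) → ExtremeFace (strictShape (del m (del M w)))
      (strictShape (del m w)) (strictShape (del M w)) (strictShape w)) ∧
    (∀ w0 x, w = w0 ++ [x] → x ≠ m → RowFace (strictShape (del m w0))
      (strictShape (del m w0 ++ [x])) (strictShape w0) (strictShape w)) := by
  induction hn : w.length using Nat.strong_induction_on generalizing w with
  | _ n IH =>
  rcases List.eq_nil_or_concat' w with rfl | ⟨w0, x, rfl⟩
  · simp at hm
  have hnd := hw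
  rw [List.nodup_append] at hnd
  have hxw0 : x ∉ w0 := fun h => (hnd.2.2 x h x (by simp)) rfl
  -- the statement for a given largest letter
  have key : ∀ M ∈ w0 ++ [x], M ≠ m → (∀ y ∈ w0 ++ [x], y ≤ M) →
      ExtremeFace (strictShape (del m (del M (w0 ++ [x])))) (strictShape (del m (w0 ++ [x])))
        (strictShape (del M (w0 ++ [x]))) (strictShape (w0 ++ [x])) ∧
      (x ≠ m → RowFace (strictShape (del m w0))
        (strictShape (del m w0 ++ [x])) (strictShape w0) (strictShape (w0 ++ [x]))) := by
    intro M hM hMm hmax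
    by_cases hxm : x = m
    · subst hxm
      refine ⟨?_, fun h => absurd rfl h⟩
      have hMw : M ∈ w0 := by
        rcases List.mem_append.1 hM with h | h
        · exact h
        · exact absurd (List.mem_singleton.1 h) hMm
      have hlt : ∀ y ∈ w0, x < y := fun y hy =>
        lt_of_le_of_ne (hmin y (by simp [hy])) (fun h => hxw0 (h ▸ hy))
      obtain ⟨b, hb⟩ := exists_addMax hnd.1 hMw (fun y hy => hmax y (by simp [hy]))
      have hb' : strictShape w0 = addBox (strictShape (del M w0)) b := hb.colLens_eq
      -- The smallest letter opens the first empty column, which is `g` without `M` and `k` with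
      -- `M`. These agree unless `M` itself has opened column `g`; then `k = g + 1`, and both
      -- columns are empty before.
      obtain ⟨g, hg, hg0⟩ := strictShape_concat_min (w := del M w0) (m := x)
        (fun y hy => hlt y (mem_del.1 hy).1)
      obtain ⟨k, hk, hk0⟩ := strictShape_concat_min (w := w0) (m := x) hlt
      have hanti := strictShape_antitone w0
      rw [del_append, del_of_ne (Ne.symm hMm), del_append, del_append, del_self,
        List.append_nil, List.append_nil, del_eq_self hxw0,
        del_eq_self (fun h => hxw0 (mem_del.1 h).1)]
      refine ⟨b, g, k, hb', hg, hk, fun hbg => ?_, fun hbg => Or.inr ⟨?_, ?_⟩⟩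
      · rw [hb'] at hk0 hanti
        have h1 := hk0 k
        have h2 := hk0 g
        have h3 := hg0 k
        have h4 := hg0 g
        have h6 := hanti (a := b) (b := g)
        have h5 := hanti (a := g) (b := b)
        have h7 := hg0 b
        have h8 := hk0 b
        simp only [addBox_apply] at h1 h2 h5 h6 h8
        simp only [if_true, Ne.symm hbg, if_false] at h1 h2 h5 h6 h8
        split_ifs at h1 <;> omega
      · subst hbg
        rw [hb'] at hk0
        have h1 := hk0 k
        have h2 := hk0 b
        have h3 := hg0 k
        have h4 := hk0 (b + 1)
        have h5 := hg0 (b + 1)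
        simp only [addBox_apply] at h1 h2 h4
        simp at h1 h2 h4
        split_ifs at h1 <;> omega
      · subst hbg
        rw [(hg0 b).2 le_rfl, (hg0 (b + 1)).2 (by omega)]
    · have hmw : m ∈ w0 := by
        rcases List.mem_append.1 hm with h | h
        · exact h
        · exact absurd (List.mem_singleton.1 h).symm hxm
      have hlen : w0.length < n := by rw [← hn]; simp
      have hmin0 : ∀ y ∈ w0, m ≤ y := fun y hy => hmin y (by simp [hy])
      have IH0 := IH w0.length hlen w0 hnd.1 hmw hmin0 rfl
      have hdm : del m (w0 ++ [x]) = del m w0 ++ [x] := by rw [del_append, del_of_ne hxm]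
      by_cases hxM : x = M
      -- A largest last letter goes to column `0` whether or not `m` is present, so only the box of
      -- `m` in the shape of `w0` matters.
      · subst hxM
        have hd : del x (w0 ++ [x]) = w0 := by
          rw [del_append, del_self, List.append_nil, del_eq_self hxw0]
        obtain ⟨g, hg⟩ := IH0.1
        have hmax0 : ∀ y ∈ w0, y ≤ x := fun y hy => hmax y (by simp [hy])
        have h1 := strictShape_concat_max hmax0
        have h2 := strictShape_concat_max (w := del m w0) (M := x)
          (fun y hy => hmax0 y (mem_del.1 hy).1)
        rw [hd, hdm, h1, h2]
        by_cases h0 : g = 0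
        · subst h0
          exact ⟨⟨0, 0, 0, rfl, hg, by rw [hg], fun h => absurd rfl h, fun _ => Or.inl rfl⟩,
            fun _ => ⟨0, 0, 0, rfl, hg, by rw [hg], fun h => absurd rfl h,
              fun _ => ⟨le_rfl, rfl, fun i hi => by omega⟩⟩⟩
        · exact ⟨⟨0, g, g, rfl, hg, by rw [hg, addBox_comm], fun _ => rfl, fun h => by omega⟩,
            fun _ => ⟨0, g, g, rfl, hg, by rw [hg, addBox_comm], fun _ => rfl,
              fun h => by omega⟩⟩
      · have hMw : M ∈ w0 := by
          rcases List.mem_append.1 hM with h | h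
          · exact h
          · exact absurd (List.mem_singleton.1 h).symm hxM
        have hdM : del M (w0 ++ [x]) = del M w0 ++ [x] := by rw [del_append, del_of_ne hxM]
        have hN := IH0.2.1 M hMw hMm (fun y hy => hmax y (by simp [hy]))
        have hmM : m ∈ del M w0 := mem_del.2 ⟨hmw, Ne.symm hMm⟩
        have hR := (IH (del M w0 ++ [x]).length
          (by have := length_del hnd.1 hMw; rw [← hn]; simp; omega) (del M w0 ++ [x])
          (hdM ▸ nodup_del hw M) (by simp [hmM])
          (fun y hy => hmin y (by
            rw [← hdM] at hy; exact (mem_del.1 hy).1)) rfl).2.2 (del M w0) x rfl hxm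
        have hC := colFace_word (w := del m w0) (x := x) (M := M)
          (hdm ▸ nodup_del hw m) (mem_del.2 ⟨hMw, hMm⟩)
          (fun y hy => hmax y (by rw [← hdm] at hy; exact (mem_del.1 hy).1))
        have hC' := colFace_word (w := w0) (x := x) (M := M) hw hMw hmax
        rw [del_comm M m] at hC
        obtain ⟨h1, h2⟩ := cube hN hC hR hC' (strictShape_antitone _) (strictShape_antitone _)
          (strictShape_antitone _) (strictShape_antitone _) (strictShape_antitone _)
        rw [hdM, hdm, del_append, del_of_ne hxm]
        exact ⟨h2, fun _ => h1⟩
  have hMex : ∃ M ∈ w0 ++ [x], ∀ y ∈ w0 ++ [x], y ≤ M := by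
    obtain ⟨M, hM, h⟩ := (w0 ++ [x]).toFinset.exists_max_image id ⟨x, by simp⟩
    exact ⟨M, List.mem_toFinset.1 hM, fun y hy => h y (List.mem_toFinset.2 hy)⟩
  obtain ⟨M, hM, hmax⟩ := hMex
  refine ⟨?_, fun M' h1 h2 h3 => (key M' h1 h2 h3).1, ?_⟩
  · by_cases hMm : M = m
    · subst hMm
      have hall : ∀ y ∈ w0 ++ [x], y = M := fun y hy => le_antisymm (hmax y hy) (hmin y hy)
      have hxM := hall x (by simp)
      subst hxM
      have hw0 : w0 = [] := by
        rw [List.eq_nil_iff_forall_not_mem]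
        intro y hy
        exact hxw0 (hall y (by simp [hy]) ▸ hy)
      subst hw0
      refine ⟨0, ?_⟩
      rw [List.nil_append, del_self]
      exact strictShape_concat_max (w := []) (by simp)
    · obtain ⟨i, j, k, h1, h2, h3, -⟩ := (key M hM hMm hmax).1
      exact ⟨k, h3⟩
  · intro w0' x' heq hx'
    obtain ⟨rfl, h⟩ := List.append_inj' heq rfl
    simp only [List.cons.injEq, and_true] at h
    subst h
    have hmw : m ∈ w0 := by
      rcases List.mem_append.1 hm with h | h
      · exact h
      · exact absurd (List.mem_singleton.1 h).symm hx'
    have hMm : M ≠ m := by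
      rintro rfl
      exact hx' (le_antisymm (hmax x (by simp)) (hmin x (by simp)))
    exact (key M hM hMm hmax).2 hx'

/-- **Symmetry of shapes.** List the points of a finite set by increasing position, and by
decreasing value: the insertion tableau of the values in the first listing and that of the
positions in the second one have conjugate shapes. -/
theorem conj_strictShape {X : Type*} [DecidableEq X] {β : Type*} [LinearOrder β]
    (pos : X → α) (val : X → β) (L L' : List X) (hperm : L.Perm L')
    (hpos : L.Pairwise fun x y => pos x < pos y) (hval : L'.Pairwise fun x y => val y < val x) :
    Conj (strictShape (L.map val)) (strictShape (L'.map pos)) := by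
  induction hn : L.length using Nat.strong_induction_on generalizing L L' with
  | _ n IH =>
  rcases List.eq_nil_or_concat' L with rfl | ⟨L0, x, rfl⟩
  · obtain rfl := hperm.nil_eq
    intro i j; simp [strictShape_nil]
  rcases List.eq_nil_or_concat' L' with rfl | ⟨L0', m, rfl⟩
  · simpa using hperm.length_eq
  rw [List.pairwise_append] at hpos hval
  have hpos' : ∀ y ∈ L0, pos y < pos x := fun y hy => hpos.2.2 y hy x (by simp)
  have hval' : ∀ y ∈ L0', val m < val y := fun y hy => hval.2.2 y hy m (by simp)
  have hxL : x ∉ L0 := fun h => (hpos' x h).false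
  have hmL : m ∉ L0' := fun h => (hval' m h).false
  have hnd : (L0 ++ [x]).Nodup := by
    rw [List.nodup_append]
    exact ⟨hpos.1.imp (fun h => by rintro rfl; exact h.false), by simp,
      fun a ha b hb => by
        rintro rfl; rw [List.mem_singleton.1 hb] at ha; exact hxL ha⟩
  have hnd' : (L0' ++ [m]).Nodup := hperm.nodup hnd
  have hvalinj : ∀ y ∈ L0 ++ [x], ∀ z ∈ L0 ++ [x], val y = val z → y = z := by
    have h1 : ((L0' ++ [m]).map val).Nodup := by
      unfold List.Nodup
      rw [List.pairwise_map, List.pairwise_append]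
      exact ⟨hval.1.imp fun h => h.ne', by simp, fun a ha b hb => (hval.2.2 a ha b hb).ne'⟩
    intro y hy z hz
    exact List.inj_on_of_nodup_map h1 (hperm.subset hy) (hperm.subset hz)
  by_cases hxm : x = m
  -- The last point is also the lowest. Its value opens a new column on one side, and its position
  -- lengthens column `0` on the other; these boxes are conjugate.
  · subst hxm
    have hperm0 : L0.Perm L0' := (List.perm_append_right_iff [x]).1 hperm
    have ih := IH L0.length (by rw [← hn]; simp) L0 L0' hperm0 hpos.1 hval.1 rfl
    rw [List.map_append, List.map_append, List.map_singleton, List.map_singleton]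
    obtain ⟨e, he, he0⟩ := strictShape_concat_min (w := L0.map val) (m := val x) (by
      intro y hy
      obtain ⟨z, hz, rfl⟩ := List.mem_map.1 hy
      exact hval' z (hperm0.subset hz))
    rw [he, strictShape_concat_max (w := L0'.map pos) (M := pos x) (by
      intro y hy
      obtain ⟨z, hz, rfl⟩ := List.mem_map.1 hy
      exact (hpos' z (hperm0.symm.subset hz)).le)]
    have h0 : strictShape (L0.map val) e = 0 := (he0 e).2 le_rfl
    rw [← h0]
    refine ih.addBox ?_
    rw [h0]
    apply le_antisymm
    · by_contra hlt
      have := (ih 0 e).2 (by omega); omega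
    · by_contra hlt
      have h1 := ih 0 (strictShape (L0'.map pos) 0)
      have h2 := he0 (strictShape (L0'.map pos) 0)
      omega
  · have hmL0 : m ∈ L0 := by
      rcases List.mem_append.1 (hperm.symm.subset (by simp : m ∈ L0' ++ [m])) with h | h
      · exact h
      · exact absurd (List.mem_singleton.1 h).symm hxm
    have hxL0 : x ∈ L0' := by
      rcases List.mem_append.1 (hperm.subset (by simp : x ∈ L0 ++ [x])) with h | h
      · exact h
      · exact absurd (List.mem_singleton.1 h) hxm
    let D : X → List X → List X := fun z l => l.filter fun y => decide (y ≠ z)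
    have hDm : ∀ l : List X, l ⊆ L0 ++ [x] → (D m l).map val = del (val m) (l.map val) := by
      intro l hl
      simp only [D, del, List.filter_map]
      congr 1
      apply List.filter_congr
      intro y hy
      have : val y = val m ↔ y = m :=
        ⟨hvalinj y (hl hy) m (by simp [hmL0]), fun h => by rw [h]⟩
      simp [this]
    have hposinj : ∀ y ∈ L0 ++ [x], ∀ z ∈ L0 ++ [x], pos y = pos z → y = z := by
      have h1 : ((L0 ++ [x]).map pos).Nodup := by
        unfold List.Nodup
        rw [List.pairwise_map, List.pairwise_append]
        exact ⟨hpos.1.imp fun h => h.ne, by simp, fun a ha b hb => (hpos.2.2 a ha b hb).ne⟩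
      intro y hy z hz
      exact List.inj_on_of_nodup_map h1 hy hz
    have hDx : ∀ l : List X, l ⊆ L0 ++ [x] → (D x l).map pos = del (pos x) (l.map pos) := by
      intro l hl
      simp only [D, del, List.filter_map]
      congr 1
      apply List.filter_congr
      intro y hy
      have : pos y = pos x ↔ y = x :=
        ⟨hposinj y (hl hy) x (by simp), fun h => by rw [h]⟩
      simp [this]
    have hDL : D x (L0 ++ [x]) = L0 := by
      simp only [D, List.filter_append]
      rw [List.filter_eq_self.2]
      · simp
      · intro a ha
        simp only [decide_eq_true_eq]
        rintro rfl; exact hxL ha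
    have hDL' : D m (L0' ++ [m]) = L0' := by
      simp only [D, List.filter_append]
      rw [List.filter_eq_self.2]
      · simp
      · intro a ha
        simp only [decide_eq_true_eq]
        rintro rfl; exact hmL ha
    have hDm1 : D m (L0 ++ [x]) = D m L0 ++ [x] := by
      simp [D, hxm]
    have hDx1 : D x (L0' ++ [m]) = D x L0' ++ [m] := by
      simp [D, Ne.symm hxm]
    -- the four pairs of words
    have p1 : (D m L0 ++ [x]).Perm L0' := by
      rw [← hDm1, ← hDL']; exact hperm.filter _
    have p2 : L0.Perm (D x L0' ++ [m]) := by
      have h : (D x (L0 ++ [x])).Perm (D x (L0' ++ [m])) := hperm.filter _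
      rwa [hDL, hDx1] at h
    have p0 : (D m L0).Perm (D x L0') := by
      have h1 : D m (D x L0' ++ [m]) = D x L0' := by
        simp only [D, List.filter_append]
        rw [List.filter_eq_self.2]
        · simp
        · intro a ha
          simp only [decide_eq_true_eq]
          rintro rfl
          exact hmL (List.mem_filter.1 ha).1
      rw [← h1]; exact p2.filter _
    have lenm : (D m L0).length < L0.length := by
      refine List.length_filter_lt_length_iff_exists.2 ⟨m, hmL0, by simp⟩
    have ln : L0.length + 1 = n := by rw [← hn]; simp
    -- Conjugacy is known without both points (`c0`), without `m` (`c1`) and without `x` (`c2`).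
    -- Among the values `x` is last and `m` is smallest, which gives a row face; among the positions
    -- `m` is last and `x` is largest, which gives a column face.
    have c0 := IH (D m L0).length (by omega) (D m L0) (D x L0') p0
      (hpos.1.filter _) (hval.1.filter _) rfl
    have c1 := IH (D m L0 ++ [x]).length (by simp; omega) (D m L0 ++ [x]) L0' p1
      (List.pairwise_append.2 ⟨hpos.1.filter _, by simp, fun a ha b hb => by
        rw [List.mem_singleton.1 hb]; exact hpos' a (List.mem_filter.1 ha).1⟩) hval.1 rfl
    have c2 := IH L0.length (by omega) L0 (D x L0' ++ [m]) p2 hpos.1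
      (List.pairwise_append.2 ⟨hval.1.filter _, by simp, fun a ha b hb => by
        rw [List.mem_singleton.1 hb]; exact hval' a (List.mem_filter.1 ha).1⟩) rfl
    have ndval : ((L0 ++ [x]).map val).Nodup :=
      List.Nodup.map_on (fun y hy z hz h => hvalinj y hy z hz h) hnd
    have ndpos : ((L0' ++ [m]).map pos).Nodup :=
      List.Nodup.map_on (fun y hy z hz h =>
        hposinj y (hperm.symm.subset hy) z (hperm.symm.subset hz) h) hnd'
    have hR := (faces_word ((L0 ++ [x]).map val) ndval (m := val m)
      (List.mem_map_of_mem (by simp [hmL0])) (by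
        intro y hy
        obtain ⟨z, hz, rfl⟩ := List.mem_map.1 hy
        rcases List.mem_append.1 (hperm.subset hz) with h | h
        · exact (hval' z h).le
        · rw [List.mem_singleton.1 h])).2.2 (L0.map val) (val x) (by simp)
        (fun h => hxm (hvalinj x (by simp) m (by simp [hmL0]) h))
    have hC := colFace_word (w := L0'.map pos) (x := pos m) (M := pos x) (by simpa using ndpos)
      (List.mem_map_of_mem hxL0) (by
        intro y hy
        have hy' : y ∈ (L0' ++ [m]).map pos := by simpa using hy
        obtain ⟨z, hz, rfl⟩ := List.mem_map.1 hy'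
        rcases List.mem_append.1 (hperm.symm.subset hz) with h | h
        · exact (hpos' z h).le
        · rw [List.mem_singleton.1 h])
    rw [← hDm L0 (by simp)] at hR
    rw [← hDx L0' (fun y hy => hperm.symm.subset (by simp [hy]))] at hC
    simp only [List.map_append, List.map_singleton] at c1 c2 hR hC ⊢
    exact Conj.of_faces hR hC c0 c1 c2

end Faces

end HookCrystal


namespace HookCrystal

/-! ### Standardization -/

section Standardization

variable {α β : Type*} {r : α → α → Bool} {s : β → β → Bool} {π : α → β}

theorem colInsert_map {b : α} {C : List α} (h : ∀ c ∈ C, r b c = s (π b) (π c)) :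
    colInsert s (π b) (C.map π) = ((colInsert r b C).1.map π, (colInsert r b C).2.map π) := by
  induction C with
  | nil => simp [colInsert]
  | cons c C ih =>
    have hc := h c (by simp)
    have ih' := ih fun c hc => h c (by simp [hc])
    simp only [List.map_cons, colInsert, ← hc, ih']
    split_ifs <;> simp

/-- The letters of each column of `T` are compared with those of the columns further right
as their images are. -/
def Compatible (r : α → α → Bool) (s : β → β → Bool) (π : α → β) : List (List α) → Prop
  | [] => True
  | C :: T => (IsCol r C ∧ IsCol s (C.map π)) ∧
      (∀ x ∈ C, ∀ y ∈ T.flatten, r x y = s (π x) (π y)) ∧ Compatible r s π T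

/-- A bumped letter moves to the right, so entries of a column need to be compared only with letters
further right. The new comparisons are those of the column with the letter that just left it:
entries above that letter bump it by `IsBump.left`, entries below do not since they formed a column
with it, and both arguments work for either relation. -/
theorem Compatible.insert (hr : IsBump r) (hs : IsBump s) {T : List (List α)}
    (hT : Compatible r s π T) {b : α} (hb : ∀ y ∈ T.flatten, r b y = s (π b) (π y)) :
    Compatible r s π (tabInsert r b T) ∧
      (tabInsert r b T).map (List.map π) = tabInsert s (π b) (T.map (List.map π)) := by
  induction T generalizing b with
  | nil => simp [tabInsert, Compatible, IsCol]
  | cons C T ih =>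
    obtain ⟨⟨h1, h1'⟩, h2, h3⟩ := hT
    have hbC : ∀ c ∈ C, r b c = s (π b) (π c) := fun c hc => hb c (by simp [hc])
    have hbT : ∀ y ∈ T.flatten, r b y = s (π b) (π y) := fun c hc => hb c (by
      rw [List.flatten_cons]; exact List.mem_append_right _ hc)
    have hmap := colInsert_map hbC
    have hcol : IsCol r (colInsert r b C).1 ∧ IsCol s ((colInsert r b C).1.map π) := by
      refine ⟨h1.insert hr b, ?_⟩
      have := h1'.insert hs (π b)
      rwa [hmap] at this
    cases hc : (colInsert r b C).2 with
    | none =>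
      have hc' : (colInsert s (π b) (C.map π)).2 = none := by rw [hmap, hc]; rfl
      rw [tabInsert_cons_none T hc, List.map_cons, List.map_cons, tabInsert_cons_none _ hc', hmap]
      refine ⟨⟨hcol, ?_, h3⟩, rfl⟩
      intro x hx y hy
      rw [colInsert_fst_of_none hc, List.mem_append, List.mem_singleton] at hx
      rcases hx with hx | rfl
      · exact h2 x hx y hy
      · exact hbT y hy
    | some c =>
      have hc' : (colInsert s (π b) (C.map π)).2 = some (π c) := by rw [hmap, hc]; rfl
      obtain ⟨X, Y, e1, e2, e3, e4⟩ := colInsert_some hc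
      have hcC : c ∈ C := by rw [e1]; simp
      obtain ⟨ih1, ih2⟩ := ih h3 (b := c) (h2 c hcC)
      rw [tabInsert_cons_some T hc, List.map_cons, List.map_cons, tabInsert_cons_some _ hc', hmap]
      refine ⟨⟨hcol, ?_, ih1⟩, by rw [ih2]⟩
      intro x hx y hy
      rcases List.mem_cons.1 ((tabInsert_perm c T).subset hy) with rfl | hy
      · rw [e2] at hx
        subst e1
        simp only [IsCol, List.map_append, List.map_cons, List.pairwise_append,
          List.pairwise_cons] at h1 h1'
        rcases List.mem_append.1 hx with hx | hx
        · have hbx := e4 x hx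
          have hby : s (π b) (π y) = true := by rw [← hbC y (by simp)]; exact e3
          have hbx' : s (π b) (π x) = false := by rw [← hbC x (by simp [hx])]; exact hbx
          rw [hr.left _ _ _ hbx e3, hs.left _ _ _ hbx' hby]
        · rcases List.mem_cons.1 hx with rfl | hx
          · exact hbC y (by simp)
          · rw [h1.2.1.1 x hx, h1'.2.1.1 (π x) (List.mem_map_of_mem hx)]
      · rw [e2] at hx
        rcases List.mem_append.1 hx with hx | hx
        · exact h2 x (by rw [e1]; simp [hx]) y hy
        · rcases List.mem_cons.1 hx with rfl | hx
          · exact hbT y hy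
          · exact h2 x (by rw [e1]; simp [hx]) y hy

/-- Insertion compares a later letter with earlier ones, so agreement is required in that direction
only. This leaves room to break ties between equal letters according to their places in the word. -/
theorem wordTab_map (hr : IsBump r) (hs : IsBump s) {w : List α}
    (hw : w.Pairwise fun y x => r x y = s (π x) (π y)) :
    (wordTab r w).map (List.map π) = wordTab s (w.map π) := by
  suffices h : Compatible r s π (wordTab r w) ∧
      (wordTab r w).map (List.map π) = wordTab s (w.map π) from h.2
  induction w using List.reverseRecOn with
  | nil => simp [Compatible]
  | append_singleton w b ih =>
    rw [List.pairwise_append] at hw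
    obtain ⟨h1, h2⟩ := ih hw.1
    rw [wordTab_concat, List.map_append, List.map_singleton, wordTab_concat, ← h2]
    refine h1.insert hr hs fun y hy => ?_
    exact hw.2.2 y ((wordTab_perm w).subset hy) b (by simp)

theorem colLens_map (T : List (List α)) : colLens (T.map (List.map π)) = colLens T :=
  colLens_congr (by simp [Function.comp_def])

theorem colLens_wordTab_map (hr : IsBump r) (hs : IsBump s) {w : List α}
    (hw : w.Pairwise fun y x => r x y = s (π x) (π y)) :
    colLens (wordTab s (w.map π)) = colLens (wordTab r w) := by
  rw [← wordTab_map hr hs hw, colLens_map]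

end Standardization

/-! ### Insertion of letters -/

section Letters

variable {m n u v : ℕ}

theorem deg_eq_zero {b : Letter m n} : deg m n b = 0 ↔ b.val < m := by
  unfold deg; split_ifs <;> simp_all

theorem bumps_iff {a b : Letter m n} :
    bumps m n a b = true ↔ a.val < b.val ∨ (a.val = b.val ∧ a.val < m) := by
  unfold bumps
  simp only [deg_eq_zero]
  split_ifs <;> simp only [decide_eq_true_eq, Fin.le_def, Fin.lt_def] <;> omega

theorem bumps_eq_false {a b : Letter m n} :
    bumps m n a b = false ↔ b.val < a.val ∨ (a.val = b.val ∧ m ≤ a.val) := by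
  rw [← Bool.not_eq_true, bumps_iff]; omega

theorem isBump_bumps : IsBump (bumps m n) where
  trans x y z := by simp only [bumps_iff]; omega
  left x y z := by simp only [bumps_iff, bumps_eq_false]; omega
  total x y := by simp only [bumps_iff, Fin.ext_iff]; omega

theorem insertColumn_eq (b : Letter m n) (C : List (Letter m n)) :
    insertColumn m n b C = colInsert (bumps m n) b C := by
  induction C with
  | nil => rfl
  | cons c C ih => simp only [insertColumn, colInsert, ih]

theorem insertTableau_eq (b : Letter m n) (T : List (List (Letter m n))) :
    insertTableau m n b T = tabInsert (bumps m n) b T := by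
  induction T generalizing b with
  | nil => rfl
  | cons C T ih =>
    cases h : (colInsert (bumps m n) b C).2 with
    | none =>
      rw [tabInsert_cons_none T h]
      simp only [insertTableau, insertColumn_eq]; rw [h]
    | some b' =>
      rw [tabInsert_cons_some T h]
      simp only [insertTableau, insertColumn_eq]; rw [h]; simp only [ih]

theorem insertionTableau_eq (w : List (Letter m n)) :
    insertionTableau m n w = wordTab (bumps m n) w := by
  unfold insertionTableau wordTab
  congr 1
  funext T b
  exact insertTableau_eq b T

/-- The letters in increasing order for `k = 0`, in decreasing order otherwise. -/
def orderedLetters (m n k : ℕ) : List (Letter m n) :=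
  if k = 0 then List.finRange (m + n) else (List.finRange (m + n)).reverse

theorem mem_orderedLetters (k : ℕ) (b : Letter m n) : b ∈ orderedLetters m n k := by
  unfold orderedLetters; split_ifs <;> simp

theorem nodup_orderedLetters (k : ℕ) : (orderedLetters m n k).Nodup := by
  unfold orderedLetters; split_ifs <;> simp [List.nodup_finRange]

/-- The transposed matrix. -/
def MSharp.transpose (A : MSharp m n u v) : MSharp u v m n :=
  ⟨A.1.transpose, fun b b' h => A.2 b' b h.symm⟩

/-- The letters `b`, with multiplicity `a_{bb'}`, in the order in which the first biword
lists them. -/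
def block (A : MSharp m n u v) (b' : Letter u v) : List (Letter m n) :=
  (orderedLetters m n (deg u v b')).flatMap fun b => List.replicate (A.1 b b') b

theorem words_fst (A : MSharp m n u v) :
    (words A).1 = (List.finRange (u + v)).flatMap (block A) := by
  simp only [words, biword, List.map_flatMap, List.map_replicate]
  rfl

theorem wordsStar_snd (A : MSharp m n u v) :
    (wordsStar A).2 = (List.finRange (m + n)).reverse.flatMap (block A.transpose) := by
  simp only [wordsStar, biwordStar, List.map_flatMap, List.map_replicate]
  rfl

/-! ### Shapes of the insertion tableaux of a matrix -/

/-- The order of the points in the first biword. -/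
def posKey (x : Letter m n × Letter u v × ℕ) : Letter u v ×ₗ ℤ ×ₗ ℤ :=
  toLex (x.2.1, toLex (if deg u v x.2.1 = 0 then (x.1.val : ℤ) else -x.1.val, (x.2.2 : ℤ)))

/-- The order of the values in the standardization of the first word. -/
def valKey (x : Letter m n × Letter u v × ℕ) : Letter m n ×ₗ ℤ ×ₗ ℤ :=
  toLex (x.1, toLex (if deg m n x.1 = 0 then (-x.2.1.val : ℤ) else x.2.1.val,
    if deg m n x.1 = 0 then (-x.2.2 : ℤ) else x.2.2))

theorem posKey_lt (x y : Letter m n × Letter u v × ℕ) : posKey x < posKey y ↔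
    x.2.1.val < y.2.1.val ∨ x.2.1.val = y.2.1.val ∧
      ((x.2.1.val < u ∧ x.1.val < y.1.val ∨ u ≤ x.2.1.val ∧ y.1.val < x.1.val) ∨
        x.1.val = y.1.val ∧ x.2.2 < y.2.2) := by
  simp only [posKey, Prod.Lex.toLex_lt_toLex, deg_eq_zero, Fin.lt_def, Fin.ext_iff]
  split_ifs <;> omega

theorem valKey_lt (x y : Letter m n × Letter u v × ℕ) : valKey x < valKey y ↔
    x.1.val < y.1.val ∨ x.1.val = y.1.val ∧
      ((x.1.val < m ∧ (y.2.1.val < x.2.1.val ∨ x.2.1.val = y.2.1.val ∧ y.2.2 < x.2.2)) ∨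
       (m ≤ x.1.val ∧ (x.2.1.val < y.2.1.val ∨ x.2.1.val = y.2.1.val ∧ x.2.2 < y.2.2))) := by
  simp only [valKey, Prod.Lex.toLex_lt_toLex, deg_eq_zero, Fin.lt_def, Fin.ext_iff]
  split_ifs <;> omega

/-- The points of a matrix in the order of the first biword. -/
def points (A : MSharp m n u v) : List (Letter m n × Letter u v × ℕ) :=
  (List.finRange (u + v)).flatMap fun b' => (orderedLetters m n (deg u v b')).flatMap fun b =>
    (List.range (A.1 b b')).map fun k => (b, b', k)

/-- The points of a matrix in the order of the second biword. -/
def pointsStar (A : MSharp m n u v) : List (Letter m n × Letter u v × ℕ) :=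
  (List.finRange (m + n)).reverse.flatMap fun b =>
    (orderedLetters u v (deg m n b)).flatMap fun b' =>
      (if deg m n b = 0 then List.range (A.1 b b') else (List.range (A.1 b b')).reverse).map
        fun k => (b, b', k)

theorem mem_points {A : MSharp m n u v} {x : Letter m n × Letter u v × ℕ} :
    x ∈ points A ↔ x.2.2 < A.1 x.1 x.2.1 := by
  obtain ⟨b, b', k⟩ := x
  simp only [points, List.mem_flatMap, List.mem_finRange, true_and, List.mem_map, List.mem_range,
    mem_orderedLetters, Prod.mk.injEq]
  constructor
  · rintro ⟨_, _, k', h, rfl, rfl, rfl⟩; exact h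
  · intro h; exact ⟨b', b, k, h, rfl, rfl, rfl⟩

theorem mem_pointsStar {A : MSharp m n u v} {x : Letter m n × Letter u v × ℕ} :
    x ∈ pointsStar A ↔ x.2.2 < A.1 x.1 x.2.1 := by
  obtain ⟨b, b', k⟩ := x
  simp only [pointsStar, List.mem_flatMap, List.mem_reverse, List.mem_finRange, true_and,
    List.mem_map, mem_orderedLetters, Prod.mk.injEq]
  constructor
  · rintro ⟨_, _, k', h, rfl, rfl, rfl⟩
    split_ifs at h <;> simpa using h
  · intro h
    refine ⟨b, b', k, ?_, rfl, rfl, rfl⟩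
    split_ifs <;> simpa using h

theorem pairwise_finRange (N : ℕ) : (List.finRange N).Pairwise fun a b => a.val < b.val := by
  rw [← List.pairwise_map (f := Fin.val) (R := fun a b => a < b)]
  simp [List.pairwise_lt_range]

theorem pairwise_orderedLetters (k : ℕ) : (orderedLetters m n k).Pairwise fun a b =>
    if k = 0 then a.val < b.val else b.val < a.val := by
  unfold orderedLetters
  split_ifs
  · exact pairwise_finRange _
  · rw [List.pairwise_reverse]; exact pairwise_finRange _

theorem pairwise_points (A : MSharp m n u v) :
    (points A).Pairwise fun x y => posKey x < posKey y := by
  simp only [posKey_lt]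
  rw [points, List.pairwise_flatMap]
  refine ⟨fun b' _ => ?_, (pairwise_finRange _).imp ?_⟩
  · rw [List.pairwise_flatMap]
    refine ⟨fun b _ => ?_, (pairwise_orderedLetters _).imp ?_⟩
    · rw [List.pairwise_map]
      refine List.pairwise_lt_range.imp ?_
      intro k l h
      simp [h]
    · intro b c h x hx y hy
      simp only [List.mem_map] at hx hy
      obtain ⟨k, -, rfl⟩ := hx
      obtain ⟨l, -, rfl⟩ := hy
      simp only [deg_eq_zero] at h
      split_ifs at h <;> simp only [true_and] <;> omega
  · intro b' c' h x hx y hy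
    simp only [List.mem_flatMap, List.mem_map] at hx hy
    obtain ⟨b, -, k, -, rfl⟩ := hx
    obtain ⟨c, -, l, -, rfl⟩ := hy
    exact Or.inl h

theorem pairwise_pointsStar (A : MSharp m n u v) :
    (pointsStar A).Pairwise fun x y => valKey y < valKey x := by
  simp only [valKey_lt]
  rw [pointsStar, List.pairwise_flatMap]
  refine ⟨fun b _ => ?_, ?_⟩
  · rw [List.pairwise_flatMap]
    refine ⟨fun b' _ => ?_, (pairwise_orderedLetters _).imp ?_⟩
    · rw [List.pairwise_map]
      simp only [deg_eq_zero]
      split_ifs with hb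
      · refine List.pairwise_lt_range.imp ?_
        intro k l h
        simp only [true_and]; omega
      · rw [List.pairwise_reverse]
        refine List.pairwise_lt_range.imp ?_
        intro k l h
        simp only [true_and]; omega
    · intro b' c' h x hx y hy
      simp only [List.mem_map] at hx hy
      obtain ⟨k, -, rfl⟩ := hx
      obtain ⟨l, -, rfl⟩ := hy
      simp only [deg_eq_zero] at h
      split_ifs at h <;> simp only [true_and] <;> omega
  · rw [List.pairwise_reverse]
    refine (pairwise_finRange _).imp ?_
    intro b c h x hx y hy
    simp only [List.mem_flatMap, List.mem_map] at hx hy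
    obtain ⟨b', -, k, -, rfl⟩ := hx
    obtain ⟨c', -, l, -, rfl⟩ := hy
    exact Or.inl h

theorem points_perm (A : MSharp m n u v) : (points A).Perm (pointsStar A) := by
  rw [List.perm_ext_iff_of_nodup]
  · intro x; rw [mem_points, mem_pointsStar]
  · exact (pairwise_points A).imp fun h => by rintro rfl; exact h.false
  · exact (pairwise_pointsStar A).imp fun h => by rintro rfl; exact h.false

theorem map_points (A : MSharp m n u v) : (points A).map (fun x => x.1) = (words A).1 := by
  rw [words_fst]
  simp only [points, List.map_flatMap, List.map_map, Function.comp_def]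
  simp only [List.map_const', List.length_range]
  rfl

theorem map_pointsStar (A : MSharp m n u v) :
    (pointsStar A).map (fun x => x.2.1) = (wordsStar A).2 := by
  rw [wordsStar_snd]
  simp only [pointsStar, List.map_flatMap, List.map_map, Function.comp_def]
  congr 1
  funext b
  congr 1
  funext b'
  split_ifs <;> simp [MSharp.transpose]

/-- The insertion tableaux of the two words of a matrix have conjugate shapes. -/
theorem conj_words (A : MSharp m n u v) :
    Conj (colLens (wordTab (bumps m n) (words A).1))
      (colLens (wordTab (bumps u v) (wordsStar A).2)) := by
  have h := conj_strictShape posKey valKey (points A) (pointsStar A) (points_perm A)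
    (pairwise_points A) (pairwise_pointsStar A)
  have h1 : colLens (wordTab (bumps m n) (words A).1) = strictShape ((points A).map valKey) := by
    -- A barred letter bumps an earlier copy of itself and an unbarred one does not. Accordingly
    -- `valKey` makes later copies smaller in the barred case and larger in the unbarred case.
    have h2 := colLens_wordTab_map (r := ltRel) (s := bumps m n)
      (π := fun κ : Letter m n ×ₗ ℤ ×ₗ ℤ => (ofLex κ).1) (w := (points A).map valKey)
      isBump_ltRel isBump_bumps ?_
    · rw [strictShape, ← h2, ← map_points, List.map_map]; rfl
    · rw [List.pairwise_map]
      refine (pairwise_points A).imp ?_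
      intro y x h
      rw [Bool.eq_iff_iff, bumps_iff]
      simp only [ltRel, decide_eq_true_eq, valKey_lt]
      rw [posKey_lt] at h
      simp only [valKey, ofLex_toLex]
      omega
  have h3 : colLens (wordTab (bumps u v) (wordsStar A).2) =
      strictShape ((pointsStar A).map posKey) := by
    have h2 := colLens_wordTab_map (r := ltRel) (s := bumps u v)
      (π := fun κ : Letter u v ×ₗ ℤ ×ₗ ℤ => (ofLex κ).1) (w := (pointsStar A).map posKey)
      isBump_ltRel isBump_bumps ?_
    · rw [strictShape, ← h2, ← map_pointsStar, List.map_map]; rfl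
    · rw [List.pairwise_map]
      refine List.Pairwise.imp_of_mem ?_ (pairwise_pointsStar A)
      intro y x hy hx h
      rw [mem_pointsStar] at hx hy
      rw [Bool.eq_iff_iff, bumps_iff]
      simp only [ltRel, decide_eq_true_eq, posKey_lt]
      rw [valKey_lt] at h
      simp only [posKey, ofLex_toLex]
      -- Repeated copies of one pair `(b, b')` come in the order required for `b'` only if the
      -- degrees of `b` and `b'` differ. For equal degrees the bound `1` on the entry leaves no
      -- repetition.
      have hA := A.2 x.1 x.2.1
      rw [show (deg m n x.1 = deg u v x.2.1 ↔ (x.1.val < m ↔ x.2.1.val < u)) by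
        unfold deg; split_ifs <;> simp <;> omega] at hA
      have hxy : x.1.val = y.1.val → x.2.1.val = y.2.1.val → A.1 y.1 y.2.1 = A.1 x.1 x.2.1 := by
        intro h1 h2
        rw [Fin.ext h1, Fin.ext h2]
      omega
  rw [h1, h3]
  exact h

end Letters

end HookCrystal


namespace HookCrystal

/-! ### The crystal of words -/

section Words

variable {m n : ℕ}

theorem lo_ne_hi (i : Idx m n) : lo m n i ≠ hi m n i := by
  simp [lo, hi, Fin.ext_iff]

/-- The signs of the form at the two ends of the arrow agree for an even root and differ for the odd
one; the sign in `coroot` then normalises the unbarred roots. -/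
theorem coroot_eq (i : Idx m n) (μ : Weight m n) : coroot m n i μ =
    if i.val + 1 = m then μ (lo m n i) + μ (hi m n i) else μ (lo m n i) - μ (hi m n i) := by
  have h : form m n (simpleRoot m n i) μ = (-1) ^ deg m n (lo m n i) * μ (lo m n i) -
      (-1) ^ deg m n (hi m n i) * μ (hi m n i) := by
    simp only [form, simpleRoot, Pi.sub_apply, mul_sub, sub_mul, Finset.sum_sub_distrib]
    congr 1
    · rw [Finset.sum_eq_single (lo m n i)] <;> simp +contextual
    · rw [Finset.sum_eq_single (hi m n i)] <;> simp +contextual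
  unfold coroot
  rw [h]
  have h1 : deg m n (lo m n i) = if i.val < m then 0 else 1 := rfl
  have h2 : deg m n (hi m n i) = if i.val + 1 < m then 0 else 1 := rfl
  rw [h1, h2]
  split_ifs <;> omega

theorem wordWt_cons (a : Letter m n) (w : List (Letter m n)) :
    wordWt m n (a :: w) = Pi.single a 1 + wordWt m n w := by
  funext b
  by_cases h : a = b
  · subst h; simp [wordWt, add_comm]
  · simp [wordWt, List.count_cons_of_ne h, Ne.symm h]

theorem coroot_add (i : Idx m n) (μ ν : Weight m n) :
    coroot m n i (μ + ν) = coroot m n i μ + coroot m n i ν := by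
  simp only [coroot_eq, Pi.add_apply]
  split_ifs <;> ring

theorem coroot_single (i : Idx m n) (a : Letter m n) : coroot m n i (Pi.single a 1) =
    if a = lo m n i then 1 else if a = hi m n i then (if i.val + 1 = m then 1 else -1) else 0 := by
  have := lo_ne_hi i
  rw [coroot_eq]
  by_cases h1 : a = lo m n i
  · subst h1; simp [this.symm]
  · by_cases h2 : a = hi m n i
    · subst h2; simp [this, this.symm]
    · simp [h1, h2, Ne.symm h1, Ne.symm h2]

/-- This removes the weight of the tail from the recursive rules, which then involve only `wordε`
and `wordφ` of the tail. -/
theorem word_string (i : Idx m n) (hi : i.val + 1 ≠ m) (w : List (Letter m n)) :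
    (wordφ m n i w : ℤ) - wordε m n i w = coroot m n i (wordWt m n w) := by
  induction w with
  | nil => simp [wordφ, wordε, coroot_eq, wordWt]
  | cons a w ih =>
    rw [wordWt_cons, coroot_add]
    simp only [wordφ, wordε, letterCrystal, hi, if_false, ← ih, coroot_single]
    have := lo_ne_hi i
    by_cases h1 : a = lo m n i
    · subst h1
      simp only [if_true, this, if_false]
      split_ifs <;> push_cast <;> omega
    · by_cases h2 : a = HookCrystal.hi m n i
      · subst h2
        simp only [if_true, this.symm, if_false]
        split_ifs <;> push_cast <;> omega
      · simp only [h1, h2, if_false]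
        split_ifs <;> push_cast <;> omega

section Barred

variable {i : Idx m n} (h : i.val + 1 < m)
include h

/-- At a barred index the rule is a bracketing: a letter `lo` in front cancels one uncancelled `hi`
behind it. Truncated subtraction replaces the maxima. -/
theorem wordε_cons_of_lt (a : Letter m n) (w) : wordε m n i (a :: w) =
    if a = lo m n i then wordε m n i w - 1 else if a = hi m n i then wordε m n i w + 1
      else wordε m n i w := by
  have := lo_ne_hi i
  simp only [wordε, letterCrystal, h, if_true, coroot_single, h.ne, if_false]
  by_cases h1 : a = lo m n i
  · subst h1; simp only [if_true, this, if_false]; omega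
  · simp only [h1, if_false]; split_ifs <;> omega

theorem wordφ_cons_of_lt (a : Letter m n) (w) : wordφ m n i (a :: w) =
    if a = lo m n i then wordφ m n i w + (1 - wordε m n i w) else wordφ m n i w := by
  have := lo_ne_hi i
  simp only [wordφ, letterCrystal, h, if_true, ← word_string i h.ne]
  split_ifs <;> push_cast <;> omega

theorem wordF_cons_of_lt (a : Letter m n) (w) : wordF m n i (a :: w) =
    if a = lo m n i ∧ wordε m n i w = 0 then some (hi m n i :: w)
    else (wordF m n i w).map (a :: ·) := by
  simp only [wordF, letterCrystal, h, if_true]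
  by_cases h1 : a = lo m n i <;> simp [h1]

theorem wordE_cons_of_lt (a : Letter m n) (w) : wordE m n i (a :: w) =
    if a = hi m n i ∧ wordε m n i w = 0 then some (lo m n i :: w)
    else if wordε m n i w ≤ (if a = lo m n i then 1 else 0) then none
    else (wordE m n i w).map (a :: ·) := by
  have := lo_ne_hi i
  simp only [wordE, letterCrystal, h, if_true]
  by_cases h1 : a = lo m n i
  · simp [h1, this]
  · by_cases h2 : a = hi m n i <;> simp [h1, h2, this.symm]
    split_ifs <;> rfl

end Barred

section Odd

variable {i : Idx m n} (h : i.val + 1 = m)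
include h

/-- At the odd index nothing cancels: the first letter that is an end of the arrow decides alone. -/
theorem wordε_cons_of_eq (a : Letter m n) (w) : wordε m n i (a :: w) =
    if a = lo m n i then 0 else if a = hi m n i then 1 else wordε m n i w := by
  have := lo_ne_hi i
  simp only [wordε, letterCrystal, h, lt_irrefl, if_true, if_false, coroot_single]
  by_cases h1 : a = lo m n i
  · subst h1; simp [this]
  · by_cases h2 : a = hi m n i <;> simp [h1, h2, this.symm]

theorem wordφ_cons_of_eq (a : Letter m n) (w) : wordφ m n i (a :: w) =
    if a = lo m n i then 1 else if a = hi m n i then 0 else wordφ m n i w := by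
  have := lo_ne_hi i
  simp only [wordφ, letterCrystal, h, lt_irrefl, if_true, if_false, coroot_single]
  by_cases h1 : a = lo m n i
  · subst h1; simp
  · by_cases h2 : a = hi m n i <;> simp [h1, h2, this.symm]

theorem wordF_cons_of_eq (a : Letter m n) (w) : wordF m n i (a :: w) =
    if a = lo m n i then some (hi m n i :: w) else if a = hi m n i then none
    else (wordF m n i w).map (a :: ·) := by
  have := lo_ne_hi i
  simp only [wordF, letterCrystal, h, lt_irrefl, if_true, if_false, coroot_single,
    decide_eq_true_eq]
  by_cases h1 : a = lo m n i
  · subst h1; simp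
  · by_cases h2 : a = hi m n i <;> simp [h1, h2, this.symm]

theorem wordE_cons_of_eq (a : Letter m n) (w) : wordE m n i (a :: w) =
    if a = hi m n i then some (lo m n i :: w) else if a = lo m n i then none
    else (wordE m n i w).map (a :: ·) := by
  have := lo_ne_hi i
  simp only [wordE, letterCrystal, h, lt_irrefl, if_true, if_false, coroot_single,
    decide_eq_true_eq]
  by_cases h1 : a = lo m n i
  · subst h1; simp [this]
  · by_cases h2 : a = hi m n i <;> simp [h1, h2, this.symm]

end Odd

section Unbarred

variable {i : Idx m n} (h : m < i.val + 1)
include h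

/-- The bracketing is opposite to that of a barred index: here a letter `hi` in front cancels a `lo`
behind it. -/
theorem wordε_cons_of_gt (a : Letter m n) (w) : wordε m n i (a :: w) =
    if a = hi m n i then wordε m n i w + (1 - wordφ m n i w) else wordε m n i w := by
  have := lo_ne_hi i
  simp only [wordε, letterCrystal, h.not_gt, h.ne', if_false, ← word_string i h.ne']
  split_ifs <;> push_cast <;> omega

theorem wordφ_cons_of_gt (a : Letter m n) (w) : wordφ m n i (a :: w) =
    if a = lo m n i then wordφ m n i w + 1 else if a = hi m n i then wordφ m n i w - 1
      else wordφ m n i w := by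
  have := lo_ne_hi i
  simp only [wordφ, letterCrystal, h.not_gt, h.ne', if_false, coroot_single]
  by_cases h1 : a = lo m n i
  · subst h1; simp only [if_true]; omega
  · simp only [h1, if_false]; split_ifs <;> omega

theorem wordF_cons_of_gt (a : Letter m n) (w) : wordF m n i (a :: w) =
    if a = lo m n i ∧ wordφ m n i w = 0 then some (hi m n i :: w)
    else if wordφ m n i w ≤ (if a = hi m n i then 1 else 0) then none
    else (wordF m n i w).map (a :: ·) := by
  have := lo_ne_hi i
  simp only [wordF, letterCrystal, h.not_gt, h.ne', if_false]
  by_cases h1 : a = hi m n i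
  · simp [h1, this.symm]
  · by_cases h2 : a = lo m n i <;> simp [h1, h2, this]
    split_ifs <;> rfl

theorem wordE_cons_of_gt (a : Letter m n) (w) : wordE m n i (a :: w) =
    if a = hi m n i ∧ wordφ m n i w = 0 then some (lo m n i :: w)
    else (wordE m n i w).map (a :: ·) := by
  simp only [wordE, letterCrystal, h.not_gt, h.ne', if_false]
  by_cases h1 : a = hi m n i <;> simp [h1]

end Unbarred

theorem wordF_eq_none_iff (i : Idx m n) (w : List (Letter m n)) :
    wordF m n i w = none ↔ wordφ m n i w = 0 := by
  have hne := lo_ne_hi i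
  induction w with
  | nil => simp [wordF, wordφ]
  | cons a w ih =>
    rcases lt_trichotomy (i.val + 1) m with h | h | h
    · rw [wordF_cons_of_lt h, wordφ_cons_of_lt h]
      split_ifs <;> simp_all
      omega
    · rw [wordF_cons_of_eq h, wordφ_cons_of_eq h]
      split_ifs <;> simp_all
    · rw [wordF_cons_of_gt h, wordφ_cons_of_gt h]
      by_cases h1 : a = lo m n i
      · subst h1
        by_cases h2 : wordφ m n i w = 0 <;> simp [hne, h2, ih]
      · by_cases h2 : a = hi m n i
        · subst h2
          simp only [hne.symm, false_and, if_false, if_true]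
          split_ifs with h3
          · simp; omega
          · simp [ih]; omega
        · simp only [h1, h2, false_and, if_false]
          split_ifs with h3
          · simp; omega
          · simp [ih]

theorem wordF_spec (i : Idx m n) {w w' : List (Letter m n)} (hw : wordF m n i w = some w') :
    wordε m n i w' = wordε m n i w + 1 ∧ wordφ m n i w' + 1 = wordφ m n i w ∧
      wordWt m n w' = wordWt m n w - simpleRoot m n i := by
  have hne := lo_ne_hi i
  induction w generalizing w' with
  | nil => simp [wordF] at hw
  | cons a w ih =>
    have hhead : wordWt m n (hi m n i :: w) = wordWt m n (lo m n i :: w) - simpleRoot m n i := by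
      rw [wordWt_cons, wordWt_cons, simpleRoot]; abel
    have htail : ∀ w'', wordF m n i w = some w'' →
        wordWt m n (a :: w'') = wordWt m n (a :: w) - simpleRoot m n i := by
      intro w'' h
      rw [wordWt_cons, wordWt_cons, (ih h).2.2]; abel
    rcases lt_trichotomy (i.val + 1) m with h | h | h
    · rw [wordF_cons_of_lt h] at hw
      split_ifs at hw with h1
      · cases hw
        rw [h1.1]
        exact ⟨by simp [wordε_cons_of_lt h, hne.symm, h1.2], by simp [wordφ_cons_of_lt h, hne.symm, h1.2], hhead⟩
      · rw [Option.map_eq_some_iff] at hw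
        obtain ⟨w'', hw, rfl⟩ := hw
        obtain ⟨h2, h3, -⟩ := ih hw
        refine ⟨?_, ?_, htail w'' hw⟩
        · rw [wordε_cons_of_lt h, wordε_cons_of_lt h]
          split_ifs <;> simp_all <;> omega
        · rw [wordφ_cons_of_lt h, wordφ_cons_of_lt h]
          split_ifs <;> simp_all <;> omega
    · rw [wordF_cons_of_eq h] at hw
      split_ifs at hw with h1 h2
      · cases hw
        rw [h1]
        exact ⟨by simp [wordε_cons_of_eq h, hne.symm], by simp [wordφ_cons_of_eq h, hne.symm], hhead⟩
      · rw [Option.map_eq_some_iff] at hw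
        obtain ⟨w'', hw, rfl⟩ := hw
        obtain ⟨h3, h4, -⟩ := ih hw
        refine ⟨?_, ?_, htail w'' hw⟩
        · rw [wordε_cons_of_eq h, wordε_cons_of_eq h]
          simp only [h1, h2, if_false]; exact h3
        · rw [wordφ_cons_of_eq h, wordφ_cons_of_eq h]
          simp only [h1, h2, if_false]; exact h4
    · rw [wordF_cons_of_gt h] at hw
      by_cases h1 : a = lo m n i ∧ wordφ m n i w = 0
      · rw [if_pos h1] at hw
        cases hw
        rw [h1.1]
        exact ⟨by simp [wordε_cons_of_gt h, hne, h1.2], by simp [wordφ_cons_of_gt h, hne.symm, h1.2], hhead⟩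
      · rw [if_neg h1] at hw
        by_cases h5 : wordφ m n i w ≤ (if a = hi m n i then 1 else 0)
        · rw [if_pos h5] at hw; cases hw
        rw [if_neg h5] at hw
        rw [Option.map_eq_some_iff] at hw
        obtain ⟨w'', hw, rfl⟩ := hw
        obtain ⟨h2, h3, -⟩ := ih hw
        refine ⟨?_, ?_, htail w'' hw⟩
        · rw [wordε_cons_of_gt h, wordε_cons_of_gt h]
          split_ifs at h5 ⊢ <;> omega
        · rw [wordφ_cons_of_gt h, wordφ_cons_of_gt h]
          split_ifs at h5 ⊢ <;> omega

/-- By `wordF_spec` an application of `f_i` to the tail shifts the values on the tail by one, and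
this is just enough for `e_i` to choose in the new word the factor that `f_i` chose in the old one.
-/
theorem wordE_spec (i : Idx m n) {w w' : List (Letter m n)} :
    wordF m n i w = some w' ↔ wordE m n i w' = some w := by
  have hne := lo_ne_hi i
  have main : ∀ w w' : List (Letter m n), wordF m n i w = some w' ↔ wordE m n i w' = some w := by
    intro w
    induction w with
    | nil =>
      intro w'
      simp only [wordF, reduceCtorEq, false_iff]
      cases w' with
      | nil => simp [wordE]
      | cons a w' =>
        rcases lt_trichotomy (i.val + 1) m with h | h | h
        · rw [wordE_cons_of_lt h]; split_ifs <;> simp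
        · rw [wordE_cons_of_eq h]; split_ifs <;> simp
        · rw [wordE_cons_of_gt h]; split_ifs <;> simp
    | cons a w ih =>
      intro w'
      cases w' with
      | nil =>
        simp only [wordE, reduceCtorEq, iff_false]
        rcases lt_trichotomy (i.val + 1) m with h | h | h
        · rw [wordF_cons_of_lt h]; split_ifs <;> simp
        · rw [wordF_cons_of_eq h]; split_ifs <;> simp
        · rw [wordF_cons_of_gt h]; split_ifs <;> simp
      | cons b w' =>
        have ih' := ih w'
        rcases lt_trichotomy (i.val + 1) m with h | h | h
        · rw [wordF_cons_of_lt h, wordE_cons_of_lt h]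
          by_cases hw : wordF m n i w = some w'
          · have hs := wordF_spec i hw
            have hE := ih'.1 hw
            by_cases ha : a = lo m n i <;> by_cases hb : b = hi m n i <;>
            split_ifs <;> simp_all <;> first | omega | grind
          · have hE : ¬ wordE m n i w' = some w := fun hh => hw (ih'.2 hh)
            split_ifs <;> simp_all <;> grind
        · rw [wordF_cons_of_eq h, wordE_cons_of_eq h]
          split_ifs <;> simp_all <;> grind
        · rw [wordF_cons_of_gt h, wordE_cons_of_gt h]
          by_cases hw : wordF m n i w = some w'
          · have hs := wordF_spec i hw
            have hE := ih'.1 hw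
            by_cases ha : a = lo m n i <;> by_cases hb : b = hi m n i <;>
            split_ifs <;> simp_all <;> first | omega | grind
          · have hE : ¬ wordE m n i w' = some w := fun hh => hw (ih'.2 hh)
            split_ifs <;> simp_all <;> grind
  exact main w w'

theorem coroot_wordWt_nonneg (i : Idx m n) (h : i.val + 1 = m) (w : List (Letter m n)) :
    0 ≤ coroot m n i (wordWt m n w) := by
  rw [coroot_eq, if_pos h]; simp only [wordWt]; omega

theorem word_odd_string (i : Idx m n) (h : i.val + 1 = m) (w : List (Letter m n)) :
    wordφ m n i w + wordε m n i w = if coroot m n i (wordWt m n w) = 0 then 0 else 1 := by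
  induction w with
  | nil => simp [wordφ, wordε, coroot_eq, wordWt]
  | cons a w ih =>
    have h0 := coroot_wordWt_nonneg i h w
    have hne := lo_ne_hi i
    rw [wordWt_cons, coroot_add, coroot_single, wordφ_cons_of_eq h, wordε_cons_of_eq h]
    by_cases h1 : a = lo m n i
    · simp only [h1, if_true]; rw [if_neg (by omega)]
    · by_cases h2 : a = hi m n i
      · simp only [h2, hne.symm, if_true, if_false, h]; rw [if_neg (by omega)]
      · simp only [h1, h2, if_false, zero_add]; exact ih

theorem isCrystal_wordCrystal : (wordCrystal m n).IsCrystal where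
  string i w h := word_string i h w
  odd_nonneg i w h := coroot_wordWt_nonneg i h w
  odd_string i w h := word_odd_string i h w
  e_ε i w w' h := by
    have := (wordF_spec i ((wordE_spec i).2 h)).1
    simp only [wordCrystal]; omega
  e_φ i w w' h := (wordF_spec i ((wordE_spec i).2 h)).2.1.symm
  e_wt i w w' h := by
    have := (wordF_spec i ((wordE_spec i).2 h)).2.2
    simp only [wordCrystal]; rw [this]; abel
  f_ε i w w' h := (wordF_spec i h).1
  f_φ i w w' h := by
    have := (wordF_spec i h).2.1
    simp only [wordCrystal]; omega
  f_wt i w w' h := (wordF_spec i h).2.2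
  f_iff_e i w w' := wordE_spec i

/-- The tensor product rule for concatenations: where `f_i` acts, and the values of `ε_i` and
`φ_i`, depend only on the values of `ε_i` and `φ_i` on the factors. -/
theorem word_append (i : Idx m n) : ∃ (P : ℕ → ℕ → ℕ → ℕ → Prop) (a b : ℕ → ℕ → ℕ → ℕ → ℕ),
    ∀ x y : List (Letter m n),
      (P (wordε m n i x) (wordφ m n i x) (wordε m n i y) (wordφ m n i y) →
        wordF m n i (x ++ y) = (wordF m n i x).map (· ++ y)) ∧
      (¬ P (wordε m n i x) (wordφ m n i x) (wordε m n i y) (wordφ m n i y) →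
        wordF m n i (x ++ y) = (wordF m n i y).map (x ++ ·)) ∧
      wordε m n i (x ++ y) = a (wordε m n i x) (wordφ m n i x) (wordε m n i y) (wordφ m n i y) ∧
      wordφ m n i (x ++ y) = b (wordε m n i x) (wordφ m n i x) (wordε m n i y) (wordφ m n i y) := by
  have hne := lo_ne_hi i
  rcases lt_trichotomy (i.val + 1) m with h | h | h
  · refine ⟨fun _ φx εy _ => εy < φx, fun εx φx εy _ => εx + (εy - φx),
      fun _ φx εy φy => φy + (φx - εy), fun x y => ?_⟩
    induction x with
    | nil => simp [wordε, wordφ]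
    | cons c x ih =>
      obtain ⟨ih1, ih2, ih3, ih4⟩ := ih
      rw [List.cons_append, wordε_cons_of_lt h, wordε_cons_of_lt h, wordφ_cons_of_lt h,
        wordφ_cons_of_lt h, wordF_cons_of_lt h, wordF_cons_of_lt h, ih3, ih4]
      refine ⟨fun hP => ?_, fun hP => ?_, by beta_reduce; split_ifs <;> omega,
        by beta_reduce; split_ifs <;> omega⟩
      · by_cases hc : c = lo m n i
        · simp only [hc, true_and, if_true] at hP ⊢
          by_cases h0 : wordε m n i x = 0
          · rw [if_pos h0, if_pos (by omega)]; simp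
          · rw [if_neg h0, if_neg (by omega), ih1 (by omega)]; simp [Function.comp_def]
        · simp only [hc, false_and, if_false] at hP ⊢
          rw [ih1 hP]; simp [Function.comp_def]
      · by_cases hc : c = lo m n i
        · simp only [hc, true_and, if_true] at hP ⊢
          rw [if_neg (by omega), ih2 (by omega)]; simp [Function.comp_def]
        · simp only [hc, false_and, if_false] at hP ⊢
          rw [ih2 hP]; simp [Function.comp_def]
  -- For the odd index `φ + ε` is `1` if the factor contains an end of the arrow and `0` otherwise,
  -- so the first factor that contains one acts.
  · refine ⟨fun εx φx _ _ => φx + εx ≠ 0, fun εx φx εy _ => if φx + εx = 0 then εy else εx,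
      fun εx φx _ φy => if φx + εx = 0 then φy else φx, fun x y => ?_⟩
    induction x with
    | nil => simp [wordε, wordφ]
    | cons c x ih =>
      obtain ⟨ih1, ih2, ih3, ih4⟩ := ih
      rw [List.cons_append, wordε_cons_of_eq h, wordε_cons_of_eq h, wordφ_cons_of_eq h,
        wordφ_cons_of_eq h, wordF_cons_of_eq h, wordF_cons_of_eq h, ih3, ih4]
      by_cases hc : c = lo m n i
      · simp [hc]
      · by_cases hc' : c = hi m n i
        · simp [hc', hne.symm]
        · simp only [hc, hc', if_false]
          refine ⟨fun hP => ?_, fun hP => ?_, trivial, trivial⟩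
          · rw [ih1 hP]; simp [Function.comp_def]
          · rw [ih2 hP]; simp [Function.comp_def]
  · refine ⟨fun εx _ _ φy => φy ≤ εx, fun εx _ εy φy => εy + (εx - φy),
      fun εx φx _ φy => φx + (φy - εx), fun x y => ?_⟩
    induction x with
    | nil =>
      simp only [List.nil_append, wordε, wordφ, wordF, Option.map_none]
      refine ⟨fun hP => ?_, fun _ => by simp, by omega, by omega⟩
      -- With an empty first factor the condition forces `φ_i y = 0`, so both sides are `none`.
      rw [wordF_eq_none_iff]; omega
    | cons c x ih =>
      obtain ⟨ih1, ih2, ih3, ih4⟩ := ih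
      rw [List.cons_append, wordε_cons_of_gt h, wordε_cons_of_gt h, wordφ_cons_of_gt h,
        wordφ_cons_of_gt h, wordF_cons_of_gt h, wordF_cons_of_gt h, ih3, ih4]
      refine ⟨fun hP => ?_, fun hP => ?_, by beta_reduce; split_ifs <;> omega,
        by beta_reduce; split_ifs <;> first | omega | grind⟩
      · by_cases hc : c = lo m n i
        · simp only [hc, true_and, hne, if_false] at hP ⊢
          by_cases h0 : wordφ m n i x = 0
          · rw [if_pos h0, if_pos (by omega)]; simp
          · rw [if_neg h0, if_neg (by omega), if_neg (by omega), if_neg (by omega),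
              ih1 (by omega)]; simp [Function.comp_def]
        · simp only [hc, false_and, if_false] at hP ⊢
          by_cases h0 : wordφ m n i x ≤ (if c = hi m n i then 1 else 0)
          · rw [if_pos h0, if_pos (by split_ifs at * <;> omega)]; simp
          · rw [if_neg h0, if_neg (by split_ifs at * <;> omega),
              ih1 (by split_ifs at * <;> omega)]
            simp [Function.comp_def]
      · by_cases hc : c = lo m n i
        · simp only [hc, true_and, hne, if_false] at hP ⊢
          rw [if_neg (by omega), if_neg (by omega), ih2 (by omega)]; simp [Function.comp_def]
        · simp only [hc, false_and, if_false] at hP ⊢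
          rw [if_neg (by split_ifs at * <;> omega), ih2 (by split_ifs at * <;> omega)]
          simp [Function.comp_def]

end Words

end HookCrystal


namespace HookCrystal

/-! ### Relations on words which the operators `f_i` preserve -/

section Stable

variable {m n : ℕ}

/-- A relation between words which permutes letters and is respected by `f_i`. -/
structure Stable (i : Idx m n) (R : List (Letter m n) → List (Letter m n) → Prop) : Prop where
  perm : ∀ w v, R w v → w.Perm v
  step : ∀ w v, R w v → ∀ w', wordF m n i w = some w' → ∃ v', wordF m n i v = some v' ∧ R w' v'
  maps_none : ∀ w v, R w v → wordF m n i w = none → wordF m n i v = none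

theorem wordWt_perm {w v : List (Letter m n)} (h : w.Perm v) : wordWt m n w = wordWt m n v := by
  funext b; simp only [wordWt]; rw [h.count_eq]

variable {i : Idx m n}

/-- The value `φ_i` is the number of times that `f_i` can be applied, and related words allow the
same number of steps. Then `ε_i` agrees too, since the weights agree. -/
theorem Stable.φ_eq {R} (hR : Stable i R) {w v : List (Letter m n)} (h : R w v) :
    wordφ m n i w = wordφ m n i v := by
  induction hk : wordφ m n i w generalizing w v with
  | zero =>
    rw [← wordF_eq_none_iff] at hk
    exact ((wordF_eq_none_iff i v).1 (hR.maps_none w v h hk)).symm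
  | succ k ih =>
    have hne : wordF m n i w ≠ none := by rw [Ne, wordF_eq_none_iff]; omega
    obtain ⟨w', hw'⟩ := Option.ne_none_iff_exists'.1 hne
    obtain ⟨v', hv', hR'⟩ := hR.step w v h w' hw'
    have h1 := (wordF_spec i hw').2.1
    have h2 := (wordF_spec i hv').2.1
    have := ih hR' (by omega)
    omega

theorem Stable.ε_eq {R} (hR : Stable i R) {w v : List (Letter m n)} (h : R w v) :
    wordε m n i w = wordε m n i v := by
  have h1 := hR.φ_eq h
  have h2 := wordWt_perm (hR.perm w v h)
  by_cases hi : i.val + 1 = m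
  · have h3 := word_odd_string i hi w
    have h4 := word_odd_string i hi v
    rw [h2] at h3; omega
  · have h3 := word_string i hi w
    have h4 := word_string i hi v
    rw [h2] at h3; omega

theorem wordF_length {w w' : List (Letter m n)} (h : wordF m n i w = some w') :
    w'.length = w.length := by
  induction w generalizing w' with
  | nil => simp [wordF] at h
  | cons a w ih =>
    have hmap : ∀ w', (wordF m n i w).map (a :: ·) = some w' → w'.length = (a :: w).length := by
      intro w' h
      obtain ⟨w'', h', rfl⟩ := Option.map_eq_some_iff.1 h
      simp [ih h']
    rcases lt_trichotomy (i.val + 1) m with hm | hm | hm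
    · rw [wordF_cons_of_lt hm] at h
      split_ifs at h
      · cases h; simp
      · exact hmap _ h
    · rw [wordF_cons_of_eq hm] at h
      split_ifs at h
      · cases h; simp
      · exact hmap _ h
    · rw [wordF_cons_of_gt hm] at h
      by_cases h1 : a = lo m n i ∧ wordφ m n i w = 0
      · rw [if_pos h1] at h; cases h; simp
      · rw [if_neg h1] at h
        by_cases h2 : wordφ m n i w ≤ (if a = hi m n i then 1 else 0)
        · rw [if_pos h2] at h; cases h
        · rw [if_neg h2] at h; exact hmap _ h

theorem wordF_append {x y w' : List (Letter m n)} (h : wordF m n i (x ++ y) = some w') :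
    (∃ x', wordF m n i x = some x' ∧ w' = x' ++ y) ∨
      (∃ y', wordF m n i y = some y' ∧ w' = x ++ y') := by
  obtain ⟨P, a, b, hP⟩ := word_append i
  obtain ⟨h1, h2, -⟩ := hP x y
  by_cases hc : P (wordε m n i x) (wordφ m n i x) (wordε m n i y) (wordφ m n i y)
  · rw [h1 hc] at h
    obtain ⟨x', h', rfl⟩ := Option.map_eq_some_iff.1 h
    exact Or.inl ⟨x', h', rfl⟩
  · rw [h2 hc] at h
    obtain ⟨y', h', rfl⟩ := Option.map_eq_some_iff.1 h
    exact Or.inr ⟨y', h', rfl⟩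

/-- Concatenation of relations. -/
def Concat (R S : List (Letter m n) → List (Letter m n) → Prop) (w v : List (Letter m n)) : Prop :=
  ∃ x y x' y', R x x' ∧ S y y' ∧ w = x ++ y ∧ v = x' ++ y'

/-- Related factors have equal `ε_i` and `φ_i`, so the tensor product rule lets `f_i` act in the
same factor of both words. -/
theorem Stable.concat {R S} (hR : Stable i R) (hS : Stable i S) : Stable i (Concat R S) := by
  obtain ⟨P, a, b, hP⟩ := word_append i
  refine ⟨?_, ?_, ?_⟩
  · rintro w v ⟨x, y, x', y', h1, h2, rfl, rfl⟩
    exact (hR.perm _ _ h1).append (hS.perm _ _ h2)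
  · rintro w v ⟨x, y, x', y', h1, h2, rfl, rfl⟩ w' hw'
    obtain ⟨e1, e2, -⟩ := hP x y
    obtain ⟨d1, d2, -⟩ := hP x' y'
    rw [← hR.φ_eq h1, ← hR.ε_eq h1, ← hS.φ_eq h2, ← hS.ε_eq h2] at d1 d2
    by_cases hc : P (wordε m n i x) (wordφ m n i x) (wordε m n i y) (wordφ m n i y)
    · rw [e1 hc] at hw'
      obtain ⟨z, hz, rfl⟩ := Option.map_eq_some_iff.1 hw'
      obtain ⟨z', hz', hzz⟩ := hR.step _ _ h1 z hz
      exact ⟨z' ++ y', by rw [d1 hc, hz']; rfl, z, y, z', y', hzz, h2, rfl, rfl⟩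
    · rw [e2 hc] at hw'
      obtain ⟨z, hz, rfl⟩ := Option.map_eq_some_iff.1 hw'
      obtain ⟨z', hz', hzz⟩ := hS.step _ _ h2 z hz
      exact ⟨x' ++ z', by rw [d2 hc, hz']; rfl, x, z, x', z', h1, hzz, rfl, rfl⟩
  · rintro w v ⟨x, y, x', y', h1, h2, rfl, rfl⟩ hw
    obtain ⟨e1, e2, -⟩ := hP x y
    obtain ⟨d1, d2, -⟩ := hP x' y'
    rw [← hR.φ_eq h1, ← hR.ε_eq h1, ← hS.φ_eq h2, ← hS.ε_eq h2] at d1 d2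
    by_cases hc : P (wordε m n i x) (wordφ m n i x) (wordε m n i y) (wordφ m n i y)
    · rw [e1 hc, Option.map_eq_none_iff] at hw
      rw [d1 hc, hR.maps_none _ _ h1 hw]; rfl
    · rw [e2 hc, Option.map_eq_none_iff] at hw
      rw [d2 hc, hS.maps_none _ _ h2 hw]; rfl

/-- The identity relation on a set of words. -/
def IdOn (S : List (Letter m n) → Prop) (w v : List (Letter m n)) : Prop := S w ∧ w = v

theorem stable_idOn {S : List (Letter m n) → Prop}
    (h : ∀ w w', S w → wordF m n i w = some w' → S w') : Stable i (IdOn S) where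
  perm := by rintro w v ⟨-, rfl⟩; exact List.Perm.refl _
  step := by rintro w v ⟨hS, rfl⟩ w' hw'; exact ⟨w', hw', h w w' hS hw', rfl⟩
  maps_none := by rintro w v ⟨-, rfl⟩ hw; exact hw

theorem stable_length (k : ℕ) : Stable i (IdOn fun w => w.length = k) :=
  stable_idOn fun _ _ h h' => by rw [wordF_length h', h]

/-! ### Two and three letters -/

theorem wordF_nil : wordF m n i [] = none := rfl
theorem wordε_nil : wordε m n i [] = 0 := rfl
theorem wordφ_nil : wordφ m n i [] = 0 := rfl

theorem bumps_eq_iff {c d : Letter m n} {fl : Bool} : bumps m n c d = fl ↔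
    ((c.val < d.val ∨ (c.val = d.val ∧ c.val < m)) ↔ fl = true) := by
  rw [← bumps_iff, Bool.eq_iff_iff]

/-- The words of two letters split into row words and column words, and each half is closed under
`f_i`. Everything about row words, column words and blocks reduces to this case. -/
theorem wordF_pair {a b : Letter m n} {w' : List (Letter m n)} {fl : Bool}
    (hab : bumps m n b a = fl) (h : wordF m n i [a, b] = some w') :
    ∃ a' b', w' = [a', b'] ∧ bumps m n b' a' = fl := by
  have hlo : (lo m n i).val = i.val := rfl
  have hhi : (hi m n i).val = i.val + 1 := rfl
  have hlen := wordF_length h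
  rcases w' with - | ⟨a', - | ⟨b', - | ⟨c', w'⟩⟩⟩ <;> simp at hlen
  refine ⟨a', b', rfl, ?_⟩
  rw [bumps_eq_iff] at hab ⊢
  rcases lt_trichotomy (i.val + 1) m with hm | hm | hm
  · simp only [wordF_cons_of_lt hm, wordε_cons_of_lt hm, wordF_nil, wordε_nil, Option.map_none] at h
    split_ifs at h <;>
    simp only [Option.map_some, Option.map_none, Option.some.injEq, List.cons.injEq, and_true,
      Fin.ext_iff, reduceCtorEq] at * <;>
    cases fl <;> simp only [iff_true, iff_false, Bool.false_eq_true, and_false, hlo, hhi] at * <;> omega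
  · simp only [wordF_cons_of_eq hm, wordF_nil, Option.map_none] at h
    split_ifs at h <;>
    simp only [Option.map_some, Option.map_none, Option.some.injEq, List.cons.injEq, and_true,
      Fin.ext_iff, reduceCtorEq] at * <;>
    cases fl <;> simp only [iff_true, iff_false, Bool.false_eq_true, hlo, hhi] at * <;> omega
  · simp only [wordF_cons_of_gt hm, wordφ_cons_of_gt hm, wordF_nil, wordφ_nil, Option.map_none] at h
    split_ifs at h <;>
    simp only [Option.map_some, Option.map_none, Option.some.injEq, List.cons.injEq, and_true,
      Fin.ext_iff, reduceCtorEq] at * <;>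
    cases fl <;> simp only [iff_true, iff_false, Bool.false_eq_true, and_false, hlo, hhi] at * <;> omega

end Stable

end HookCrystal


namespace HookCrystal

/-! ### Composition and restriction of preserved relations; closed sets of words. -/

section Bisimulation

variable {m n : ℕ} {i : Idx m n}

/-- Composition of relations. -/
def RelComp (R S : List (Letter m n) → List (Letter m n) → Prop) (w v : List (Letter m n)) : Prop :=
  ∃ x, R w x ∧ S x v

theorem Stable.comp {R S} (hR : Stable i R) (hS : Stable i S) : Stable i (RelComp R S) where
  perm := by
    rintro w v ⟨x, h1, h2⟩
    exact (hR.perm _ _ h1).trans (hS.perm _ _ h2)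
  step := by
    rintro w v ⟨x, h1, h2⟩ w' hw'
    obtain ⟨x', hx', h3⟩ := hR.step _ _ h1 _ hw'
    obtain ⟨v', hv', h4⟩ := hS.step _ _ h2 _ hx'
    exact ⟨v', hv', x', h3, h4⟩
  maps_none := by
    rintro w v ⟨x, h1, h2⟩ hw
    exact hS.maps_none _ _ h2 (hR.maps_none _ _ h1 hw)

/-- `f_i` preserves the set `S`. -/
def Closed (i : Idx m n) (S : List (Letter m n) → Prop) : Prop :=
  ∀ w w', S w → wordF m n i w = some w' → S w'

theorem Stable.restrict {R S} (hR : Stable i R) (hS : Closed i S) :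
    Stable i fun w v => S w ∧ R w v where
  perm := fun w v h => hR.perm w v h.2
  step := fun w v h w' hw' => by
    obtain ⟨v', hv', h'⟩ := hR.step w v h.2 w' hw'
    exact ⟨v', hv', hS w w' h.1 hw', h'⟩
  maps_none := fun w v h => hR.maps_none w v h.2

theorem Stable.congr {R S : List (Letter m n) → List (Letter m n) → Prop} (hR : Stable i R)
    (h : ∀ w v, S w v ↔ R w v) : Stable i S := by
  have : S = R := by funext w v; exact propext (h w v)
  rw [this]; exact hR

/-- By `wordF_append` two adjacent letters are either left alone or changed by `f_i` as a word of
length two, where `wordF_pair` applies. -/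
theorem isChain_wordF_iff (fl : Bool) {w w' : List (Letter m n)} (h : wordF m n i w = some w') :
    w.IsChain (fun a b => bumps m n b a = fl) ↔ w'.IsChain fun a b => bumps m n b a = fl := by
  induction w generalizing w' with
  | nil => simp [wordF_nil] at h
  | cons a w ih =>
    have hlen := wordF_length h
    cases w with
    | nil =>
      obtain ⟨a', rfl⟩ := List.length_eq_one_iff.1 hlen
      simp
    | cons b w =>
      rcases w' with - | ⟨a', - | ⟨b', w'⟩⟩
      · simp at hlen
      · simp at hlen
      rw [List.isChain_cons_cons, List.isChain_cons_cons]
      have h1 : bumps m n b a = bumps m n b' a' := by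
        rcases wordF_append (x := [a, b]) (y := w) h with ⟨z, hz, he⟩ | ⟨z, hz, he⟩
        · obtain ⟨a2, b2, rfl, hab⟩ := wordF_pair rfl hz
          simp only [List.cons_append, List.nil_append, List.cons.injEq] at he
          obtain ⟨rfl, rfl, -⟩ := he
          exact hab.symm
        · simp only [List.cons_append, List.nil_append, List.cons.injEq] at he
          rw [he.1, he.2.1]
      rw [h1]
      refine and_congr_right fun _ => ?_
      rcases wordF_append (x := [a]) (y := b :: w) h with ⟨z, hz, he⟩ | ⟨z, hz, he⟩
      · obtain ⟨a2, rfl⟩ := List.length_eq_one_iff.1 (wordF_length hz)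
        simp only [List.cons_append, List.nil_append, List.cons.injEq] at he
        rw [he.2.1, he.2.2]
      · simp only [List.cons_append, List.nil_append, List.cons.injEq] at he
        exact ih (he.2 ▸ hz)

theorem isCol_iff_isChain {C : List (Letter m n)} :
    IsCol (bumps m n) C ↔ C.IsChain fun a b => bumps m n b a = false := by
  have : Trans (fun a b : Letter m n => bumps m n b a = false)
      (fun a b => bumps m n b a = false) (fun a b => bumps m n b a = false) :=
    ⟨fun h1 h2 => isBump_bumps.neg_trans h2 h1⟩
  exact List.isChain_iff_pairwise.symm

theorem closed_isCol : Closed i (IsCol (bumps m n)) := by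
  intro w w' h
  rw [isCol_iff_isChain] at h ⊢
  exact fun h' => (isChain_wordF_iff false h').1 h

theorem closed_length (k : ℕ) : Closed i fun w => w.length = k :=
  fun _ _ h h' => (wordF_length h').trans h

theorem Closed.and {S T} (hS : Closed i S) (hT : Closed i T) : Closed i fun w => S w ∧ T w :=
  fun w w' h h' => ⟨hS w w' h.1 h', hT w w' h.2 h'⟩

/-- Concatenation of sets of words. -/
def ConcatSet (S T : List (Letter m n) → Prop) (w : List (Letter m n)) : Prop :=
  ∃ x y, S x ∧ T y ∧ w = x ++ y

theorem Closed.concat {S T} (hS : Closed i S) (hT : Closed i T) : Closed i (ConcatSet S T) := by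
  rintro w w' ⟨x, y, h1, h2, rfl⟩ h
  rcases wordF_append h with ⟨x', hx', rfl⟩ | ⟨y', hy', rfl⟩
  · exact ⟨x', y, hS _ _ h1 hx', h2, rfl⟩
  · exact ⟨x, y', h1, hT _ _ h2 hy', rfl⟩

/-! ### The elementary relation on three letters -/

/-- The bumping relation for an insertion into a column of length two. -/
def Knuth (w v : List (Letter m n)) : Prop :=
  ∃ a b c, bumps m n b a = false ∧ bumps m n c b = true ∧ w = [a, b, c] ∧
    v = if bumps m n c a then [a, c, b] else [b, a, c]

theorem knuth_perm {w v : List (Letter m n)} (h : Knuth w v) : w.Perm v := by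
  obtain ⟨a, b, c, -, -, rfl, rfl⟩ := h
  split_ifs
  · exact List.Perm.cons _ (List.Perm.swap _ _ _)
  · exact List.Perm.swap _ _ _

-- On three letters the move and its result depend only on which letters are ends of the arrow and
-- on a few comparisons, so the claim is a finite check for each of the three kinds of indices.
set_option maxHeartbeats 1000000 in
theorem knuth_step (a b c : Letter m n) (h1 : bumps m n b a = false) (h2 : bumps m n c b = true) :
    (wordF m n i [a, b, c] = none ∧
      wordF m n i (if bumps m n c a then [a, c, b] else [b, a, c]) = none) ∨
    ∃ a' b' c', wordF m n i [a, b, c] = some [a', b', c'] ∧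
      wordF m n i (if bumps m n c a then [a, c, b] else [b, a, c]) =
        some (if bumps m n c' a' then [a', c', b'] else [b', a', c']) ∧
      bumps m n b' a' = false ∧ bumps m n c' b' = true := by
  have hlo : (lo m n i).val = i.val := rfl
  have hhi : (hi m n i).val = i.val + 1 := rfl
  have hne := lo_ne_hi i
  have hne' := (lo_ne_hi i).symm
  have b1 : bumps m n (lo m n i) (hi m n i) = true := by rw [bumps_iff]; omega
  have b2 : bumps m n (hi m n i) (lo m n i) = false := by rw [bumps_eq_iff]; simp; omega
  -- A letter outside the arrow compares in the same way with both of its ends. So `f_i` changes no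
  -- comparison with such a letter, and only the positions of `lo` and `hi` have to be
  -- distinguished.
  have b3 : ∀ d, d ≠ lo m n i → d ≠ hi m n i →
      bumps m n (lo m n i) d = bumps m n (hi m n i) d := by
    intro d hd hd'; rw [Bool.eq_iff_iff, bumps_iff, bumps_iff]; simp only [ne_eq, Fin.ext_iff] at *
    omega
  have b4 : ∀ d, d ≠ lo m n i → d ≠ hi m n i →
      bumps m n d (lo m n i) = bumps m n d (hi m n i) := by
    intro d hd hd'; rw [Bool.eq_iff_iff, bumps_iff, bumps_iff]; simp only [ne_eq, Fin.ext_iff] at *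
    omega
  rcases lt_trichotomy (i.val + 1) m with hm | hm | hm
  · have b5 : bumps m n (lo m n i) (lo m n i) = true := by rw [bumps_iff]; omega
    have b6 : bumps m n (hi m n i) (hi m n i) = true := by rw [bumps_iff]; omega
    clear hlo hhi
    by_cases h3 : bumps m n c a = true <;>
    by_cases ha : a = lo m n i <;> by_cases ha' : a = hi m n i <;>
    by_cases hb : b = lo m n i <;> by_cases hb' : b = hi m n i <;>
    by_cases hc : c = lo m n i <;> by_cases hc' : c = hi m n i <;>
    simp_all [wordF_cons_of_lt hm, wordε_cons_of_lt hm, wordF_nil, wordε_nil]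
  · have b5 : bumps m n (lo m n i) (lo m n i) = true := by rw [bumps_iff]; omega
    have b6 : bumps m n (hi m n i) (hi m n i) = false := by rw [bumps_eq_iff]; simp; omega
    clear hlo hhi
    by_cases h3 : bumps m n c a = true <;>
    by_cases ha : a = lo m n i <;> by_cases ha' : a = hi m n i <;>
    by_cases hb : b = lo m n i <;> by_cases hb' : b = hi m n i <;>
    by_cases hc : c = lo m n i <;> by_cases hc' : c = hi m n i <;>
    simp_all [wordF_cons_of_eq hm, wordF_nil]
  · have b5 : bumps m n (lo m n i) (lo m n i) = false := by rw [bumps_eq_iff]; simp; omega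
    have b6 : bumps m n (hi m n i) (hi m n i) = false := by rw [bumps_eq_iff]; simp; omega
    clear hlo hhi
    by_cases h3 : bumps m n c a = true <;>
    by_cases ha : a = lo m n i <;> by_cases ha' : a = hi m n i <;>
    by_cases hb : b = lo m n i <;> by_cases hb' : b = hi m n i <;>
    by_cases hc : c = lo m n i <;> by_cases hc' : c = hi m n i <;>
    simp_all [wordF_cons_of_gt hm, wordφ_cons_of_gt hm, wordφ_nil]

theorem stable_knuth : Stable i Knuth where
  perm w v h := knuth_perm h
  step := by
    rintro w v ⟨a, b, c, h1, h2, rfl, rfl⟩ w' hw'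
    rcases knuth_step (i := i) a b c h1 h2 with h | ⟨a', b', c', e1, e2, e3, e4⟩
    · rw [h.1] at hw'; cases hw'
    · rw [e1] at hw'; cases hw'
      exact ⟨_, e2, a', b', c', e3, e4, rfl, rfl⟩
  maps_none := by
    rintro w v ⟨a, b, c, h1, h2, rfl, rfl⟩ hw
    rcases knuth_step (i := i) a b c h1 h2 with h | ⟨a', b', c', e1, e2, e3, e4⟩
    · exact h.2
    · rw [e1] at hw; cases hw

end Bisimulation

end HookCrystal


namespace HookCrystal

/-! ### Insertion into a single column commutes with the operators. -/

section ColumnInsertion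

variable {m n : ℕ} {i : Idx m n}

/-- The relation given by the insertion of a letter into a column of length `k`. -/
def ColBump (m n k : ℕ) (fl : Bool) (w v : List (Letter m n)) : Prop :=
  ∃ C b, IsCol (bumps m n) C ∧ C.length = k ∧ (colInsert (bumps m n) b C).2.isSome = fl ∧
    w = C ++ [b] ∧ v = (colInsert (bumps m n) b C).2.toList ++ (colInsert (bumps m n) b C).1

theorem isCol_concat {C : List (Letter m n)} {b : Letter m n} :
    IsCol (bumps m n) (C ++ [b]) ↔
      IsCol (bumps m n) C ∧ (colInsert (bumps m n) b C).2.isSome = false := by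
  rw [Option.isSome_eq_false_iff, Option.isNone_iff_eq_none, colInsert_none_iff]
  simp only [IsCol, List.pairwise_append, List.pairwise_singleton, List.mem_singleton]
  exact ⟨fun h => ⟨h.1, fun c hc => h.2.2 c hc b rfl⟩,
    fun h => ⟨h.1, trivial, fun x hx y hy => hy ▸ h.2 x hx⟩⟩

theorem colBump_false_iff {k : ℕ} {w v : List (Letter m n)} : ColBump m n k false w v ↔
    IdOn (fun w => IsCol (bumps m n) w ∧ w.length = k + 1) w v := by
  constructor
  · rintro ⟨C, b, h1, h2, h3, rfl, rfl⟩
    have h4 : (colInsert (bumps m n) b C).2 = none := by simpa using h3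
    refine ⟨⟨isCol_concat.2 ⟨h1, h3⟩, by simp [h2]⟩, ?_⟩
    rw [h4, colInsert_fst_of_none h4]; rfl
  · rintro ⟨⟨h1, h2⟩, rfl⟩
    rcases List.eq_nil_or_concat' w with rfl | ⟨C, b, rfl⟩
    · simp at h2
    · have h3 := isCol_concat.1 h1
      have h4 : (colInsert (bumps m n) b C).2 = none := by simpa using h3.2
      refine ⟨C, b, h3.1, by simpa using h2, h3.2, rfl, ?_⟩
      rw [h4, colInsert_fst_of_none h4]; rfl

theorem stable_colBump_false (k : ℕ) : Stable i (ColBump m n k false) :=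
  (stable_idOn (closed_isCol.and (closed_length (k + 1)))).congr fun _ _ => colBump_false_iff

/-- For a column of length one, the bumped letter followed by the new column is the original word,
so the relation is the identity on the pairs that bump. -/
theorem stable_colBump_one : Stable i (ColBump m n 1 true) := by
  have h : Stable i (IdOn fun w : List (Letter m n) => ∃ a b, w = [a, b] ∧ bumps m n b a = true) := by
    apply stable_idOn
    rintro w w' ⟨a, b, rfl, h⟩ hw
    exact wordF_pair h hw
  refine h.congr fun w v => ⟨?_, ?_⟩
  · rintro ⟨C, b, h1, h2, h3, rfl, rfl⟩
    obtain ⟨c, rfl⟩ := List.length_eq_one_iff.1 h2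
    have hb : bumps m n b c = true := by
      by_contra hb; simp [colInsert, hb] at h3
    exact ⟨⟨c, b, rfl, hb⟩, by simp [colInsert, hb]⟩
  · rintro ⟨⟨a, b, rfl, hb⟩, rfl⟩
    exact ⟨[a], b, by simp [IsCol], rfl, by simp [colInsert, hb], rfl, by simp [colInsert, hb]⟩

/-- Insertion of `b` into a column of length at least two whose tail bumps. -/
theorem colInsert_cons_bump {c b o : Letter m n} {C : List (Letter m n)}
    (hC : IsCol (bumps m n) (c :: C)) (h : (colInsert (bumps m n) b C).2 = some o) :
    ∃ t rest, (colInsert (bumps m n) b C).1 = t :: rest ∧ bumps m n o c = false ∧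
      bumps m n t o = true ∧ (colInsert (bumps m n) b (c :: C)).2.isSome = true ∧
      (colInsert (bumps m n) b (c :: C)).2.toList ++ (colInsert (bumps m n) b (c :: C)).1 =
        (if bumps m n t c then [c, t, o] else [o, c, t]) ++ rest := by
  have hr := isBump_bumps (m := m) (n := n)
  obtain ⟨X, Y, rfl, e, hbo, hX⟩ := colInsert_some h
  rw [IsCol, List.pairwise_cons] at hC
  obtain ⟨hc, hC⟩ := hC
  have hoc : bumps m n o c = false := hc o (by simp)
  cases X with
  | nil =>
    refine ⟨b, Y, e, hoc, hbo, ?_⟩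
    by_cases hb : bumps m n b c = true
    · simp [colInsert, hb]
    · simp [colInsert, hb, hbo]
  | cons d X =>
    have hd : bumps m n b d = false := hX d (by simp)
    have hdc : bumps m n d c = false := hc d (by simp)
    have hbc : bumps m n b c = false := hr.neg_trans hd hdc
    refine ⟨d, X ++ b :: Y, e, hoc, ?_, ?_⟩
    · have h1 : bumps m n o d = false := by
        simp only [List.cons_append, List.pairwise_cons] at hC
        exact hC.1 o (by simp)
      rcases hr.total d o with h2 | h2 | h2
      · exact h2
      · rw [h1] at h2; cases h2
      · subst h2; rw [hd] at hbo; cases hbo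
    · have h5 : colInsert (bumps m n) b (c :: (d :: X ++ o :: Y)) =
          (c :: (colInsert (bumps m n) b (d :: X ++ o :: Y)).1,
            (colInsert (bumps m n) b (d :: X ++ o :: Y)).2) := by
        rw [colInsert, if_neg (by simp [hbc])]
      rw [h5, h, e]
      simp [hdc]

/-- A letter that bumps the top entry also bumps the entries below it. Hence the insertion bumps in
the tail as well, and the induction on the tail can be used even when the top entry is the one to be
bumped. -/
theorem colInsert_cons_isSome {c b : Letter m n} {C : List (Letter m n)} (hne : C ≠ [])
    (hC : IsCol (bumps m n) (c :: C)) (h : (colInsert (bumps m n) b (c :: C)).2.isSome = true) :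
    (colInsert (bumps m n) b C).2.isSome = true := by
  have hr := isBump_bumps (m := m) (n := n)
  by_cases hb : bumps m n b c = true
  · obtain ⟨d, C', rfl⟩ := List.exists_cons_of_ne_nil hne
    rw [IsCol, List.pairwise_cons] at hC
    have hd := hC.1 d (by simp)
    have h1 := hr.right hb hd
    have h2 : bumps m n b d = true := by
      rcases hr.total b d with h2 | h2 | h2
      · exact h2
      · rw [h1] at h2; cases h2
      · subst h2; rw [hb] at hd; cases hd
    simp [colInsert, h2]
  · simpa [colInsert, hb] using h

/-- Insertion into `c :: C` is insertion into `C`, followed by one three-letter move on `c`, the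
letter bumped out of `C`, and the new top entry of `C`. The column thus reduces to a shorter column
and `Knuth`. -/
theorem stable_colBump_true (k : ℕ) : Stable i (ColBump m n (k + 1) true) := by
  induction k with
  | zero => exact stable_colBump_one
  | succ k ih =>
    have hT : Stable i (RelComp
        (Concat (IdOn fun w : List (Letter m n) => w.length = 1) (ColBump m n (k + 1) true))
        (Concat Knuth (IdOn fun w : List (Letter m n) => w.length = k))) :=
      ((stable_length 1).concat ih).comp (stable_knuth.concat (stable_length k))
    -- The composite relation forgets that `c` and the tail together form a column; this closed set
    -- keeps the information.
    have hS : Closed i (ConcatSet (fun w => IsCol (bumps m n) w ∧ w.length = k + 2)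
        (fun w => w.length = 1)) :=
      (closed_isCol.and (closed_length _)).concat (closed_length 1)
    refine (hT.restrict hS).congr fun w v => ⟨?_, ?_⟩
    · rintro ⟨C, b, h1, h2, h3, rfl, rfl⟩
      refine ⟨⟨C, [b], ⟨h1, h2⟩, rfl, rfl⟩, ?_⟩
      cases C with
      | nil => simp at h2
      | cons c C =>
        have hl : C.length = k + 1 := by simpa using h2
        have hs := colInsert_cons_isSome (List.ne_nil_of_length_pos (by omega)) h1 h3
        obtain ⟨o, ho⟩ := Option.isSome_iff_exists.1 hs
        obtain ⟨t, rest, e1, e2, e3, e4, e5⟩ := colInsert_cons_bump h1 ho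
        refine ⟨[c] ++ (o :: t :: rest), ⟨[c], C ++ [b], [c], o :: t :: rest, ⟨rfl, rfl⟩,
          ⟨C, b, (List.pairwise_cons.1 h1).2, hl, hs, rfl, by rw [ho, e1]; rfl⟩, rfl, rfl⟩, ?_⟩
        have hl2 := colInsert_length (r := bumps m n) (b := b) (C := C)
        rw [ho, e1, hl] at hl2
        exact ⟨[c, o, t], rest, _, rest, ⟨c, o, t, e2, e3, rfl, rfl⟩, ⟨by simpa using hl2, rfl⟩,
          rfl, e5⟩
    · rintro ⟨⟨C, y, ⟨h1, h2⟩, hy, rfl⟩, x, ⟨p, q, p', q', ⟨hp, rfl⟩, ⟨D, b, g1, g2, g3, rfl, rfl⟩,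
        e1, rfl⟩, hx⟩
      obtain ⟨b', rfl⟩ := List.length_eq_one_iff.1 hy
      obtain ⟨c, rfl⟩ := List.length_eq_one_iff.1 hp
      rw [← List.append_assoc] at e1
      obtain ⟨rfl, e2⟩ := List.append_inj' e1 rfl
      obtain rfl : b' = b := by simpa using e2
      obtain ⟨o, ho⟩ := Option.isSome_iff_exists.1 g3
      obtain ⟨t, rest, d1, d2, d3, d4, d5⟩ := colInsert_cons_bump h1 ho
      refine ⟨[c] ++ D, b', h1, h2, d4, rfl, ?_⟩
      obtain ⟨z, z', y, y', ⟨a, b, c', k1, k2, rfl, rfl⟩, ⟨k4, rfl⟩, k5, rfl⟩ := hx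
      have d1' : (colInsert (bumps m n) b' D).1 = t :: rest := d1
      rw [ho, d1'] at k5
      simp only [Option.toList_some, List.cons_append, List.nil_append, List.cons.injEq] at k5
      obtain ⟨rfl, rfl, rfl, rfl⟩ := k5
      exact d5.symm

end ColumnInsertion

/-! ### Insertion into a tableau commutes with the operators. -/

section TableauInsertion

variable {m n : ℕ} {i : Idx m n}

theorem columnReading_cons {α : Type*} (C : List α) (T : List (List α)) :
    columnReading (C :: T) = columnReading T ++ C := by
  simp [columnReading]

/-- With fixed column lengths the intermediate word of a composed relation determines the
intermediate filling. This is why the relations below carry the lengths. -/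
theorem columnReading_inj {α : Type*} {T U : List (List α)}
    (h : T.map List.length = U.map List.length) (h' : columnReading T = columnReading U) :
    T = U := by
  induction T generalizing U with
  | nil => cases U <;> simp_all
  | cons C T ih =>
    cases U with
    | nil => simp at h
    | cons D U =>
      simp only [List.map_cons, List.cons.injEq] at h
      rw [columnReading_cons, columnReading_cons] at h'
      obtain ⟨h1, h2⟩ := List.append_inj' h' h.1
      rw [h2, ih h.2 h1]

/-- The readings of the fillings with given column lengths and columns which are allowed. -/
def FillingWord (m n : ℕ) (ls : List ℕ) (w : List (Letter m n)) : Prop :=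
  ∃ T : List (List (Letter m n)), T.map List.length = ls ∧ (∀ C ∈ T, IsCol (bumps m n) C) ∧
    w = columnReading T

theorem closed_fillingWord (ls : List ℕ) : Closed i (FillingWord m n ls) := by
  induction ls with
  | nil =>
    rintro w w' ⟨T, h1, h2, rfl⟩ h
    obtain rfl : T = [] := by simpa using h1
    simp [columnReading, wordF_nil] at h
  | cons l ls ih =>
    have hS : Closed i (ConcatSet (FillingWord m n ls)
        (fun w => IsCol (bumps m n) w ∧ w.length = l)) :=
      ih.concat (closed_isCol.and (closed_length l))
    rintro w w' ⟨T, h1, h2, rfl⟩ h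
    cases T with
    | nil => simp at h1
    | cons C T =>
      simp only [List.map_cons, List.cons.injEq] at h1
      obtain ⟨x, y, ⟨U, g1, g2, rfl⟩, ⟨g3, g4⟩, rfl⟩ := hS _ w'
        ⟨columnReading T, C, ⟨T, h1.2, fun D hD => h2 D (by simp [hD]), rfl⟩,
          ⟨h2 C (by simp), h1.1⟩, columnReading_cons C T⟩ h
      refine ⟨y :: U, by simp [g1, g4], ?_, (columnReading_cons y U).symm⟩
      intro D hD
      rcases List.mem_cons.1 hD with rfl | hD
      · exact g3
      · exact g2 D hD

/-- The relation given by the insertion of a letter into a filling. -/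
def TabBump (m n : ℕ) (ls : List ℕ) (e : ℕ) (w v : List (Letter m n)) : Prop :=
  ∃ T b, T.map List.length = ls ∧ (∀ C ∈ T, IsCol (bumps m n) C) ∧ endCol (bumps m n) b T = e ∧
    w = columnReading T ++ [b] ∧ v = columnReading (tabInsert (bumps m n) b T)

/-- Columns are read from right to left, so the inserted letter stands directly behind the first
column. That column is treated by `ColBump`; afterwards the bumped letter stands directly behind the
remaining columns, and the induction continues there. Fixing the end column `e` fixes which columns
bump, and nonempty columns are needed for a bump. -/
theorem stable_tabBump (ls : List ℕ) (hls : 0 ∉ ls) (e : ℕ) : Stable i (TabBump m n ls e) := by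
  induction ls generalizing e with
  | nil =>
    refine (((stable_length (i := i) 1).restrict (S := fun _ => e = 0)
      (fun _ _ h _ => h)).congr fun w v => ⟨?_, ?_⟩)
    · rintro ⟨T, b, h1, h2, h3, rfl, rfl⟩
      obtain rfl : T = [] := by simpa using h1
      exact ⟨h3.symm, by simp [columnReading], by simp [columnReading, tabInsert]⟩
    · rintro ⟨rfl, h, rfl⟩
      obtain ⟨b, rfl⟩ := List.length_eq_one_iff.1 h
      exact ⟨[], b, rfl, by simp, rfl, by simp [columnReading], by simp [columnReading, tabInsert]⟩
  | cons l ls ih =>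
    have hls' : 0 ∉ ls := fun h => hls (by simp [h])
    cases e with
    | zero =>
      have hT := (stable_idOn (closed_fillingWord (m := m) (n := n) (i := i) ls)).concat
        (stable_colBump_false l)
      refine hT.congr fun w v => ⟨?_, ?_⟩
      · rintro ⟨T, b, h1, h2, h3, rfl, rfl⟩
        cases T with
        | nil => simp at h1
        | cons C T =>
          simp only [List.map_cons, List.cons.injEq] at h1
          have hn : (colInsert (bumps m n) b C).2 = none := by
            cases ho : (colInsert (bumps m n) b C).2 with
            | none => rfl
            | some o => rw [endCol_cons_some T ho] at h3; cases h3
          refine ⟨columnReading T, C ++ [b], columnReading T, C ++ [b],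
            ⟨⟨T, h1.2, fun D hD => h2 D (by simp [hD]), rfl⟩, rfl⟩,
            ⟨C, b, h2 C (by simp), h1.1, by rw [hn]; rfl, rfl, ?_⟩, ?_, ?_⟩
          · rw [hn, colInsert_fst_of_none hn]; rfl
          · rw [columnReading_cons, List.append_assoc]
          · rw [tabInsert_cons_none T hn, colInsert_fst_of_none hn, columnReading_cons]
      · rintro ⟨x, y, x', y', ⟨⟨T, g1, g2, rfl⟩, rfl⟩, ⟨C, b, k1, k2, k3, rfl, rfl⟩, rfl, rfl⟩
        have hn : (colInsert (bumps m n) b C).2 = none := by simpa using k3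
        refine ⟨C :: T, b, by simp [g1, k2], ?_, endCol_cons_none T hn, ?_, ?_⟩
        · intro D hD
          rcases List.mem_cons.1 hD with rfl | hD
          · exact k1
          · exact g2 D hD
        · rw [columnReading_cons, List.append_assoc]
        · rw [tabInsert_cons_none T hn, columnReading_cons, hn]; rfl
    | succ e =>
      obtain ⟨l, rfl⟩ : ∃ l', l = l' + 1 :=
        Nat.exists_eq_succ_of_ne_zero fun h => hls (by simp [h])
      have hT := ((stable_idOn (closed_fillingWord (m := m) (n := n) (i := i) ls)).concat
        (stable_colBump_true l)).comp ((ih hls' e).concat (stable_length (l + 1)))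
      refine hT.congr fun w v => ⟨?_, ?_⟩
      · rintro ⟨T, b, h1, h2, h3, rfl, rfl⟩
        cases T with
        | nil => simp at h1
        | cons C T =>
          simp only [List.map_cons, List.cons.injEq] at h1
          cases ho : (colInsert (bumps m n) b C).2 with
          | none => rw [endCol_cons_none T ho] at h3; cases h3
          | some o =>
            have hl := colInsert_length (r := bumps m n) (b := b) (C := C)
            rw [endCol_cons_some T ho, Nat.add_right_cancel_iff] at h3
            refine ⟨columnReading T ++ (o :: (colInsert (bumps m n) b C).1),
              ⟨columnReading T, C ++ [b], _, _,
              ⟨⟨T, h1.2, fun D hD => h2 D (by simp [hD]), rfl⟩, rfl⟩,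
              ⟨C, b, h2 C (by simp), h1.1, by rw [ho]; rfl, rfl, by rw [ho]; rfl⟩, ?_, rfl⟩,
              columnReading T ++ [o], (colInsert (bumps m n) b C).1, _, _,
              ⟨T, o, h1.2, fun D hD => h2 D (by simp [hD]), h3, rfl, rfl⟩, ⟨?_, rfl⟩, ?_, ?_⟩
            · rw [columnReading_cons, List.append_assoc]
            · change (colInsert (bumps m n) b C).1.length = l + 1
              rw [hl, ho, h1.1]; rfl
            · simp
            · rw [tabInsert_cons_some T ho, columnReading_cons]
      · rintro ⟨x, ⟨p, q, p', q', ⟨⟨T, g1, g2, rfl⟩, rfl⟩, ⟨C, b, k1, k2, k3, rfl, rfl⟩, rfl, rfl⟩,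
          p2, q2, p2', q2', ⟨U, d, h1, h2, h3, rfl, rfl⟩, ⟨h4, rfl⟩, h5, rfl⟩
        obtain ⟨o, ho⟩ := Option.isSome_iff_exists.1 k3
        have hl := colInsert_length (r := bumps m n) (b := b) (C := C)
        rw [ho, k2] at hl
        rw [ho, Option.toList_some, ← List.append_assoc] at h5
        obtain ⟨h6, h7⟩ := List.append_inj' h5 (by rw [h4, hl]; rfl)
        obtain ⟨h8, h9⟩ := List.append_inj' h6 rfl
        obtain rfl := columnReading_inj (by rw [g1, h1]) h8
        obtain rfl : o = d := by simpa using h9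
        refine ⟨C :: T, b, by simp [g1, k2], ?_, by rw [endCol_cons_some T ho, h3], ?_, ?_⟩
        · intro D hD
          rcases List.mem_cons.1 hD with rfl | hD
          · exact k1
          · exact g2 D hD
        · rw [columnReading_cons, List.append_assoc]
        · rw [tabInsert_cons_some T ho, columnReading_cons, h7]

/-- Column lengths after an insertion. -/
def addLength : List ℕ → ℕ → List ℕ
  | [], _ => [1]
  | l :: ls, 0 => (l + 1) :: ls
  | l :: ls, e + 1 => l :: addLength ls e

theorem map_length_tabInsert {α : Type*} (r : α → α → Bool) (b : α) (T : List (List α)) :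
    (tabInsert r b T).map List.length = addLength (T.map List.length) (endCol r b T) := by
  induction T generalizing b with
  | nil => rfl
  | cons C T ih =>
    have hl := colInsert_length (r := r) (b := b) (C := C)
    cases ho : (colInsert r b C).2 with
    | none =>
      rw [ho] at hl
      simp [tabInsert_cons_none T ho, endCol_cons_none T ho, addLength, hl]
    | some o =>
      rw [ho] at hl
      simp [tabInsert_cons_some T ho, endCol_cons_some T ho, addLength, hl, ih]

theorem IsTab.isCol {α : Type*} {r : α → α → Bool} {T : List (List α)} (h : IsTab r T) :
    ∀ C ∈ T, IsCol r C := by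
  induction T with
  | nil => simp
  | cons D T ih =>
    intro C hC
    rcases List.mem_cons.1 hC with rfl | hC
    · exact h.2.1
    · exact ih h.2.2.2 C hC

theorem IsTab.nil_notMem {α : Type*} {r : α → α → Bool} {T : List (List α)} (h : IsTab r T) :
    [] ∉ T := by
  induction T with
  | nil => simp
  | cons D T ih => simp [h.1.symm, ih h.2.2.2]

/-- The relation between a word and the reading of its tableau. -/
def WordTabRel (m n : ℕ) (k : ℕ) (ls : List ℕ) (w v : List (Letter m n)) : Prop :=
  w.length = k ∧ (wordTab (bumps m n) w).map List.length = ls ∧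
    v = columnReading (wordTab (bumps m n) w)

/-- Induction on the length: the tableau of all letters but the last is read off, then the last
letter is inserted. The relation for this second step depends on the pair through the column lengths
and the end column, so `key` finds for each pair a preserved relation that contains it and lies
inside `WordTabRel`. -/
theorem stable_wordTabRel (k : ℕ) (ls : List ℕ) : Stable i (WordTabRel m n k ls) := by
  induction k generalizing ls with
  | zero =>
    refine ⟨?_, ?_, ?_⟩
    · rintro w v ⟨h1, h2, rfl⟩
      rw [List.length_eq_zero_iff] at h1; subst h1; exact List.Perm.refl _
    · rintro w v ⟨h1, h2, rfl⟩ w' hw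
      rw [List.length_eq_zero_iff] at h1; subst h1; cases hw
    · rintro w v ⟨h1, h2, rfl⟩ hw
      rw [List.length_eq_zero_iff] at h1; subst h1; exact hw
  | succ k ih =>
    have key : ∀ w v, WordTabRel m n (k + 1) ls w v → ∃ R, Stable i R ∧ R w v ∧
        ∀ w' v', R w' v' → WordTabRel m n (k + 1) ls w' v' := by
      rintro w v ⟨h1, h2, rfl⟩
      rcases List.eq_nil_or_concat' w with rfl | ⟨w, b, rfl⟩
      · simp at h1
      set ls0 := (wordTab (bumps m n) w).map List.length with hls0
      set e := endCol (bumps m n) b (wordTab (bumps m n) w) with he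
      have ht := isTab_wordTab (isBump_bumps (m := m) (n := n)) w
      have h0 : 0 ∉ ls0 := by
        intro h
        obtain ⟨C, hC, hC0⟩ := List.mem_map.1 h
        rw [List.length_eq_zero_iff] at hC0; subst hC0
        exact ht.nil_notMem hC
      have hls : addLength ls0 e = ls := by
        rw [← h2, wordTab_concat, map_length_tabInsert]
      refine ⟨_, ((ih ls0).concat (stable_length 1)).comp (stable_tabBump ls0 h0 e), ?_, ?_⟩
      · refine ⟨_, ⟨w, [b], _, _, ⟨by simpa using h1, rfl, rfl⟩, ⟨rfl, rfl⟩, rfl, rfl⟩,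
          _, b, rfl, ht.isCol, rfl, rfl, ?_⟩
        rw [wordTab_concat]
      · rintro w' v' ⟨x, ⟨p, q, p', q', ⟨g1, g2, rfl⟩, ⟨g3, rfl⟩, rfl, rfl⟩,
          T, d, k1, k2, k3, k4, rfl⟩
        obtain ⟨d', rfl⟩ := List.length_eq_one_iff.1 g3
        obtain ⟨h6, h7⟩ := List.append_inj' k4 rfl
        obtain rfl := columnReading_inj (by rw [g2, k1]) h6
        obtain rfl : d' = d := by simpa using h7
        refine ⟨by simp [g1], ?_, by rw [wordTab_concat]⟩
        rw [wordTab_concat, map_length_tabInsert, k1, k3, hls]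
    refine ⟨?_, ?_, ?_⟩
    · intro w v h
      obtain ⟨R, hR, hwv, -⟩ := key w v h
      exact hR.perm _ _ hwv
    · intro w v h w' hw'
      obtain ⟨R, hR, hwv, hsub⟩ := key w v h
      obtain ⟨v', hv', h'⟩ := hR.step _ _ hwv _ hw'
      exact ⟨v', hv', hsub _ _ h'⟩
    · intro w v h hw
      obtain ⟨R, hR, hwv, -⟩ := key w v h
      exact hR.maps_none _ _ hwv hw

/-- The reading of the tableau of `w`. -/
def normalForm (m n : ℕ) (w : List (Letter m n)) : List (Letter m n) :=
  columnReading (wordTab (bumps m n) w)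

/-- The central fact about the crystal structure: the operators may be computed after passing to the
tableau. The lengths recorded in `WordTabRel` show in addition that the shape stays the same. -/
theorem wordF_normalForm (w : List (Letter m n)) :
    wordF m n i (normalForm m n w) = (wordF m n i w).map (normalForm m n) := by
  have hS := stable_wordTabRel (i := i) w.length ((wordTab (bumps m n) w).map List.length)
  cases h : wordF m n i w with
  | none => exact hS.maps_none w _ ⟨rfl, rfl, rfl⟩ h
  | some w' =>
    obtain ⟨v', hv', -, -, rfl⟩ := hS.step w _ ⟨rfl, rfl, rfl⟩ w' h
    exact hv'

theorem wordF_wordTab_length {w w' : List (Letter m n)} (h : wordF m n i w = some w') :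
    (wordTab (bumps m n) w').map List.length = (wordTab (bumps m n) w).map List.length := by
  have hS := stable_wordTabRel (i := i) w.length ((wordTab (bumps m n) w).map List.length)
  obtain ⟨v', -, -, h', -⟩ := hS.step w _ ⟨rfl, rfl, rfl⟩ w' h
  exact h'

theorem wordφ_normalForm (w : List (Letter m n)) :
    wordφ m n i (normalForm m n w) = wordφ m n i w :=
  ((stable_wordTabRel (i := i) w.length ((wordTab (bumps m n) w).map List.length)).φ_eq
    ⟨rfl, rfl, rfl⟩).symm

theorem wordε_normalForm (w : List (Letter m n)) :
    wordε m n i (normalForm m n w) = wordε m n i w :=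
  ((stable_wordTabRel (i := i) w.length ((wordTab (bumps m n) w).map List.length)).ε_eq
    ⟨rfl, rfl, rfl⟩).symm

theorem wordWt_normalForm (w : List (Letter m n)) :
    wordWt m n (normalForm m n w) = wordWt m n w := by
  apply wordWt_perm
  refine List.Perm.trans ?_ (wordTab_perm (r := bumps m n) w)
  exact (List.reverse_perm _).flatten

end TableauInsertion

end HookCrystal


namespace HookCrystal

/-! ### Insertion of a whole word, one column at a time. -/

section ColumnPass

variable {α : Type*} {r : α → α → Bool}

/-- Successive insertion of the letters of a word into a column: the final column and the word of
the letters which are bumped out. -/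
def colPass (r : α → α → Bool) : List α → List α → List α × List α
  | [], C => (C, [])
  | b :: w, C => ((colPass r w (colInsert r b C).1).1,
      (colInsert r b C).2.toList ++ (colPass r w (colInsert r b C).1).2)

/-- Successive insertion of the letters of a word into a tableau. -/
def tabFold (r : α → α → Bool) (T : List (List α)) (w : List α) : List (List α) :=
  w.foldl (fun T b => tabInsert r b T) T

theorem tabFold_append (T : List (List α)) (w v : List α) :
    tabFold r T (w ++ v) = tabFold r (tabFold r T w) v := List.foldl_append

theorem wordTab_eq_tabFold (w : List α) : wordTab r w = tabFold r [] w := rfl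

/-- What happens in a column does not depend on the columns to its right, so the whole word may pass
through the first column before its output enters the rest. -/
theorem tabFold_cons (C : List α) (T : List (List α)) (w : List α) :
    tabFold r (C :: T) w = (colPass r w C).1 :: tabFold r T (colPass r w C).2 := by
  induction w generalizing C T with
  | nil => rfl
  | cons b w ih =>
    change tabFold r (tabInsert r b (C :: T)) w = _
    cases h : (colInsert r b C).2 with
    | none => rw [tabInsert_cons_none T h, ih]; simp [colPass, h]
    | some o =>
      rw [tabInsert_cons_some T h, ih]
      simp only [colPass, h, Option.toList_some, List.cons_append, List.nil_append]
      rfl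

theorem tabFold_nil_cons (b : α) (w : List α) :
    tabFold r [] (b :: w) = (colPass r (b :: w) []).1 :: tabFold r [] (colPass r (b :: w) []).2 := by
  change tabFold r [[b]] w = _
  rw [tabFold_cons]
  simp [colPass, colInsert]

theorem wordTab_of_ne_nil {w : List α} (h : w ≠ []) :
    wordTab r w = (colPass r w []).1 :: wordTab r (colPass r w []).2 := by
  obtain ⟨b, w, rfl⟩ := List.exists_cons_of_ne_nil h
  exact tabFold_nil_cons b w

theorem colInsert_append_of_not {b : α} {X E : List α} (h : ∀ x ∈ X, r b x = false) :
    colInsert r b (X ++ E) = (X ++ (colInsert r b E).1, (colInsert r b E).2) := by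
  induction X with
  | nil => rfl
  | cons x X ih =>
    have hx := h x (by simp)
    simp [colInsert, hx, ih fun y hy => h y (by simp [hy])]

/-- Each letter of `Z` passes the letters `X` already placed and bumps the top entry of what is left
of the old column, its right neighbour by the row condition. After the old column is used up, the
letters are appended. -/
theorem colPass_column {X Z E : List α} (h : IsCol r (X ++ Z)) (hE : RowOK r Z E) :
    colPass r Z (X ++ E) = (X ++ Z, E) := by
  induction Z generalizing X E with
  | nil =>
    cases E with
    | nil => rfl
    | cons e E => exact hE.elim
  | cons z Z ih =>
    have hz : ∀ x ∈ X, r z x = false := fun x hx =>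
      (List.pairwise_append.1 h).2.2 x hx z (by simp)
    have h' : IsCol r ((X ++ [z]) ++ Z) := by simpa using h
    cases E with
    | nil =>
      have := ih h' (rowOK_nil Z)
      simp only [List.append_nil] at this
      simp only [colPass, colInsert_append_of_not hz, colInsert]
      simpa using this
    | cons e E =>
      have := ih h' hE.2
      simp only [colPass, colInsert_append_of_not hz, colInsert, hE.1, if_true]
      simp only [List.append_assoc, List.singleton_append] at this
      rw [this]; rfl

theorem tabFold_column {C : List α} {T : List (List α)} (h : IsTab r (C :: T)) :
    tabFold r T C = C :: T := by
  induction T generalizing C with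
  | nil =>
    have h2 := colPass_column (X := []) (E := []) (r := r) (Z := C) h.2.1 (rowOK_nil C)
    obtain ⟨c, C, rfl⟩ := List.exists_cons_of_ne_nil h.1
    rw [tabFold_nil_cons]
    simp only [List.nil_append] at h2
    rw [h2]; rfl
  | cons D T ih =>
    have h2 := colPass_column (X := []) (E := D) (r := r) (Z := C) h.2.1 h.2.2.1
    simp only [List.nil_append] at h2
    rw [tabFold_cons, h2, ih h.2.2.2]

/-- The columns are inserted from right to left, and by `tabFold_column` each of them pushes the
tableau built so far one column to the right. -/
theorem wordTab_columnReading {T : List (List α)} (h : IsTab r T) :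
    wordTab r (columnReading T) = T := by
  induction T with
  | nil => rfl
  | cons C T ih =>
    rw [columnReading_cons, wordTab_eq_tabFold, tabFold_append, ← wordTab_eq_tabFold,
      ih h.2.2.2, tabFold_column h]

end ColumnPass

/-! ### Tableaux of a given shape -/

section Shapes

variable {α : Type*} {r : α → α → Bool}

theorem entry_zero (C : List α) (T : List (List α)) (i : ℕ) : entry (C :: T) i 0 = C[i]? := by
  simp [entry]

theorem entry_succ (C : List α) (T : List (List α)) (i j : ℕ) :
    entry (C :: T) i (j + 1) = entry T i j := by
  simp [entry]

theorem entry_nil (i j : ℕ) : entry ([] : List (List α)) i j = none := by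
  simp [entry]

theorem entry_isSome (T : List (List α)) (i j : ℕ) : (entry T i j).isSome ↔ i < colLens T j := by
  induction T generalizing j with
  | nil => simp [entry_nil]
  | cons C T ih =>
    cases j with
    | zero => rw [entry_zero]; simp
    | succ j => rw [entry_succ, ih]; rfl

theorem map_length_eq_of_colLens {T U : List (List α)} (hT : [] ∉ T) (hU : [] ∉ U)
    (h : ∀ j, colLens T j = colLens U j) : T.map List.length = U.map List.length := by
  induction T generalizing U with
  | nil =>
    cases U with
    | nil => rfl
    | cons D U =>
      have := h 0
      simp only [colLens_nil, colLens_cons_zero] at this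
      exact absurd (List.length_eq_zero_iff.1 this.symm) fun h => hU (by simp [h])
  | cons C T ih =>
    cases U with
    | nil =>
      have := h 0
      simp only [colLens_nil, colLens_cons_zero] at this
      exact absurd (List.length_eq_zero_iff.1 this) fun h => hT (by simp [h])
    | cons D U =>
      have h0 := h 0
      simp only [colLens_cons_zero] at h0
      simp only [List.map_cons, List.cons.injEq]
      exact ⟨h0, ih (fun h => hT (by simp [h])) (fun h => hU (by simp [h])) fun j => h (j + 1)⟩

theorem rowOK_of_getElem {C D : List α} (hl : D.length ≤ C.length)
    (h : ∀ (i : ℕ) c d, C[i]? = some c → D[i]? = some d → r c d = true) : RowOK r C D := by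
  induction C generalizing D with
  | nil =>
    have : D = [] := by simpa using hl
    subst this; simp
  | cons c C ih =>
    cases D with
    | nil => simp
    | cons d D =>
      exact ⟨h 0 c d rfl rfl, ih (by simpa using hl) fun i c d h1 h2 => h (i + 1) c d h1 h2⟩

theorem RowOK.getElem {C D : List α} (h : RowOK r C D) {i : ℕ} {c d : α} (hc : C[i]? = some c)
    (hd : D[i]? = some d) : r c d = true := by
  induction C generalizing D i with
  | nil => simp at hc
  | cons c' C ih =>
    cases D with
    | nil => simp at hd
    | cons d' D =>
      cases i with
      | zero =>
        simp only [List.getElem?_cons_zero, Option.some.injEq] at hc hd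
        subst hc hd; exact h.1
      | succ i => exact ih h.2 hc hd

theorem isCol_iff_getElem {C : List α} : IsCol r C ↔
    ∀ (i i' : ℕ) a b, i < i' → C[i]? = some a → C[i']? = some b → r b a = false := by
  rw [IsCol, List.pairwise_iff_getElem]
  constructor
  · intro h i i' a b hi ha hb
    obtain ⟨h1, rfl⟩ := List.getElem?_eq_some_iff.1 ha
    obtain ⟨h2, rfl⟩ := List.getElem?_eq_some_iff.1 hb
    exact h i i' h1 h2 hi
  · intro h i j hi hj hij
    exact h i j _ _ hij (List.getElem?_eq_getElem hi) (List.getElem?_eq_getElem hj)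

theorem IsTab.row (hr : IsBump r) {T : List (List α)} (h : IsTab r T) {i j j' : ℕ} {a b : α}
    (hj : j < j') (ha : entry T i j = some a) (hb : entry T i j' = some b) : r a b = true := by
  induction T generalizing j j' a b with
  | nil => simp [entry_nil] at ha
  | cons C T ih =>
    obtain ⟨j', rfl⟩ : ∃ k, j' = k + 1 := ⟨j' - 1, by omega⟩
    rw [entry_succ] at hb
    cases j with
    | succ j =>
      rw [entry_succ] at ha
      exact ih h.tail (by omega) ha hb
    | zero =>
      rw [entry_zero] at ha
      cases T with
      | nil => simp [entry_nil] at hb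
      | cons D T =>
        cases j' with
        | zero =>
          rw [entry_zero] at hb
          exact h.2.2.1.getElem ha hb
        | succ j' =>
          have h1 : (entry (D :: T) i 0).isSome := by
            rw [entry_isSome]
            have h2 : i < colLens (D :: T) (j' + 1) := by rw [← entry_isSome, hb]; rfl
            exact h2.trans_le (h.tail.antitone (Nat.zero_le _))
          obtain ⟨d, hd⟩ := Option.isSome_iff_exists.1 h1
          refine hr.trans _ _ _ ?_ (ih h.tail (Nat.succ_pos j') hd hb)
          rw [entry_zero] at hd
          exact h.2.2.1.getElem ha hd

theorem IsTab.col {T : List (List α)} (h : IsTab r T) {i i' j : ℕ} {a b : α}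
    (hi : i < i') (ha : entry T i j = some a) (hb : entry T i' j = some b) : r b a = false := by
  induction T generalizing j with
  | nil => simp [entry_nil] at ha
  | cons C T ih =>
    cases j with
    | zero =>
      rw [entry_zero] at ha hb
      exact isCol_iff_getElem.1 h.2.1 i i' a b hi ha hb
    | succ j => exact ih h.tail ha hb

theorem isTab_of_entry {T : List (List α)} (h0 : [] ∉ T)
    (hl : ∀ j, colLens T (j + 1) ≤ colLens T j)
    (hrow : ∀ i j j' a b, j < j' → entry T i j = some a → entry T i j' = some b → r a b = true)
    (hcol : ∀ i i' j a b, i < i' → entry T i j = some a → entry T i' j = some b → r b a = false) :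
    IsTab r T := by
  induction T with
  | nil => trivial
  | cons C T ih =>
    refine ⟨fun h => h0 (by simp [h]), ?_, ?_, ?_⟩
    · exact isCol_iff_getElem.2 fun i i' a b hi ha hb =>
        hcol i i' 0 a b hi (by rw [entry_zero, ha]) (by rw [entry_zero, hb])
    · cases T with
      | nil => simp
      | cons D T =>
        refine rowOK_of_getElem (hl 0) fun i c d hc hd =>
          hrow i 0 1 c d Nat.zero_lt_one (by rw [entry_zero, hc]) ?_
        rw [entry_succ, entry_zero]; exact hd
    · exact ih (fun h => h0 (by simp [h])) (fun j => hl (j + 1))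
        (fun i j j' a b hj ha hb => hrow i (j + 1) (j' + 1) a b (by omega) ha hb)
        (fun i i' j a b hi ha hb => hcol i i' (j + 1) a b hi ha hb)

/-- The Young diagram with given column lengths. -/
def diagramOfCols (f : ℕ → ℕ) (N : ℕ) (hf : Antitone f) : YoungDiagram where
  cells := (Finset.range N).biUnion fun j => (Finset.range (f j)).map
    ⟨fun i => (i, j), fun _ _ h => (Prod.ext_iff.1 h).1⟩
  isLowerSet := by
    rintro ⟨i, j⟩ ⟨i', j'⟩ ⟨h1, h2⟩ h
    simp only [Finset.coe_biUnion, Set.mem_iUnion, Finset.coe_map, Set.mem_image, Finset.mem_coe,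
      Finset.mem_range] at h ⊢
    obtain ⟨k, hk, x, hx, h⟩ := h
    cases h
    exact ⟨j', lt_of_le_of_lt h2 hk, i', lt_of_le_of_lt h1 (hx.trans_le (hf h2)), rfl⟩

theorem mem_diagramOfCols {f : ℕ → ℕ} {N : ℕ} {hf : Antitone f} (hN : f N = 0) {i j : ℕ} :
    (i, j) ∈ diagramOfCols f N hf ↔ i < f j := by
  rw [← YoungDiagram.mem_cells]
  simp only [diagramOfCols, Finset.mem_biUnion, Finset.mem_map, Finset.mem_range]
  constructor
  · rintro ⟨k, hk, x, hx, h⟩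
    cases h; exact hx
  · intro h
    refine ⟨j, ?_, i, h, rfl⟩
    by_contra hj
    have := hf (not_lt.1 hj)
    omega

theorem diagram_ext {lam mu : YoungDiagram} (h : ∀ j, lam.colLen j = mu.colLen j) : lam = mu := by
  apply YoungDiagram.ext
  ext ⟨i, j⟩
  rw [YoungDiagram.mem_cells, YoungDiagram.mem_cells, YoungDiagram.mem_iff_lt_colLen,
    YoungDiagram.mem_iff_lt_colLen, h]

theorem colLen_eq_of_mem_iff {lam : YoungDiagram} {f : ℕ → ℕ}
    (h : ∀ i j, (i, j) ∈ lam ↔ i < f j) (j : ℕ) : lam.colLen j = f j := by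
  have h1 : ∀ i, i < lam.colLen j ↔ i < f j := fun i => by
    rw [← YoungDiagram.mem_iff_lt_colLen, h]
  have := h1 (f j); have := h1 (lam.colLen j); omega

theorem IsTab.exists_shape {T : List (List α)} (h : IsTab r T) :
    ∃ lam : YoungDiagram, ∀ j, lam.colLen j = colLens T j :=
  ⟨diagramOfCols (colLens T) T.length h.antitone, colLen_eq_of_mem_iff fun _ _ =>
    mem_diagramOfCols ((h.colLens_eq_zero_iff _).2 le_rfl)⟩

end Shapes

/-! ### Hook semistandard tableaux as tableaux for the bumping relation. -/

section HookTableaux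

variable {m n : ℕ}

theorem bumps_true_iff {a b : Letter m n} : bumps m n a b = true ↔ a < b ∨ a = b ∧ deg m n a = 0 := by
  rw [bumps_iff, deg_eq_zero, Fin.lt_def, Fin.ext_iff]

theorem bumps_false_iff {a b : Letter m n} :
    bumps m n b a = false ↔ a < b ∨ a = b ∧ deg m n a = 1 := by
  have h1 : deg m n a = 1 ↔ ¬ a.val < m := by
    unfold deg; split_ifs <;> simp_all
  rw [bumps_eq_iff, h1, Fin.lt_def, Fin.ext_iff]
  simp only [Bool.false_eq_true, iff_false]
  omega

theorem mem_hookTableaux_iff {lam : YoungDiagram} {T : List (List (Letter m n))} :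
    T ∈ hookTableaux m n lam ↔ IsTab (bumps m n) T ∧ ∀ j, colLens T j = lam.colLen j := by
  constructor
  · rintro ⟨h0, hs, hrow, hcol⟩
    have hl : ∀ j, colLens T j = lam.colLen j := fun j =>
      (colLen_eq_of_mem_iff (fun i j => by rw [← hs, entry_isSome]) j).symm
    refine ⟨isTab_of_entry h0 (fun j => ?_) ?_ ?_, hl⟩
    · rw [hl, hl]; exact lam.colLen_anti _ _ (Nat.le_succ j)
    · intro i j j' a b hj ha hb
      exact bumps_true_iff.2 (hrow i j j' a b hj ha hb)
    · intro i i' j a b hi ha hb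
      exact bumps_false_iff.2 (hcol i i' j a b hi ha hb)
  · rintro ⟨hT, hl⟩
    refine ⟨hT.nil_notMem, fun i j => ?_, ?_, ?_⟩
    · rw [entry_isSome, hl, YoungDiagram.mem_iff_lt_colLen]
    · intro i j j' a b hj ha hb
      exact bumps_true_iff.1 (hT.row isBump_bumps hj ha hb)
    · intro i i' j a b hi ha hb
      exact bumps_false_iff.1 (hT.col hi ha hb)

/-- The bound is the entry of the highest weight tableau. Barred entries increase strictly down a
column, so row `i < m` starts at least at `i`. From row `m` on all entries are unbarred, and they
increase strictly along rows. -/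
theorem IsTab.le_entry {T : List (List (Letter m n))} (hT : IsTab (bumps m n) T) {i j : ℕ}
    {a : Letter m n} (ha : entry T i j = some a) : (if i < m then i else m + j) ≤ a.val := by
  have h1 : ∀ i j a, entry T i j = some a → min i m ≤ a.val := by
    intro i
    induction i with
    | zero => simp
    | succ i ih =>
      intro j a ha
      have h2 : (entry T i j).isSome := by
        have : (entry T (i + 1) j).isSome := by rw [ha]; rfl
        rw [entry_isSome] at this ⊢; omega
      obtain ⟨b, hb⟩ := Option.isSome_iff_exists.1 h2
      have h3 := hT.col (Nat.lt_succ_self i) hb ha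
      have h4 := ih j b hb
      rw [bumps_eq_iff] at h3
      simp only [Bool.false_eq_true, iff_false] at h3
      omega
  split_ifs with hi
  · have := h1 i j a ha; omega
  · induction j generalizing a with
    | zero => have := h1 i 0 a ha; omega
    | succ j ih =>
      have h2 : (entry T i j).isSome := by
        have : (entry T i (j + 1)).isSome := by rw [ha]; rfl
        rw [entry_isSome] at this ⊢
        have := hT.colLens_le j; omega
      obtain ⟨b, hb⟩ := Option.isSome_iff_exists.1 h2
      have h3 := hT.row isBump_bumps (Nat.lt_succ_self j) hb ha
      have h4 := ih hb
      have h5 := h1 i j b hb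
      rw [bumps_iff] at h3
      omega

/-- A box in row `m` and column `n` would need a letter in position at least `m + n`. -/
theorem mem_hookPartitions_of_isTab {T : List (List (Letter m n))} (hT : IsTab (bumps m n) T)
    {lam : YoungDiagram} (h : ∀ j, colLens T j = lam.colLen j) : lam ∈ hookPartitions m n := by
  change lam.rowLen m ≤ n
  by_contra hn
  have h1 : (m, n) ∈ lam := YoungDiagram.mem_iff_lt_rowLen.2 (not_le.1 hn)
  rw [YoungDiagram.mem_iff_lt_colLen, ← h, ← entry_isSome] at h1
  obtain ⟨a, ha⟩ := Option.isSome_iff_exists.1 h1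
  have := hT.le_entry ha
  simp at this
  omega

end HookTableaux

/-! ### Subcrystals -/

section Pullback

variable {m n : ℕ} {B X : Type*} {C : CrystalData m n B} {r : X → B}

theorem pullback_f (hr : Function.Injective r) {i x y} :
    (C.pullback r).f i x = some y ↔ C.f i (r x) = some (r y) := by
  classical
  simp only [CrystalData.pullback]
  constructor
  · intro h
    split_ifs at h with h1
    rw [Option.some.injEq] at h
    rw [← h]; exact h1.choose_spec
  · intro h
    have h1 : ∃ y, C.f i (r x) = some (r y) := ⟨y, h⟩
    rw [dif_pos h1, Option.some.injEq]
    have h2 := h1.choose_spec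
    exact hr (Option.some.inj (h2.symm.trans h))

theorem pullback_e (hr : Function.Injective r) {i x y} :
    (C.pullback r).e i x = some y ↔ C.e i (r x) = some (r y) := by
  classical
  simp only [CrystalData.pullback]
  constructor
  · intro h
    split_ifs at h with h1
    rw [Option.some.injEq] at h
    rw [← h]; exact h1.choose_spec
  · intro h
    have h1 : ∃ y, C.e i (r x) = some (r y) := ⟨y, h⟩
    rw [dif_pos h1, Option.some.injEq]
    have h2 := h1.choose_spec
    exact hr (Option.some.inj (h2.symm.trans h))

theorem isCrystal_pullback (hC : C.IsCrystal) (hr : Function.Injective r) :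
    (C.pullback r).IsCrystal where
  string i x h := hC.string i (r x) h
  odd_nonneg i x h := hC.odd_nonneg i (r x) h
  odd_string i x h := hC.odd_string i (r x) h
  e_ε i x y h := hC.e_ε i _ _ ((pullback_e hr).1 h)
  e_φ i x y h := hC.e_φ i _ _ ((pullback_e hr).1 h)
  e_wt i x y h := hC.e_wt i _ _ ((pullback_e hr).1 h)
  f_ε i x y h := hC.f_ε i _ _ ((pullback_f hr).1 h)
  f_φ i x y h := hC.f_φ i _ _ ((pullback_f hr).1 h)
  f_wt i x y h := hC.f_wt i _ _ ((pullback_f hr).1 h)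
  f_iff_e i x y := by rw [pullback_f hr, pullback_e hr, hC.f_iff_e]

end Pullback

/-! ### The crystal of tableaux of a given shape. -/

section TableauCrystal

variable {m n : ℕ}

theorem normalForm_columnReading {T : List (List (Letter m n))} (hT : IsTab (bumps m n) T) :
    normalForm m n (columnReading T) = columnReading T := by
  rw [normalForm, wordTab_columnReading hT]

theorem tableauWord_injective (lam : YoungDiagram) : Function.Injective (tableauWord m n lam) := by
  rintro ⟨T, hT⟩ ⟨U, hU⟩ h
  obtain ⟨hT1, hT2⟩ := mem_hookTableaux_iff.1 hT
  obtain ⟨hU1, hU2⟩ := mem_hookTableaux_iff.1 hU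
  exact Subtype.ext (columnReading_inj (map_length_eq_of_colLens hT1.nil_notMem hU1.nil_notMem
    fun j => by rw [hT2, hU2]) h)

/-- The reading of a tableau is fixed by `normalForm`, and `f_i` commutes with `normalForm`; hence
its image is again fixed, that is, the reading of a tableau, and the shape does not change. -/
theorem wordF_columnReading {i : Idx m n} {lam : YoungDiagram} {T : List (List (Letter m n))}
    (hT : T ∈ hookTableaux m n lam) {w : List (Letter m n)}
    (h : wordF m n i (columnReading T) = some w) :
    wordTab (bumps m n) w ∈ hookTableaux m n lam ∧ columnReading (wordTab (bumps m n) w) = w := by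
  obtain ⟨hT1, hT2⟩ := mem_hookTableaux_iff.1 hT
  have h1 := wordF_normalForm (i := i) (columnReading T)
  rw [normalForm_columnReading hT1, h, Option.map_some, Option.some.injEq] at h1
  refine ⟨mem_hookTableaux_iff.2 ⟨isTab_wordTab isBump_bumps w, fun j => ?_⟩, h1.symm⟩
  have h2 := wordF_wordTab_length h
  rw [wordTab_columnReading hT1] at h2
  rw [colLens_congr h2, hT2]

theorem wordE_columnReading {i : Idx m n} {lam : YoungDiagram} {T : List (List (Letter m n))}
    (hT : T ∈ hookTableaux m n lam) {w : List (Letter m n)}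
    (h : wordE m n i (columnReading T) = some w) :
    wordTab (bumps m n) w ∈ hookTableaux m n lam ∧ columnReading (wordTab (bumps m n) w) = w := by
  obtain ⟨hT1, hT2⟩ := mem_hookTableaux_iff.1 hT
  have h0 := (wordE_spec i).2 h
  have h1 := wordF_normalForm (i := i) w
  rw [h0, Option.map_some, normalForm_columnReading hT1, wordE_spec, h, Option.some.injEq] at h1
  refine ⟨mem_hookTableaux_iff.2 ⟨isTab_wordTab isBump_bumps w, fun j => ?_⟩, h1.symm⟩
  have h2 := wordF_wordTab_length h0
  rw [wordTab_columnReading hT1] at h2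
  rw [← colLens_congr h2, hT2]

theorem isSubcrystal_tableauWord (lam : YoungDiagram) :
    IsSubcrystal (wordCrystal m n) (tableauWord m n lam) where
  injective := tableauWord_injective lam
  e_mem i T w h := by
    obtain ⟨h1, h2⟩ := wordE_columnReading T.2 h
    exact ⟨⟨_, h1⟩, h2⟩
  f_mem i T w h := by
    obtain ⟨h1, h2⟩ := wordF_columnReading T.2 h
    exact ⟨⟨_, h1⟩, h2⟩
  isCrystal := isCrystal_pullback isCrystal_wordCrystal (tableauWord_injective lam)

end TableauCrystal

end HookCrystal


namespace HookCrystal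

/-! ### Matrices as families of column words and row words -/

section Blocks

variable {m n u v : ℕ}

theorem isChain_iff_pairwise_bumps (fl : Bool) {w : List (Letter m n)} :
    w.IsChain (fun a b => bumps m n b a = fl) ↔ w.Pairwise fun a b => bumps m n b a = fl := by
  have : Trans (fun a b : Letter m n => bumps m n b a = fl)
      (fun a b => bumps m n b a = fl) (fun a b => bumps m n b a = fl) := by
    refine ⟨fun {a b c} h1 h2 => ?_⟩
    cases fl with
    | false => exact isBump_bumps.neg_trans h2 h1
    | true => exact isBump_bumps.trans _ _ _ h2 h1
  exact List.isChain_iff_pairwise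

/-- The words which are the part of the first biword with a given lower letter: column words for
a barred letter, row words for an unbarred one. -/
def IsBlock (m n : ℕ) {u v : ℕ} (b' : Letter u v) (w : List (Letter m n)) : Prop :=
  w.Pairwise fun x y => bumps m n y x = decide (u ≤ b'.val)

theorem isBlock_wordF_iff {i : Idx m n} {b' : Letter u v} {w w' : List (Letter m n)}
    (h : wordF m n i w = some w') : IsBlock m n b' w ↔ IsBlock m n b' w' := by
  rw [IsBlock, IsBlock, ← isChain_iff_pairwise_bumps, ← isChain_iff_pairwise_bumps,
    isChain_wordF_iff _ h]

theorem count_flatMap_replicate {β γ : Type*} [DecidableEq β] [DecidableEq γ] {L : List β}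
    (hL : L.Nodup) (k : β → ℕ) (f : β → γ) (hf : Function.Injective f) {b : β} (hb : b ∈ L) :
    (L.flatMap fun b => List.replicate (k b) (f b)).count (f b) = k b := by
  induction L with
  | nil => simp at hb
  | cons a L ih =>
    rw [List.nodup_cons] at hL
    rw [List.flatMap_cons, List.count_append, List.count_replicate]
    rcases List.mem_cons.1 hb with rfl | hb
    · have : (L.flatMap fun b => List.replicate (k b) (f b)).count (f b) = 0 := by
        rw [List.count_eq_zero]
        intro h
        obtain ⟨c, hc, h⟩ := List.mem_flatMap.1 h
        exact hL.1 (hf (List.eq_of_mem_replicate h) ▸ hc)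
      simp [this]
    · have hab : a ≠ b := fun h => hL.1 (h ▸ hb)
      rw [ih hL.2 hb, if_neg (by simpa using fun h => hab (hf h)), zero_add]

theorem count_block (A : MSharp m n u v) (b : Letter m n) (b' : Letter u v) :
    (block A b').count b = A.1 b b' :=
  count_flatMap_replicate (nodup_orderedLetters _) (fun b => A.1 b b') id
    Function.injective_id (mem_orderedLetters _ b)

theorem deg_eq_iff {b : Letter m n} {b' : Letter u v} :
    deg m n b = deg u v b' ↔ (b.val < m ↔ b'.val < u) := by
  unfold deg; split_ifs <;> simp <;> omega

theorem isBlock_block (A : MSharp m n u v) (b' : Letter u v) : IsBlock m n b' (block A b') := by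
  rw [IsBlock, block, List.pairwise_flatMap]
  refine ⟨fun b _ => ?_, (pairwise_orderedLetters _).imp ?_⟩
  · have h := A.2 b b'
    rw [deg_eq_iff] at h
    rw [List.pairwise_replicate]
    rw [bumps_eq_iff, decide_eq_true_eq]
    omega
  · intro x y h x' hx y' hy
    rw [List.eq_of_mem_replicate hx, List.eq_of_mem_replicate hy, bumps_eq_iff, decide_eq_true_eq]
    simp only [deg_eq_zero] at h
    split_ifs at h <;> omega

/-- A letter bumps its own copy exactly if it is barred. So a column word can repeat only unbarred
letters and a row word only barred ones, which is the bound in the definition of `M♯`. -/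
theorem IsBlock.count_le {b' : Letter u v} {w : List (Letter m n)} (h : IsBlock m n b' w)
    (b : Letter m n) (hb : deg m n b = deg u v b') : w.count b ≤ 1 := by
  by_contra hc
  have h1 : List.Sublist (List.replicate 2 b) w := List.replicate_sublist_iff.2 (by omega)
  have h2 := List.Pairwise.sublist h1 h
  rw [List.pairwise_replicate, bumps_eq_iff, decide_eq_true_eq] at h2
  rw [deg_eq_iff] at hb
  omega

/-- The matrix with given parts of the first word. -/
def matrixOf (g : Letter u v → List (Letter m n)) (hg : ∀ b', IsBlock m n b' (g b')) :
    MSharp m n u v :=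
  ⟨fun b b' => (g b').count b, fun b b' h => (hg b').count_le b h⟩

theorem eq_of_isBlock {b' : Letter u v} {w w' : List (Letter m n)} (h : IsBlock m n b' w)
    (h' : IsBlock m n b' w') (hp : w.Perm w') : w = w' := by
  refine hp.eq_of_pairwise (le := fun x y => bumps m n y x = decide (u ≤ b'.val)) ?_ h h'
  intro a b _ _ h1 h2
  rw [bumps_eq_iff, decide_eq_true_eq] at h1 h2
  rw [Fin.ext_iff]; omega

theorem block_matrixOf {g : Letter u v → List (Letter m n)} (hg : ∀ b', IsBlock m n b' (g b'))
    (b' : Letter u v) : block (matrixOf g hg) b' = g b' := by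
  refine eq_of_isBlock (isBlock_block _ b') (hg b') ?_
  rw [List.perm_iff_count]
  intro b
  rw [count_block]; rfl

theorem MSharp.ext_block {A B : MSharp m n u v} (h : ∀ b', block A b' = block B b') : A = B := by
  apply Subtype.ext
  ext b b'
  rw [← count_block, h, count_block]

theorem words_snd (A : MSharp m n u v) : (words A).2 =
    (List.finRange (u + v)).flatMap fun b' => List.replicate (block A b').length b' := by
  simp only [words, biword, List.map_flatMap, List.map_replicate]
  congr 1
  funext b'
  rw [List.eq_replicate_iff]
  refine ⟨?_, ?_⟩
  · simp only [block, List.length_flatMap, List.length_replicate]; rfl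
  · intro c hc
    obtain ⟨b, -, h⟩ := List.mem_flatMap.1 hc
    exact List.eq_of_mem_replicate h

theorem wordsStar_fst (A : MSharp m n u v) : (wordsStar A).1 =
    (List.finRange (m + n)).reverse.flatMap fun b =>
      List.replicate (block A.transpose b).length b := by
  simp only [wordsStar, biwordStar, List.map_flatMap, List.map_replicate]
  congr 1
  funext b'
  rw [List.eq_replicate_iff]
  refine ⟨?_, ?_⟩
  · simp only [block, List.length_flatMap, List.length_replicate]; rfl
  · intro c hc
    obtain ⟨b, -, h⟩ := List.mem_flatMap.1 hc
    exact List.eq_of_mem_replicate h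

theorem flatMap_inj {β : Type*} {L : List β} {g h : β → List (Letter m n)}
    (hl : ∀ b ∈ L, (g b).length = (h b).length) (he : L.flatMap g = L.flatMap h) :
    ∀ b ∈ L, g b = h b := by
  induction L with
  | nil => simp
  | cons a L ih =>
    rw [List.flatMap_cons, List.flatMap_cons] at he
    obtain ⟨h1, h2⟩ := List.append_inj he (hl a (by simp))
    intro b hb
    rcases List.mem_cons.1 hb with rfl | hb
    · exact h1
    · exact ih (fun b hb => hl b (by simp [hb])) h2 b hb

/-- The word `j` gives the lengths of the blocks, these cut `i` into blocks, and the contents of the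
blocks are the columns of the matrix. -/
theorem words_injective : Function.Injective (words (m := m) (n := n) (u := u) (v := v)) := by
  intro A B h
  have h1 := congrArg Prod.fst h
  have h2 := congrArg Prod.snd h
  rw [words_fst, words_fst] at h1
  rw [words_snd, words_snd] at h2
  have hl : ∀ b', (block A b').length = (block B b').length := by
    intro b'
    have h3 := congrArg (List.count b') h2
    have key := fun C : MSharp m n u v => count_flatMap_replicate (List.nodup_finRange (u + v))
      (fun b' => (block C b').length) id Function.injective_id (List.mem_finRange b')
    simpa only [id] using (key A).symm.trans (h3.trans (key B))
  exact MSharp.ext_block fun b' => flatMap_inj (fun b _ => hl b) h1 b' (List.mem_finRange b')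

theorem MSharp.transpose_injective :
    Function.Injective (MSharp.transpose (m := m) (n := n) (u := u) (v := v)) := by
  intro A B h
  apply Subtype.ext
  ext b b'
  exact congrFun (congrFun (congrArg Subtype.val h) b') b

theorem MSharp.transpose_transpose (A : MSharp m n u v) : A.transpose.transpose = A := rfl

theorem wordsStar_injective :
    Function.Injective (wordsStar (m := m) (n := n) (u := u) (v := v)) := by
  intro A B h
  have h1 := congrArg Prod.snd h
  have h2 := congrArg Prod.fst h
  rw [wordsStar_snd, wordsStar_snd] at h1
  rw [wordsStar_fst, wordsStar_fst] at h2
  have hl : ∀ b', (block A.transpose b').length = (block B.transpose b').length := by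
    intro b'
    have h3 := congrArg (List.count b') h2
    have key := fun C : MSharp m n u v =>
      count_flatMap_replicate (List.nodup_reverse.2 (List.nodup_finRange (m + n)))
      (fun b' => (block C.transpose b').length) id Function.injective_id
      (List.mem_reverse.2 (List.mem_finRange b'))
    simpa only [id] using (key A).symm.trans (h3.trans (key B))
  exact MSharp.transpose_injective (MSharp.ext_block fun b' => flatMap_inj (fun b _ => hl b) h1 b'
    (List.mem_reverse.2 (List.mem_finRange b')))

/-! ### The operators change one part of a word -/

theorem flatMap_update_of_notMem {β : Type*} [DecidableEq β] {L : List β} {a : β} (ha : a ∉ L)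
    (g : β → List (Letter m n)) (x : List (Letter m n)) :
    L.flatMap (Function.update g a x) = L.flatMap g := by
  apply List.flatMap_congr
  intro b hb
  rw [Function.update_of_ne]
  rintro rfl; exact ha hb

/-- By the tensor product rule an operator changes a single factor. -/
theorem wordF_flatMap {i : Idx m n} {β : Type*} [DecidableEq β] {L : List β} (hL : L.Nodup)
    {g : β → List (Letter m n)} {w' : List (Letter m n)}
    (h : wordF m n i (L.flatMap g) = some w') :
    ∃ c ∈ L, ∃ x', wordF m n i (g c) = some x' ∧ w' = L.flatMap (Function.update g c x') := by
  induction L generalizing w' with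
  | nil => cases h
  | cons a L ih =>
    rw [List.nodup_cons] at hL
    rw [List.flatMap_cons] at h
    rcases wordF_append h with ⟨x', hx', rfl⟩ | ⟨y', hy', rfl⟩
    · exact ⟨a, by simp, x', hx', by rw [List.flatMap_cons, Function.update_self,
        flatMap_update_of_notMem hL.1]⟩
    · obtain ⟨c, hc, x', hx', rfl⟩ := ih hL.2 hy'
      have hca : a ≠ c := fun h => hL.1 (h ▸ hc)
      exact ⟨c, by simp [hc], x', hx', by rw [List.flatMap_cons, Function.update_of_ne hca]⟩

theorem wordF_eq_flatMap {i : Idx m n} {β : Type*} [DecidableEq β] {L : List β} (hL : L.Nodup)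
    {g : β → List (Letter m n)} {w : List (Letter m n)}
    (h : wordF m n i w = some (L.flatMap g)) :
    ∃ c ∈ L, ∃ x, wordF m n i x = some (g c) ∧ w = L.flatMap (Function.update g c x) := by
  induction L generalizing w with
  | nil =>
    have := wordF_length h
    obtain rfl : w = [] := by simpa using this.symm
    cases h
  | cons a L ih =>
    rw [List.nodup_cons] at hL
    rw [List.flatMap_cons] at h
    have hlen := wordF_length h
    rw [List.length_append] at hlen
    obtain ⟨x, y, rfl, hx⟩ : ∃ x y, w = x ++ y ∧ x.length = (g a).length :=
      ⟨w.take (g a).length, w.drop (g a).length, (List.take_append_drop _ _).symm, by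
        rw [List.length_take]; omega⟩
    rcases wordF_append h with ⟨x', hx', he⟩ | ⟨y', hy', he⟩
    · obtain ⟨h1, h2⟩ := List.append_inj he (by rw [wordF_length hx', hx])
      rw [← h1] at hx'
      exact ⟨a, by simp, x, hx', by rw [List.flatMap_cons, Function.update_self,
        flatMap_update_of_notMem hL.1, h2]⟩
    · obtain ⟨h1, h2⟩ := List.append_inj he hx.symm
      rw [← h2] at hy'
      obtain ⟨c, hc, x', hx', rfl⟩ := ih hL.2 hy'
      have hca : a ≠ c := fun h => hL.1 (h ▸ hc)
      exact ⟨c, by simp [hc], x', hx', by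
        rw [List.flatMap_cons, Function.update_of_ne hca, h1]⟩

theorem exists_block_update {A : MSharp m n u v} {c : Letter u v} {x : List (Letter m n)}
    (hx : IsBlock m n c x) : ∃ A' : MSharp m n u v, block A' = Function.update (block A) c x := by
  have hg : ∀ b', IsBlock m n b' (Function.update (block A) c x b') := by
    intro b'
    by_cases h : b' = c
    · subst h; rw [Function.update_self]; exact hx
    · rw [Function.update_of_ne h]; exact isBlock_block A b'
  exact ⟨matrixOf _ hg, funext (block_matrixOf hg)⟩

/-- The factor that changes remains a block of the same kind and length, so the result is again the
word of a matrix, with the same second component. -/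
theorem wordF_block {i : Idx m n} {A : MSharp m n u v} {L : List (Letter u v)} (hL : L.Nodup)
    {w : List (Letter m n)} (h : wordF m n i (L.flatMap (block A)) = some w) :
    ∃ A' : MSharp m n u v, L.flatMap (block A') = w ∧
      ∀ b', (block A' b').length = (block A b').length := by
  obtain ⟨c, hc, x, hx, rfl⟩ := wordF_flatMap hL h
  obtain ⟨A', hA'⟩ := exists_block_update (A := A) ((isBlock_wordF_iff hx).1 (isBlock_block A c))
  refine ⟨A', by rw [hA'], fun b' => ?_⟩
  rw [hA']
  by_cases h : b' = c
  · subst h; rw [Function.update_self, wordF_length hx]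
  · rw [Function.update_of_ne h]

theorem wordE_block {i : Idx m n} {A : MSharp m n u v} {L : List (Letter u v)} (hL : L.Nodup)
    {w : List (Letter m n)} (h : wordE m n i (L.flatMap (block A)) = some w) :
    ∃ A' : MSharp m n u v, L.flatMap (block A') = w ∧
      ∀ b', (block A' b').length = (block A b').length := by
  obtain ⟨c, hc, x, hx, rfl⟩ := wordF_eq_flatMap hL ((wordE_spec i).2 h)
  obtain ⟨A', hA'⟩ := exists_block_update (A := A) ((isBlock_wordF_iff hx).2 (isBlock_block A c))
  refine ⟨A', by rw [hA'], fun b' => ?_⟩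
  rw [hA']
  by_cases h : b' = c
  · subst h; rw [Function.update_self, wordF_length hx]
  · rw [Function.update_of_ne h]

/-! ### Matrices form a subcrystal of the pairs of words -/

theorem isCrystal_onFst {B : Type*} {C : CrystalData m n B} (hC : C.IsCrystal) (B' : Type*) :
    (C.onFst B').IsCrystal where
  string i p h := hC.string i p.1 h
  odd_nonneg i p h := hC.odd_nonneg i p.1 h
  odd_string i p h := hC.odd_string i p.1 h
  e_ε i p q h := by
    obtain ⟨b, hb, rfl⟩ := Option.map_eq_some_iff.1 h
    exact hC.e_ε i p.1 b hb
  e_φ i p q h := by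
    obtain ⟨b, hb, rfl⟩ := Option.map_eq_some_iff.1 h
    exact hC.e_φ i p.1 b hb
  e_wt i p q h := by
    obtain ⟨b, hb, rfl⟩ := Option.map_eq_some_iff.1 h
    exact hC.e_wt i p.1 b hb
  f_ε i p q h := by
    obtain ⟨b, hb, rfl⟩ := Option.map_eq_some_iff.1 h
    exact hC.f_ε i p.1 b hb
  f_φ i p q h := by
    obtain ⟨b, hb, rfl⟩ := Option.map_eq_some_iff.1 h
    exact hC.f_φ i p.1 b hb
  f_wt i p q h := by
    obtain ⟨b, hb, rfl⟩ := Option.map_eq_some_iff.1 h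
    exact hC.f_wt i p.1 b hb
  f_iff_e i p q := by
    simp only [CrystalData.onFst, Option.map_eq_some_iff]
    constructor
    · rintro ⟨b, hb, rfl⟩; exact ⟨p.1, (hC.f_iff_e i _ _).1 hb, rfl⟩
    · rintro ⟨b, hb, rfl⟩; exact ⟨q.1, (hC.f_iff_e i _ _).2 hb, rfl⟩

theorem isCrystal_onSnd {B : Type*} {C : CrystalData m n B} (hC : C.IsCrystal) (B' : Type*) :
    (C.onSnd B').IsCrystal where
  string i p h := hC.string i p.2 h
  odd_nonneg i p h := hC.odd_nonneg i p.2 h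
  odd_string i p h := hC.odd_string i p.2 h
  e_ε i p q h := by
    obtain ⟨b, hb, rfl⟩ := Option.map_eq_some_iff.1 h
    exact hC.e_ε i p.2 b hb
  e_φ i p q h := by
    obtain ⟨b, hb, rfl⟩ := Option.map_eq_some_iff.1 h
    exact hC.e_φ i p.2 b hb
  e_wt i p q h := by
    obtain ⟨b, hb, rfl⟩ := Option.map_eq_some_iff.1 h
    exact hC.e_wt i p.2 b hb
  f_ε i p q h := by
    obtain ⟨b, hb, rfl⟩ := Option.map_eq_some_iff.1 h
    exact hC.f_ε i p.2 b hb
  f_φ i p q h := by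
    obtain ⟨b, hb, rfl⟩ := Option.map_eq_some_iff.1 h
    exact hC.f_φ i p.2 b hb
  f_wt i p q h := by
    obtain ⟨b, hb, rfl⟩ := Option.map_eq_some_iff.1 h
    exact hC.f_wt i p.2 b hb
  f_iff_e i p q := by
    simp only [CrystalData.onSnd, Option.map_eq_some_iff]
    constructor
    · rintro ⟨b, hb, rfl⟩; exact ⟨p.2, (hC.f_iff_e i _ _).1 hb, rfl⟩
    · rintro ⟨b, hb, rfl⟩; exact ⟨q.2, (hC.f_iff_e i _ _).2 hb, rfl⟩

theorem words_eq_of {A B : MSharp m n u v} {w : List (Letter m n)}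
    (h : (List.finRange (u + v)).flatMap (block B) = w)
    (hl : ∀ b', (block B b').length = (block A b').length) : words B = (w, (words A).2) := by
  refine Prod.ext (by rw [words_fst, h]) ?_
  rw [words_snd, words_snd]; simp only [hl]

theorem wordsStar_eq_of {A : MSharp m n u v} {B : MSharp u v m n} {w : List (Letter u v)}
    (h : (List.finRange (m + n)).reverse.flatMap (block B) = w)
    (hl : ∀ b, (block B b).length = (block A.transpose b).length) :
    wordsStar B.transpose = ((wordsStar A).1, w) := by
  refine Prod.ext ?_ (by rw [wordsStar_snd, MSharp.transpose_transpose, h])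
  rw [wordsStar_fst, wordsStar_fst, MSharp.transpose_transpose]; simp only [hl]

theorem isSubcrystal_words :
    IsSubcrystal (biwordCrystal m n u v) (words (m := m) (n := n) (u := u) (v := v)) where
  injective := words_injective
  e_mem i A p h := by
    obtain ⟨w, hw, rfl⟩ := Option.map_eq_some_iff.1 h
    have hw' : wordE m n i (words A).1 = some w := hw
    rw [words_fst] at hw'
    obtain ⟨B, h1, h2⟩ := wordE_block (List.nodup_finRange _) hw'
    exact ⟨B, words_eq_of h1 h2⟩
  f_mem i A p h := by
    obtain ⟨w, hw, rfl⟩ := Option.map_eq_some_iff.1 h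
    have hw' : wordF m n i (words A).1 = some w := hw
    rw [words_fst] at hw'
    obtain ⟨B, h1, h2⟩ := wordF_block (List.nodup_finRange _) hw'
    exact ⟨B, words_eq_of h1 h2⟩
  isCrystal := isCrystal_pullback (isCrystal_onFst isCrystal_wordCrystal _) words_injective

theorem isSubcrystal_wordsStar :
    IsSubcrystal (biwordStarCrystal m n u v)
      (wordsStar (m := m) (n := n) (u := u) (v := v)) where
  injective := wordsStar_injective
  e_mem i A p h := by
    obtain ⟨w, hw, rfl⟩ := Option.map_eq_some_iff.1 h
    have hw' : wordE u v i (wordsStar A).2 = some w := hw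
    rw [wordsStar_snd] at hw'
    obtain ⟨B, h1, h2⟩ := wordE_block (List.nodup_reverse.2 (List.nodup_finRange _)) hw'
    exact ⟨B.transpose, wordsStar_eq_of h1 h2⟩
  f_mem i A p h := by
    obtain ⟨w, hw, rfl⟩ := Option.map_eq_some_iff.1 h
    have hw' : wordF u v i (wordsStar A).2 = some w := hw
    rw [wordsStar_snd] at hw'
    obtain ⟨B, h1, h2⟩ := wordF_block (List.nodup_reverse.2 (List.nodup_finRange _)) hw'
    exact ⟨B.transpose, wordsStar_eq_of h1 h2⟩
  isCrystal := isCrystal_pullback (isCrystal_onSnd isCrystal_wordCrystal _) wordsStar_injective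

end Blocks

end HookCrystal


namespace HookCrystal

/-! ### Restriction of a tableau to the small letters -/

section Restrict

variable {α : Type*} {r : α → α → Bool} {p : α → Bool}

/-- The entries which satisfy `p`. -/
def restrictTab (p : α → Bool) : List (List α) → List (List α)
  | [] => []
  | C :: T => if C.filter p = [] then [] else C.filter p :: restrictTab p T

/-- `p` holds for all entries which are bumped by, or equal to, an entry with `p`. -/
def IsLower (r : α → α → Bool) (p : α → Bool) : Prop :=
  ∀ a b, r a b = true → p b = true → p a = true

/-- A letter without `p` bumps only letters without `p`, so its whole path is invisible. -/
theorem restrictTab_tabInsert_of_not (hp : IsLower r p) {b : α} (hb : p b = false)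
    (T : List (List α)) : restrictTab p (tabInsert r b T) = restrictTab p T := by
  induction T generalizing b with
  | nil => simp [tabInsert, restrictTab, hb]
  | cons C T ih =>
    cases ho : (colInsert r b C).2 with
    | none =>
      rw [tabInsert_cons_none T ho, colInsert_fst_of_none ho]
      simp [restrictTab, hb]
    | some o =>
      rw [tabInsert_cons_some T ho]
      obtain ⟨X, Y, rfl, e, hbo, -⟩ := colInsert_some ho
      have hpo : p o = false := by
        by_contra h
        rw [hp b o hbo (by simpa using h)] at hb; cases hb
      rw [e]
      simp [restrictTab, hb, hpo, ih hpo]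

theorem filter_eq_nil_of_rowOK (hp : IsLower r p) {C D : List α} (h : RowOK r C D)
    (hC : C.filter p = []) : D.filter p = [] := by
  induction C generalizing D with
  | nil => cases D with
    | nil => rfl
    | cons d D => exact h.elim
  | cons c C ih =>
    cases D with
    | nil => rfl
    | cons d D =>
      rw [List.filter_eq_nil_iff] at hC
      have hc := hC c (by simp)
      have hd : ¬ p d = true := fun h' => hc (hp c d h.1 h')
      rw [List.filter_cons_of_neg hd]
      exact ih h.2 (List.filter_eq_nil_iff.2 fun x hx => hC x (by simp [hx]))

theorem restrictTab_eq_nil (hp : IsLower r p) {C : List α} {T : List (List α)}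
    (h : IsTab r (C :: T)) (hC : C.filter p = []) : restrictTab p T = [] := by
  cases T with
  | nil => rfl
  | cons D T =>
    have hD : D.filter p = [] := filter_eq_nil_of_rowOK hp h.2.2.1 hC
    simp only [restrictTab, hD, if_true]

/-- The insertion takes the same path in the restricted tableau until a letter without `p` is
bumped. There the restricted insertion ends at the bottom of the column, and the bumped letter no
longer matters. -/
theorem restrictTab_tabInsert (hr : IsBump r) (hp : IsLower r p) {b : α} (hb : p b = true)
    {T : List (List α)} (hT : IsTab r T) :
    restrictTab p (tabInsert r b T) = tabInsert r b (restrictTab p T) := by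
  induction T generalizing b with
  | nil => simp [tabInsert, restrictTab, hb]
  | cons C T ih =>
    cases ho : (colInsert r b C).2 with
    | none =>
      rw [tabInsert_cons_none T ho, colInsert_fst_of_none ho]
      rw [colInsert_none_iff] at ho
      by_cases hC : C.filter p = []
      · simp [restrictTab, hb, hC, tabInsert, restrictTab_eq_nil hp hT hC]
      · have h1 : (colInsert r b (C.filter p)).2 = none :=
          colInsert_none_iff.2 fun c hc => ho c (List.mem_filter.1 hc).1
        simp only [restrictTab, List.filter_append, hC, if_false]
        rw [tabInsert_cons_none _ h1, colInsert_fst_of_none h1]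
        simp [hb]
    | some o =>
      rw [tabInsert_cons_some T ho]
      obtain ⟨X, Y, rfl, e, hbo, hX⟩ := colInsert_some ho
      have hX' : ∀ x ∈ X.filter p, r b x = false := fun x hx => hX x (List.mem_filter.1 hx).1
      rw [e]
      cases hpo : p o with
      | true =>
        have h1 : colInsert r b ((X ++ o :: Y).filter p) =
            (X.filter p ++ b :: Y.filter p, some o) := by
          rw [List.filter_append, List.filter_cons_of_pos hpo, colInsert_append_of_not hX']
          simp [colInsert, hbo]
        have h2 : (X ++ o :: Y).filter p ≠ [] := by simp [hpo]
        have h3 : (X ++ b :: Y).filter p ≠ [] := by simp [hb]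
        have h4 : (X ++ b :: Y).filter p = X.filter p ++ b :: Y.filter p := by simp [hb]
        simp only [restrictTab, h2, h3, if_false]
        rw [tabInsert_cons_some _ (by rw [h1]), h1, h4, ih hpo hT.tail]
      | false =>
        -- In a column all entries below an entry without `p` also lack `p`, so the new letter is
        -- last among the visible ones.
        have hY : Y.filter p = [] := by
          rw [List.filter_eq_nil_iff]
          intro y hy hpy
          have h1 : r y o = false := by
            have := (List.pairwise_append.1 hT.2.1).2.1
            exact (List.pairwise_cons.1 this).1 y hy
          rcases hr.total o y with h | h | h
          · rw [hp o y h hpy] at hpo; cases hpo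
          · rw [h1] at h; cases h
          · subst h; rw [hpy] at hpo; cases hpo
        have h4 : (X ++ b :: Y).filter p = X.filter p ++ [b] := by simp [hb, hY]
        have h5 : (X ++ o :: Y).filter p = X.filter p := by simp [hpo, hY]
        simp only [restrictTab, h4, h5]
        rw [if_neg (by simp), restrictTab_tabInsert_of_not hp hpo]
        by_cases hXn : X.filter p = []
        · rw [if_pos hXn, restrictTab_eq_nil hp hT (by rw [h5, hXn]), hXn]; rfl
        · have h6 := colInsert_none_iff.2 hX'
          rw [if_neg hXn, tabInsert_cons_none _ h6, colInsert_fst_of_none h6]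

theorem restrictTab_wordTab (hr : IsBump r) (hp : IsLower r p) (w : List α) :
    restrictTab p (wordTab r w) = wordTab r (w.filter p) := by
  induction w using List.reverseRecOn with
  | nil => rfl
  | append_singleton w b ih =>
    rw [wordTab_concat, List.filter_append]
    cases hb : p b with
    | true =>
      rw [restrictTab_tabInsert hr hp hb (isTab_wordTab hr w), ih,
        List.filter_cons_of_pos hb, List.filter_nil, wordTab_concat]
    | false =>
      rw [restrictTab_tabInsert_of_not hp hb, ih, List.filter_cons_of_neg (by simp [hb])]
      simp

/-- The recursion of `restrictTab` stops at the first column without letters satisfying `p`; by the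
row condition no column further right has any. -/
theorem colLens_restrictTab (hp : IsLower r p) {T : List (List α)} (hT : IsTab r T) (j : ℕ) :
    colLens (restrictTab p T) j = colLens (T.map (List.filter p)) j := by
  induction T generalizing j with
  | nil => rfl
  | cons C T ih =>
    by_cases hC : C.filter p = []
    · have h1 := restrictTab_eq_nil hp hT hC
      simp only [restrictTab, hC, if_true]
      cases j with
      | zero => simp [hC]
      | succ j =>
        rw [List.map_cons, colLens_cons_succ, ← ih hT.tail, h1]; rfl
    · simp only [restrictTab, hC, if_false]
      cases j with
      | zero => simp
      | succ j => rw [List.map_cons, colLens_cons_succ, colLens_cons_succ, ih hT.tail]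

end Restrict

/-! ### Truncated matrices, and the invariance of the tableau of the other word. -/

section Invariance

variable {m n u v : ℕ}

theorem isLower_lt (c : ℕ) : IsLower (bumps m n) fun b => decide (b.val < c) := by
  intro a b h hb
  rw [bumps_iff] at h
  simp only [decide_eq_true_eq] at hb ⊢
  omega

theorem count_eq_length_filter (C : List (Letter m n)) (b : Letter m n) :
    C.count b + (C.filter fun x => decide (x.val < b.val)).length =
      (C.filter fun x => decide (x.val < b.val + 1)).length := by
  induction C with
  | nil => rfl
  | cons c C ih =>
    rw [List.count_cons, List.filter_cons, List.filter_cons]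
    rcases lt_trichotomy c.val b.val with h | h | h
    · simp only [h, Nat.lt_succ_of_lt h, decide_true, if_true, List.length_cons]
      rw [if_neg (by simp [Fin.ext_iff]; omega)]; omega
    · rw [if_pos (by simp [Fin.ext_iff]; omega)]
      simp only [h, lt_irrefl, Nat.lt_succ_self, decide_true, decide_false, if_true,
        Bool.false_eq_true, if_false, List.length_cons]; omega
    · rw [if_neg (by simp [Fin.ext_iff]; omega), if_neg (by simp; omega), if_neg (by simp; omega)]
      omega

theorem eq_of_isCol {C D : List (Letter m n)} (hC : IsCol (bumps m n) C)
    (hD : IsCol (bumps m n) D) (hp : C.Perm D) : C = D := by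
  refine hp.eq_of_pairwise (le := fun x y => bumps m n y x = false) ?_ hC hD
  intro a b _ _ h1 h2
  rw [bumps_eq_false] at h1 h2
  rw [Fin.ext_iff]; omega

/-- Differences of successive counts give the multiplicity of each letter in each column, and a
column is determined by its content. -/
theorem eq_of_filter_lengths {T U : List (List (Letter m n))} (hT : IsTab (bumps m n) T)
    (hU : IsTab (bumps m n) U) (h : ∀ c j,
      colLens (T.map (List.filter fun b => decide (b.val < c))) j =
        colLens (U.map (List.filter fun b => decide (b.val < c))) j) : T = U := by
  have hall : ∀ C : List (Letter m n), C.filter (fun b => decide (b.val < m + n)) = C :=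
    fun C => List.filter_eq_self.2 fun b _ => by simp
  induction T generalizing U with
  | nil =>
    cases U with
    | nil => rfl
    | cons D U =>
      have := h (m + n) 0
      simp only [List.map_nil, colLens_nil, List.map_cons, colLens_cons_zero, hall] at this
      exact absurd (List.length_eq_zero_iff.1 this.symm) hU.1
  | cons C T ih =>
    cases U with
    | nil =>
      have := h (m + n) 0
      simp only [List.map_nil, colLens_nil, List.map_cons, colLens_cons_zero, hall] at this
      exact absurd (List.length_eq_zero_iff.1 this) hT.1
    | cons D U =>
      rw [ih hT.tail hU.tail fun c j => h c (j + 1)]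
      have h0 : ∀ c, (C.filter fun b => decide (b.val < c)).length =
          (D.filter fun b => decide (b.val < c)).length := fun c => h c 0
      rw [eq_of_isCol hT.2.1 hU.2.1 (List.perm_iff_count.2 fun b => ?_)]
      have h1 := count_eq_length_filter C b
      have h2 := count_eq_length_filter D b
      rw [h0, h0] at h1
      omega

/-- A word tableau is determined by the shapes of its restrictions. -/
theorem wordTab_eq_of_restrict {w w' : List (Letter m n)}
    (h : ∀ c, colLens (wordTab (bumps m n) (w.filter fun b => decide (b.val < c))) =
      colLens (wordTab (bumps m n) (w'.filter fun b => decide (b.val < c)))) :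
    wordTab (bumps m n) w = wordTab (bumps m n) w' := by
  have h1 := isTab_wordTab (isBump_bumps (m := m) (n := n)) w
  have h2 := isTab_wordTab (isBump_bumps (m := m) (n := n)) w'
  refine eq_of_filter_lengths h1 h2 fun c j => ?_
  rw [← colLens_restrictTab (isLower_lt c) h1, ← colLens_restrictTab (isLower_lt c) h2,
    restrictTab_wordTab isBump_bumps (isLower_lt c), restrictTab_wordTab isBump_bumps (isLower_lt c),
    h]

/-- The matrix in which the columns from `c` on are replaced by zero. -/
def truncCols (A : MSharp m n u v) (c : ℕ) : MSharp m n u v :=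
  ⟨fun b b' => if b'.val < c then A.1 b b' else 0, fun b b' h => by
    have := A.2 b b' h
    change (if b'.val < c then A.1 b b' else 0) ≤ 1
    split_ifs <;> omega⟩

theorem block_truncCols (A : MSharp m n u v) (c : ℕ) (b' : Letter u v) :
    block (truncCols A c) b' = if b'.val < c then block A b' else [] := by
  by_cases h : b'.val < c <;> simp [block, truncCols, h]

theorem block_transpose_truncCols (A : MSharp m n u v) (c : ℕ) (b : Letter m n) :
    block (truncCols A c).transpose b =
      (block A.transpose b).filter fun b' => decide (b'.val < c) := by
  simp only [block, List.filter_flatMap, List.filter_replicate]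
  congr 1
  funext b'
  change List.replicate (if b'.val < c then A.1 b b' else 0) b' = _
  by_cases h : b'.val < c <;> simp [MSharp.transpose, Matrix.transpose_apply, h]

theorem flatMap_ite {β : Type*} (L : List β) (q : β → Bool) (g : β → List (Letter m n)) :
    (L.flatMap fun b => if q b = true then g b else []) = (L.filter q).flatMap g := by
  induction L with
  | nil => rfl
  | cons a L ih =>
    rw [List.flatMap_cons, ih, List.filter_cons]
    split_ifs <;> simp

theorem words_truncCols (A : MSharp m n u v) (c : ℕ) : (words (truncCols A c)).1 =
    ((List.finRange (u + v)).filter fun b' => decide (b'.val < c)).flatMap (block A) := by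
  rw [words_fst, ← flatMap_ite]
  simp only [decide_eq_true_eq]
  congr 1; funext b'; exact block_truncCols A c b'

theorem wordsStar_truncCols (A : MSharp m n u v) (c : ℕ) : (wordsStar (truncCols A c)).2 =
    (wordsStar A).2.filter fun b' => decide (b'.val < c) := by
  rw [wordsStar_snd, wordsStar_snd, List.filter_flatMap]
  congr 1; funext b; exact block_transpose_truncCols A c b

/-- The matrix in which the rows from `c` on are replaced by zero. -/
def truncRows (A : MSharp m n u v) (c : ℕ) : MSharp m n u v :=
  (truncCols A.transpose c).transpose

theorem wordsStar_truncRows (A : MSharp m n u v) (c : ℕ) : (wordsStar (truncRows A c)).2 =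
    ((List.finRange (m + n)).reverse.filter fun b => decide (b.val < c)).flatMap
      (block A.transpose) := by
  rw [wordsStar_snd, ← flatMap_ite]
  simp only [decide_eq_true_eq]
  congr 1; funext b'; exact block_truncCols A.transpose c b'

theorem words_truncRows (A : MSharp m n u v) (c : ℕ) : (words (truncRows A c)).1 =
    (words A).1.filter fun b => decide (b.val < c) := by
  rw [words_fst, words_fst, List.filter_flatMap]
  congr 1; funext b'; exact block_transpose_truncCols A.transpose c b'

theorem filter_append_filter_not {N : ℕ} {L : List (Fin N)}
    (hL : L.Pairwise fun a b => a.val < b.val) (c : ℕ) :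
    L = (L.filter fun a => decide (a.val < c)) ++ L.filter fun a => decide (c ≤ a.val) := by
  induction L with
  | nil => rfl
  | cons a L ih =>
    rw [List.pairwise_cons] at hL
    by_cases h : a.val < c
    · rw [List.filter_cons_of_pos (by simpa using h), List.filter_cons_of_neg (by simpa using h),
        List.cons_append, ← ih hL.2]
    · have h1 : (a :: L).filter (fun a => decide (a.val < c)) = [] := by
        rw [List.filter_eq_nil_iff]
        intro x hx
        rcases List.mem_cons.1 hx with rfl | hx
        · simpa using h
        · have := hL.1 x hx
          simp; omega
      have h2 : (a :: L).filter (fun a => decide (c ≤ a.val)) = a :: L := by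
        rw [List.filter_eq_self]
        intro x hx
        rcases List.mem_cons.1 hx with rfl | hx
        · simpa using h
        · have := hL.1 x hx
          simp; omega
      rw [h1, h2]; rfl

/-- An operator changes a segment of a word by itself or not at all. -/
theorem wordF_segments {i : Idx m n} {β : Type*} {L1 L2 : List β} {g h : β → List (Letter m n)}
    (hl : ∀ b, (g b).length = (h b).length)
    (hF : wordF m n i ((L1 ++ L2).flatMap g) = some ((L1 ++ L2).flatMap h)) :
    (L1.flatMap g = L1.flatMap h ∨ wordF m n i (L1.flatMap g) = some (L1.flatMap h)) ∧
      (L2.flatMap g = L2.flatMap h ∨ wordF m n i (L2.flatMap g) = some (L2.flatMap h)) := by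
  rw [List.flatMap_append, List.flatMap_append] at hF
  have hlen : (L1.flatMap g).length = (L1.flatMap h).length := by
    simp only [List.length_flatMap, hl]
  rcases wordF_append hF with ⟨x, hx, he⟩ | ⟨y, hy, he⟩
  · obtain ⟨h1, h2⟩ := List.append_inj he (by rw [wordF_length hx, hlen])
    exact ⟨Or.inr (h1 ▸ hx), Or.inl h2.symm⟩
  · obtain ⟨h1, h2⟩ := List.append_inj he hlen.symm
    exact ⟨Or.inl h1.symm, Or.inr (h2 ▸ hy)⟩

theorem colLens_wordTab_wordF {i : Idx m n} {w w' : List (Letter m n)}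
    (h : w = w' ∨ wordF m n i w = some w') :
    colLens (wordTab (bumps m n) w) = colLens (wordTab (bumps m n) w') := by
  rcases h with rfl | h
  · rfl
  · exact (colLens_congr (wordF_wordTab_length h)).symm

theorem block_length_of_words_snd {A B : MSharp m n u v} (h : (words A).2 = (words B).2)
    (b' : Letter u v) : (block A b').length = (block B b').length := by
  rw [words_snd, words_snd] at h
  have h3 := congrArg (List.count b') h
  have key := fun C : MSharp m n u v => count_flatMap_replicate (List.nodup_finRange (u + v))
    (fun b' => (block C b').length) id Function.injective_id (List.mem_finRange b')
  simpa only [id] using (key A).symm.trans (h3.trans (key B))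

theorem block_length_of_wordsStar_fst {A B : MSharp m n u v}
    (h : (wordsStar A).1 = (wordsStar B).1) (b : Letter m n) :
    (block A.transpose b).length = (block B.transpose b).length := by
  rw [wordsStar_fst, wordsStar_fst] at h
  have h3 := congrArg (List.count b) h
  have key := fun C : MSharp m n u v =>
    count_flatMap_replicate (List.nodup_reverse.2 (List.nodup_finRange (m + n)))
    (fun b' => (block C.transpose b').length) id Function.injective_id
    (List.mem_reverse.2 (List.mem_finRange b))
  simpa only [id] using (key A).symm.trans (h3.trans (key B))

/-- The operators of `gl_{m|n}` do not change the second tableau of a matrix. -/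
theorem wordTab_wordsStar_of_wordF {i : Idx m n} {A B : MSharp m n u v}
    (h : wordF m n i (words A).1 = some (words B).1) (h' : (words A).2 = (words B).2) :
    wordTab (bumps u v) (wordsStar A).2 = wordTab (bumps u v) (wordsStar B).2 := by
  -- The restriction to letters below `c` is the second tableau of a truncated matrix. Its shape is
  -- conjugate to that of the tableau of an initial segment of `i`, on which the operator acts as
  -- itself or trivially.
  refine wordTab_eq_of_restrict fun c => ?_
  rw [← wordsStar_truncCols, ← wordsStar_truncCols]
  refine (conj_words (truncCols A c)).unique ?_
  have h1 := (conj_words (truncCols B c))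
  rw [words_truncCols] at h1 ⊢
  rw [words_fst, words_fst, filter_append_filter_not (pairwise_finRange (u + v)) c] at h
  rwa [colLens_wordTab_wordF (wordF_segments (block_length_of_words_snd h') h).1]

/-- The operators of `gl_{u|v}` do not change the first tableau of a matrix. -/
theorem wordTab_words_of_wordF {i : Idx u v} {A B : MSharp m n u v}
    (h : wordF u v i (wordsStar A).2 = some (wordsStar B).2)
    (h' : (wordsStar A).1 = (wordsStar B).1) :
    wordTab (bumps m n) (words A).1 = wordTab (bumps m n) (words B).1 := by
  -- The rows are listed in decreasing order, so here the rows below `c` form a final segment of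
  -- `l`.
  refine wordTab_eq_of_restrict fun c => ?_
  rw [← words_truncRows, ← words_truncRows]
  refine (conj_words (truncRows A c)).symm.unique ?_
  have h1 := (conj_words (truncRows B c)).symm
  rw [wordsStar_truncRows] at h1 ⊢
  rw [wordsStar_snd, wordsStar_snd, filter_append_filter_not (pairwise_finRange (m + n)) c,
    List.reverse_append] at h
  rw [List.filter_reverse] at h1 ⊢
  rwa [colLens_wordTab_wordF (wordF_segments (block_length_of_wordsStar_fst h') h).2]

end Invariance

end HookCrystal


namespace HookCrystal

/-! ### Reversing an insertion -/

section Reverse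

variable {α : Type*} {r : α → α → Bool}

/-- If the two exchanges of `o` had happened in different rows, one of the letters that bump `o`
would stand below `o` in the other column, against the column condition. -/
theorem colInsert_unique {b b' o : α} {C D : List α} (hC : IsCol r C) (hD : IsCol r D)
    (h : colInsert r b C = colInsert r b' D) (ho : (colInsert r b C).2 = some o) :
    C = D ∧ b = b' := by
  have ho' : (colInsert r b' D).2 = some o := h ▸ ho
  obtain ⟨X, Y, rfl, e, h1, h2⟩ := colInsert_some ho
  obtain ⟨X', Y', rfl, e', h1', h2'⟩ := colInsert_some ho'
  have he : X ++ b :: Y = X' ++ b' :: Y' := by rw [← e, ← e', h]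
  have key : ∀ {X Y X' Y' : List α} {b b' : α}, X ++ b :: Y = X' ++ b' :: Y' →
      X.length < X'.length → IsCol r (X ++ o :: Y) → r b' o = true → False := by
    intro X Y X' Y' b b' he hl hc hb
    rcases List.append_eq_append_iff.1 he with ⟨Z, rfl, hZ⟩ | ⟨Z, rfl, hZ⟩
    · cases Z with
      | nil => simp at hl
      | cons z Z =>
        simp only [List.cons_append, List.cons.injEq] at hZ
        have h3 := (List.pairwise_cons.1 (List.pairwise_append.1 hc).2.1).1 b' (by simp [hZ.2])
        rw [hb] at h3; cases h3
    · simp at hl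
  rcases lt_trichotomy X.length X'.length with hl | hl | hl
  · exact (key he hl hC h1').elim
  · obtain ⟨rfl, h3⟩ := List.append_inj he hl
    simp only [List.cons.injEq] at h3
    obtain ⟨rfl, rfl⟩ := h3
    exact ⟨rfl, rfl⟩
  · exact (key he.symm hl hD h1).elim

/-- Once the end column is known, the insertion can be undone column by column, from the end column
back to the first. -/
theorem tabInsert_unique {b b' : α} {T U : List (List α)} (hT : IsTab r T) (hU : IsTab r U)
    (h : tabInsert r b T = tabInsert r b' U) (he : endCol r b T = endCol r b' U) :
    T = U ∧ b = b' := by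
  induction T generalizing U b b' with
  | nil =>
    cases U with
    | nil =>
      simp only [tabInsert, List.cons.injEq, and_true] at h
      exact ⟨rfl, h⟩
    | cons D U =>
      cases ho : (colInsert r b' D).2 with
      | none =>
        rw [tabInsert_cons_none U ho, colInsert_fst_of_none ho] at h
        obtain ⟨d, D, rfl⟩ := List.exists_cons_of_ne_nil hU.1
        simp [tabInsert] at h
      | some o => rw [endCol_cons_some U ho] at he; simp [endCol] at he
  | cons C T ih =>
    cases U with
    | nil =>
      cases ho : (colInsert r b C).2 with
      | none =>
        rw [tabInsert_cons_none T ho, colInsert_fst_of_none ho] at h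
        obtain ⟨d, D, rfl⟩ := List.exists_cons_of_ne_nil hT.1
        simp [tabInsert] at h
      | some o => rw [endCol_cons_some T ho] at he; simp [endCol] at he
    | cons D U =>
      cases ho : (colInsert r b C).2 with
      | none =>
        cases ho' : (colInsert r b' D).2 with
        | none =>
          rw [tabInsert_cons_none T ho, colInsert_fst_of_none ho,
            tabInsert_cons_none U ho', colInsert_fst_of_none ho', List.cons.injEq] at h
          obtain ⟨h1, h2⟩ := List.append_inj' h.1 rfl
          exact ⟨by rw [h1, h.2], by simpa using h2⟩
        | some o' => rw [endCol_cons_none T ho, endCol_cons_some U ho'] at he; cases he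
      | some o =>
        cases ho' : (colInsert r b' D).2 with
        | none => rw [endCol_cons_some T ho, endCol_cons_none U ho'] at he; cases he
        | some o' =>
          rw [tabInsert_cons_some T ho, tabInsert_cons_some U ho', List.cons.injEq] at h
          rw [endCol_cons_some T ho, endCol_cons_some U ho', Nat.add_right_cancel_iff] at he
          obtain ⟨rfl, rfl⟩ := ih hT.tail hU.tail h.2 he
          obtain ⟨rfl, rfl⟩ := colInsert_unique hT.2.1 hU.2.1 (Prod.ext h.1 (by rw [ho, ho'])) ho
          exact ⟨rfl, rfl⟩

theorem RowOK.exists_left {C D : List α} (h : RowOK r C D) {d : α} (hd : d ∈ D) :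
    ∃ c ∈ C, r c d = true := by
  induction C generalizing D with
  | nil => cases D with
    | nil => simp at hd
    | cons d' D => exact h.elim
  | cons c C ih =>
    cases D with
    | nil => simp at hd
    | cons d' D =>
      rcases List.mem_cons.1 hd with rfl | hd
      · exact ⟨c, by simp, h.1⟩
      · obtain ⟨c', hc', h'⟩ := ih h.2 hd
        exact ⟨c', by simp [hc'], h'⟩

theorem RowOK.of_append {C D : List α} {b : α} (h : RowOK r (C ++ [b]) D)
    (hl : D.length ≤ C.length) : RowOK r C D := by
  induction C generalizing D with
  | nil =>
    have : D = [] := by simpa using hl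
    subst this; simp
  | cons c C ih =>
    cases D with
    | nil => simp
    | cons d D => exact ⟨h.1, ih h.2 (by simpa using hl)⟩

theorem RowOK.replace_of_forall {X Y D : List α} {b o : α} (h : RowOK r (X ++ b :: Y) D)
    (ho : ∀ d ∈ D, r o d = true) : RowOK r (X ++ o :: Y) D := by
  induction X generalizing D with
  | nil =>
    cases D with
    | nil => simp
    | cons d D => exact ⟨ho d (by simp), h.2⟩
  | cons x X ih =>
    cases D with
    | nil => simp
    | cons d D => exact ⟨h.1, ih h.2 fun d hd => ho d (by simp [hd])⟩

theorem mem_colInsert (b : α) (C : List α) : b ∈ (colInsert r b C).1 := by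
  induction C with
  | nil => simp [colInsert]
  | cons c C ih =>
    simp only [colInsert]
    split_ifs <;> simp [ih]

/-- Since no entry of `Y` bumps `o`, the letter `o` sits in the right column no lower than the row
of `b`. Hence exchanging `b` for `o` on the left restores the row condition with the column as it
was before `o` came in. -/
theorem RowOK.uninsert (hr : IsBump r) {X Y D : List α} {b o : α} (hD : IsCol r D)
    (h : RowOK r (X ++ b :: Y) (colInsert r o D).1) (hY : ∀ y ∈ Y, r y o = false) :
    RowOK r (X ++ o :: Y) D := by
  induction X generalizing D with
  | nil =>
    cases D with
    | nil => simp
    | cons d D =>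
      by_cases hd : r o d = true
      · simp only [colInsert, hd, if_true] at h
        exact ⟨hd, h.2⟩
      · simp only [colInsert, hd] at h
        obtain ⟨y, hy, h'⟩ := RowOK.exists_left h.2 (mem_colInsert o D)
        rw [hY y hy] at h'; cases h'
  | cons x X ih =>
    cases D with
    | nil => simp
    | cons d D =>
      by_cases hd : r o d = true
      · simp only [colInsert, hd, if_true] at h
        refine ⟨hr.trans _ _ _ h.1 hd, RowOK.replace_of_forall h.2 fun y hy => ?_⟩
        have h1 := (List.pairwise_cons.1 hD).1 y hy
        rcases hr.total o y with h2 | h2 | h2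
        · exact h2
        · rw [hr.trans _ _ _ h2 hd] at h1; cases h1
        · subst h2; rw [hd] at h1; cases h1
      · simp only [colInsert, hd] at h
        exact ⟨h.1, ih (List.pairwise_cons.1 hD).2 h.2⟩

/-- The entry to be exchanged for `o` is the lowest one that bumps `o`. The entries below do not
bump `o`, which keeps the column condition. -/
theorem exists_colInsert_eq (hr : IsBump r) {C : List α} {o : α} (hC : IsCol r C)
    (h : ∃ c ∈ C, r c o = true) :
    ∃ X Y b, C = X ++ b :: Y ∧ (∀ y ∈ Y, r y o = false) ∧ IsCol r (X ++ o :: Y) ∧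
      colInsert r b (X ++ o :: Y) = (C, some o) := by
  have hsplit : ∃ X Y b, C = X ++ b :: Y ∧ r b o = true ∧ ∀ y ∈ Y, r y o = false := by
    clear hC
    induction C with
    | nil => simp at h
    | cons c C ih =>
      by_cases h' : ∃ c ∈ C, r c o = true
      · obtain ⟨X, Y, b, rfl, h1, h2⟩ := ih h'
        exact ⟨c :: X, Y, b, rfl, h1, h2⟩
      · push Not at h'
        obtain ⟨d, hd, hdo⟩ := h
        rcases List.mem_cons.1 hd with rfl | hd
        · exact ⟨[], C, d, rfl, hdo, fun y hy => by simpa using h' y hy⟩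
        · exact absurd hdo (h' d hd)
  obtain ⟨X, Y, b, rfl, hbo, hY⟩ := hsplit
  rw [IsCol, List.pairwise_append, List.pairwise_cons] at hC
  obtain ⟨c1, ⟨c2, c3⟩, c4⟩ := hC
  have hX : ∀ x ∈ X, r b x = false := fun x hx => c4 x hx b (by simp)
  refine ⟨X, Y, b, rfl, hY, ?_, ?_⟩
  · rw [IsCol, List.pairwise_append, List.pairwise_cons]
    refine ⟨c1, ⟨hY, c3⟩, fun x hx y hy => ?_⟩
    rcases List.mem_cons.1 hy with rfl | hy
    · by_contra h1
      rw [Bool.not_eq_false] at h1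
      have h2 := hr.trans _ _ _ hbo h1
      rw [hX x hx] at h2; cases h2
    · exact c4 x hx y (by simp [hy])
  · rw [colInsert_append_of_not hX]
    simp [colInsert, hbo]

theorem headD_tabInsert (b : α) (T : List (List α)) :
    (tabInsert r b T).headD [] = (colInsert r b (T.headD [])).1 := by
  cases T with
  | nil => rfl
  | cons C T =>
    cases ho : (colInsert r b C).2 with
    | none => rw [tabInsert_cons_none T ho]; rfl
    | some o => rw [tabInsert_cons_some T ho]; rfl

theorem IsTab.isCol_headD {T : List (List α)} (h : IsTab r T) : IsCol r (T.headD []) := by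
  cases T with
  | nil => simp [IsCol]
  | cons C T => exact h.2.1

/-- Every corner of a tableau is the end of an insertion. -/
theorem exists_tabInsert_eq (hr : IsBump r) {T' : List (List α)} (hT' : IsTab r T') {e : ℕ}
    (he : colLens T' (e + 1) < colLens T' e) :
    ∃ T b, IsTab r T ∧ tabInsert r b T = T' ∧ endCol r b T = e := by
  induction e generalizing T' with
  | zero =>
    cases T' with
    | nil => simp at he
    | cons C' T2 =>
      rcases List.eq_nil_or_concat' C' with rfl | ⟨C, b, rfl⟩
      · exact absurd rfl hT'.1
      · simp only [colLens_cons_zero, colLens_cons_succ, List.length_append, List.length_singleton]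
          at he
        by_cases hC : C = []
        · subst hC
          have : T2.length ≤ 0 := (hT'.tail.colLens_eq_zero_iff 0).1 (by simpa using he)
          obtain rfl : T2 = [] := by simpa using this
          exact ⟨[], b, trivial, rfl, rfl⟩
        · have hcol := hT'.2.1
          rw [IsCol, List.pairwise_append] at hcol
          have ho : (colInsert r b C).2 = none :=
            colInsert_none_iff.2 fun c hc => hcol.2.2 c hc b (by simp)
          refine ⟨C :: T2, b, ⟨hC, hcol.1, RowOK.of_append hT'.2.2.1 ?_, hT'.tail⟩, ?_,
            endCol_cons_none T2 ho⟩
          · cases T2 <;> simp_all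
          · rw [tabInsert_cons_none T2 ho, colInsert_fst_of_none ho]
  | succ e ih =>
    cases T' with
    | nil => simp at he
    | cons C' T2 =>
      obtain ⟨T, o, hT, rfl, rfl⟩ := ih hT'.tail he
      have hrow := hT'.2.2.1
      rw [headD_tabInsert] at hrow
      obtain ⟨X, Y, b, rfl, hY, h1, h2⟩ :=
        exists_colInsert_eq hr hT'.2.1 (hrow.exists_left (mem_colInsert o _))
      refine ⟨(X ++ o :: Y) :: T, b, ⟨by simp, h1, RowOK.uninsert hr hT.isCol_headD hrow hY, hT⟩,
        ?_, ?_⟩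
      · rw [tabInsert_cons_some T (by rw [h2]), h2]
      · rw [endCol_cons_some T (by rw [h2])]

theorem colInsert_append_of_bump {b o : α} {X : List α} (h : (colInsert r b X).2 = some o)
    (E : List α) : (colInsert r b (X ++ E)).2 = some o := by
  induction X with
  | nil => simp [colInsert] at h
  | cons x X ih =>
    by_cases hx : r b x = true
    · simpa [colInsert, hx] using h
    · simp only [colInsert, hx] at h
      simpa [colInsert, hx] using ih h

/-- Two successive insertions: the second one ends strictly to the right of the first one if and
only if the second letter bumps the first one. -/
theorem endCol_lt_endCol_iff (hr : IsBump r) {T : List (List α)} (hT : IsTab r T) (x y : α) :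
    endCol r x T < endCol r y (tabInsert r x T) ↔ r y x = true := by
  induction T generalizing x y with
  | nil =>
    by_cases h : r y x = true
    · have : (colInsert r y [x]).2 = some x := by simp [colInsert, h]
      simp [endCol, tabInsert, h, this]
    · have : (colInsert r y [x]).2 = none := by simp [colInsert, h]
      simp [endCol, tabInsert, h, this]
  | cons C T ih =>
    cases ho : (colInsert r x C).2 with
    | none =>
      rw [endCol_cons_none T ho, tabInsert_cons_none T ho, colInsert_fst_of_none ho]
      rw [colInsert_none_iff] at ho
      cases hy : (colInsert r y (C ++ [x])).2 with
      | none =>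
        rw [endCol_cons_none T hy]
        have := (colInsert_none_iff.1 hy) x (by simp)
        simp [this]
      | some z =>
        rw [endCol_cons_some T hy]
        obtain ⟨X, Y, e, -, hyz, -⟩ := colInsert_some hy
        refine iff_of_true (Nat.succ_pos _) ?_
        have hz : z ∈ C ++ [x] := by rw [e]; simp
        rcases List.mem_append.1 hz with hz | hz
        · by_contra h
          have h1 := hr.left _ _ _ (by simpa using h) hyz
          rw [ho z hz] at h1; cases h1
        · rw [List.mem_singleton] at hz; rw [← hz]; exact hyz
    | some o =>
      rw [endCol_cons_some T ho, tabInsert_cons_some T ho]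
      obtain ⟨X, Y, rfl, e, hxo, hX⟩ := colInsert_some ho
      have hcol := hT.2.1
      rw [IsCol, List.pairwise_append, List.pairwise_cons] at hcol
      obtain ⟨c1, ⟨c2, c3⟩, c4⟩ := hcol
      cases hy : (colInsert r y (colInsert r x (X ++ o :: Y)).1).2 with
      | none =>
        rw [endCol_cons_none _ hy]
        have := (colInsert_none_iff.1 hy) x (mem_colInsert x _)
        simp [this]
      | some z =>
        -- Both letters bump in the first column, `x` sending out `o` and `y` sending out `z`. By
        -- induction it remains to see that `z` bumps `o` exactly if `y` bumps `x`.
        rw [endCol_cons_some _ hy, Nat.add_lt_add_iff_right, ih hT.tail]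
        rw [e] at hy
        by_cases h : r y x = true
        · refine iff_of_true ?_ h
          cases hz : (colInsert r y X).2 with
          | none =>
            have h1 := colInsert_append_of_not (E := x :: Y) (colInsert_none_iff.1 hz)
            rw [h1] at hy
            simp only [colInsert, h, if_true, Option.some.injEq] at hy
            rw [← hy]; exact hxo
          | some z' =>
            rw [colInsert_append_of_bump hz, Option.some.injEq] at hy
            subst hy
            obtain ⟨X1, X2, rfl, -⟩ := colInsert_some hz
            have h1 := c4 z' (by simp) o (by simp)
            have h2 := hX z' (by simp)
            rcases hr.total z' o with h3 | h3 | h3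
            · exact h3
            · rw [h1] at h3; cases h3
            · subst h3; rw [hxo] at h2; cases h2
        · refine iff_of_false ?_ h
          rw [Bool.not_eq_true] at h ⊢
          obtain ⟨X2, Y2, e2, -, hyz, -⟩ := colInsert_some hy
          have hz : z ∈ X ++ x :: Y := by rw [e2]; simp
          rcases List.mem_append.1 hz with hz | hz
          · have h1 := hr.left _ _ _ h hyz
            rw [hX z hz] at h1; cases h1
          · rcases List.mem_cons.1 hz with rfl | hz
            · rw [h] at hyz; cases hyz
            · exact c2 z hz

/-! ### Insertion of a word -/

/-- The end columns of the successive insertions of the letters of a word. -/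
def endCols (r : α → α → Bool) : List (List α) → List α → List ℕ
  | _, [] => []
  | T, b :: w => endCol r b T :: endCols r (tabInsert r b T) w

theorem endCols_append (T : List (List α)) (w w' : List α) :
    endCols r T (w ++ w') = endCols r T w ++ endCols r (tabFold r T w) w' := by
  induction w generalizing T with
  | nil => rfl
  | cons b w ih => simp only [List.cons_append, endCols, ih]; rfl

theorem colLens_tabFold (T : List (List α)) (w : List α) (j : ℕ) :
    colLens (tabFold r T w) j = colLens T j + (endCols r T w).count j := by
  induction w generalizing T with
  | nil => rfl
  | cons b w ih =>
    change colLens (tabFold r (tabInsert r b T) w) j = _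
    rw [ih, colLens_tabInsert, endCols, List.count_cons, addBox_apply]
    by_cases h : endCol r b T = j
    · simp [h]; omega
    · simp [h, Ne.symm h]

theorem isTab_tabFold (hr : IsBump r) {T : List (List α)} (hT : IsTab r T) (w : List α) :
    IsTab r (tabFold r T w) := by
  induction w generalizing T with
  | nil => exact hT
  | cons b w ih => exact ih (hT.insert hr b)

theorem tabFold_unique (hr : IsBump r) {T U : List (List α)} (hT : IsTab r T) (hU : IsTab r U)
    {w w' : List α} (h : tabFold r T w = tabFold r U w')
    (he : endCols r T w = endCols r U w') : T = U ∧ w = w' := by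
  induction w using List.reverseRecOn generalizing w' with
  | nil =>
    cases w' with
    | nil => exact ⟨h, rfl⟩
    | cons b w' => simp [endCols] at he
  | append_singleton w b ih =>
    rcases List.eq_nil_or_concat' w' with rfl | ⟨w', b', rfl⟩
    · rw [endCols_append] at he; simp [endCols] at he
    · rw [endCols_append, endCols_append] at he
      rw [tabFold_append, tabFold_append] at h
      obtain ⟨h1, h2⟩ := List.append_inj' he rfl
      obtain ⟨h3, rfl⟩ := tabInsert_unique (isTab_tabFold hr hT w) (isTab_tabFold hr hU w') h
        (by simpa [endCols] using h2)
      obtain ⟨rfl, rfl⟩ := ih h3 h1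
      exact ⟨rfl, rfl⟩

/-- A row word ends in strictly increasing columns, a column word in weakly decreasing ones, by
comparing consecutive letters. -/
theorem isChain_endCols (hr : IsBump r) {T : List (List α)} (hT : IsTab r T) (fl : Bool)
    (w : List α) : (endCols r T w).IsChain (fun a b => decide (a < b) = fl) ↔
      w.IsChain fun a b => r b a = fl := by
  induction w generalizing T with
  | nil => simp [endCols]
  | cons x w ih =>
    cases w with
    | nil => simp [endCols]
    | cons y w =>
      have h1 := ih (hT.insert hr x)
      have h2 := endCol_lt_endCol_iff hr hT x y
      simp only [endCols] at h1
      simp only [endCols, List.isChain_cons_cons, h1]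
      rw [show decide (endCol r x T < endCol r y (tabInsert r x T)) = r y x by
        rw [Bool.eq_iff_iff, decide_eq_true_eq, h2]]

/-- Removal of boxes: `Removable f es` says that the boxes in the columns `es` can be removed
from the shape `f`, starting from the end of the list. -/
def Removable (f : ℕ → ℕ) (es : List ℕ) : Prop :=
  ∀ es1 e es2, es = es1 ++ e :: es2 → f (e + 1) - es2.count (e + 1) < f e - es2.count e

theorem exists_tabFold_eq (hr : IsBump r) {T' : List (List α)} (hT' : IsTab r T') {es : List ℕ}
    (he : Removable (colLens T') es) :
    ∃ T w, IsTab r T ∧ tabFold r T w = T' ∧ endCols r T w = es := by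
  induction es using List.reverseRecOn generalizing T' with
  | nil => exact ⟨T', [], hT', rfl, rfl⟩
  | append_singleton es e ih =>
    obtain ⟨T1, b, h1, rfl, rfl⟩ := exists_tabInsert_eq hr hT' (e := e) (by
      simpa using he es e [] rfl)
    obtain ⟨T, w, h2, rfl, rfl⟩ := ih h1 (by
      intro es1 e' es2 h
      have h3 := he es1 e' (es2 ++ [endCol r b T1]) (by rw [h]; simp)
      rw [colLens_tabInsert] at h3
      simp only [addBox_apply, List.count_append, List.count_singleton] at h3
      simp only [beq_iff_eq] at h3
      split_ifs at h3 <;> omega)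
    refine ⟨T, w ++ [b], h2, by rw [tabFold_append]; rfl, by rw [endCols_append]; rfl⟩

end Reverse

end HookCrystal


namespace HookCrystal

/-! ### Strips -/

section Strips

variable {α : Type*} {r : α → α → Bool}

theorem isChain_iff_pairwise_lt (fl : Bool) {l : List ℕ} :
    l.IsChain (fun a b => decide (a < b) = fl) ↔ l.Pairwise fun a b => decide (a < b) = fl := by
  have : Trans (fun a b : ℕ => decide (a < b) = fl) (fun a b => decide (a < b) = fl)
      (fun a b => decide (a < b) = fl) := by
    refine ⟨fun {a b c} h1 h2 => ?_⟩
    cases fl <;> simp only [decide_eq_true_eq, decide_eq_false_iff_not] at h1 h2 ⊢ <;> omega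
  exact List.isChain_iff_pairwise

/-- The pairs of shapes that the insertion of a column word (`false`) or a row word (`true`)
connects. -/
def IsStrip (fl : Bool) (f f' : ℕ → ℕ) : Prop :=
  (∀ j, f j ≤ f' j) ∧ ∀ j, if fl = true then f' j ≤ f j + 1 else f' (j + 1) ≤ f j

/-- The end columns are monotone in the sense of `fl`, hence determined by their multiplicities,
which are the differences of the two shapes. With the end columns known, the insertions can be
undone. -/
theorem strip_unique (hr : IsBump r) {fl : Bool} {T U : List (List α)} (hT : IsTab r T)
    (hU : IsTab r U) {w w' : List α} (hw : w.IsChain fun a b => r b a = fl)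
    (hw' : w'.IsChain fun a b => r b a = fl) (h : tabFold r T w = tabFold r U w')
    (hl : colLens T = colLens U) : T = U ∧ w = w' := by
  refine tabFold_unique hr hT hU h ?_
  rw [← isChain_endCols hr hT, isChain_iff_pairwise_lt] at hw
  rw [← isChain_endCols hr hU, isChain_iff_pairwise_lt] at hw'
  refine List.Perm.eq_of_pairwise (le := fun a b => decide (a < b) = fl) ?_ hw hw' ?_
  · intro a b _ _ h1 h2
    cases fl <;> simp only [decide_eq_true_eq, decide_eq_false_iff_not] at h1 h2 <;> omega
  · rw [List.perm_iff_count]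
    intro j
    have h1 := colLens_tabFold (r := r) T w j
    rw [h, colLens_tabFold, hl] at h1
    omega

/-- A row word needs the columns in increasing order without repetition, a column word needs them in
decreasing order with repetitions allowed. -/
theorem exists_columns (fl : Bool) (k : ℕ → ℕ) (N : ℕ) (hk : ∀ j, N ≤ j → k j = 0)
    (hfl : fl = true → ∀ j, k j ≤ 1) : ∃ es : List ℕ,
      es.Pairwise (fun a b => decide (a < b) = fl) ∧ ∀ j, es.count j = k j := by
  have hcount : ∀ L : List ℕ, L.Nodup → (∀ j, j < N → j ∈ L) → ∀ j,
      (L.flatMap fun j => List.replicate (k j) j).count j = k j := by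
    intro L hL hmem j
    by_cases hj : j < N
    · exact count_flatMap_replicate hL k id Function.injective_id (hmem j hj)
    · rw [hk j (not_lt.1 hj), List.count_eq_zero]
      intro h
      obtain ⟨c, -, hc⟩ := List.mem_flatMap.1 h
      obtain rfl := List.eq_of_mem_replicate hc
      rw [hk j (not_lt.1 hj)] at hc
      simp at hc
  cases fl with
  | true =>
    refine ⟨_, ?_, hcount (List.range N) List.nodup_range fun j hj => List.mem_range.2 hj⟩
    rw [List.pairwise_flatMap]
    refine ⟨fun j _ => ?_, List.pairwise_lt_range.imp ?_⟩
    · rw [List.pairwise_replicate]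
      exact Or.inl (hfl rfl j)
    · intro a b h x hx y hy
      rw [List.eq_of_mem_replicate hx, List.eq_of_mem_replicate hy]
      simpa using h
  | false =>
    refine ⟨_, ?_, hcount (List.range N).reverse (List.nodup_reverse.2 List.nodup_range)
      fun j hj => List.mem_reverse.2 (List.mem_range.2 hj)⟩
    rw [List.pairwise_flatMap]
    refine ⟨fun j _ => ?_, List.pairwise_reverse.2 (List.pairwise_lt_range.imp ?_)⟩
    · rw [List.pairwise_replicate]
      exact Or.inr (by simp)
    · intro a b h x hx y hy
      rw [List.eq_of_mem_replicate hx, List.eq_of_mem_replicate hy]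
      simpa using h.le

/-- The boxes of the strip are listed in the monotone order and removed from the end of the list;
the strip condition makes each one a corner when its turn comes. -/
theorem strip_exists (hr : IsBump r) {fl : Bool} {T' : List (List α)} (hT' : IsTab r T')
    {f : ℕ → ℕ} (hf : Antitone f) (h : IsStrip fl f (colLens T')) :
    ∃ T w, IsTab r T ∧ colLens T = f ∧ tabFold r T w = T' ∧ w.IsChain fun a b => r b a = fl := by
  obtain ⟨h1, h2⟩ := h
  obtain ⟨es, hes, hc⟩ := exists_columns fl (fun j => colLens T' j - f j) T'.length
    (fun j hj => by simp [(hT'.colLens_eq_zero_iff j).2 hj])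
    (fun hfl j => by have := h2 j; rw [if_pos hfl] at this; omega)
  obtain ⟨T, w, hT, rfl, rfl⟩ := exists_tabFold_eq hr hT' (es := es) (by
    intro es1 e es2 he
    have hp := hes
    rw [he, List.pairwise_append, List.pairwise_cons] at hp
    obtain ⟨-, ⟨p1, -⟩, p2⟩ := hp
    have c1 := hc e
    have c2 := hc (e + 1)
    simp only [he, List.count_append, List.count_cons, beq_iff_eq, if_true] at c1 c2
    rw [if_neg (by omega)] at c2
    have g1 := h1 e
    have g2 := h1 (e + 1)
    have g3 := hf (Nat.le_succ e)
    have g4 := h2 e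
    -- For a row strip, a box in column `e + 1` can occur only later in the list, so it is removed
    -- before the box in column `e`. For a column strip, no box in column `e + 1` follows, and `f'
    -- (e + 1) ≤ f e` suffices.
    cases fl with
    | true =>
      have z1 : es1.count (e + 1) = 0 := by
        rw [List.count_eq_zero]
        intro hm
        have := p2 _ hm e (by simp)
        simp at this
      have z2 : es2.count e = 0 := by
        rw [List.count_eq_zero]
        intro hm
        have := p1 _ hm
        simp at this
      simp only [Nat.succ_eq_add_one] at g3
      omega
    | false =>
      have z1 : es2.count (e + 1) = 0 := by
        rw [List.count_eq_zero]
        intro hm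
        have := p1 _ hm
        simp at this
      simp only [Bool.false_eq_true, if_false] at g4
      omega)
  refine ⟨T, w, hT, ?_, rfl, ?_⟩
  · funext j
    have e1 := colLens_tabFold (r := r) T w j
    rw [hc] at e1
    have := h1 j
    omega
  · rw [← isChain_endCols hr hT, isChain_iff_pairwise_lt]; exact hes

theorem exists_conj {S : ℕ → ℕ} (hS : Antitone S) {N : ℕ} (hN : S N = 0) : ∃ f, Conj f S := by
  refine ⟨(diagramOfCols S N hS).rowLen, fun i j => ?_⟩
  rw [← YoungDiagram.mem_iff_lt_rowLen, mem_diagramOfCols hN]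

theorem Conj.le {f f' S S' : ℕ → ℕ} (h : Conj f S) (h' : Conj f' S') (hS : ∀ j, S j ≤ S' j)
    (j : ℕ) : f j ≤ f' j := by
  by_contra hlt
  have h1 := (h (f' j) j).1 (by omega)
  have h2 := (h' (f' j) j).2 (h1.trans_le (hS _))
  omega

/-- Conjugation exchanges strips with at most one box per column and strips with at most one box per
row. -/
theorem Conj.isStrip {fl : Bool} {f f' S S' : ℕ → ℕ} (h : Conj f S) (h' : Conj f' S')
    (hS : ∀ j, S j ≤ S' j) (hs : ∀ k, if fl = true then S' (k + 1) ≤ S k else S' k ≤ S k + 1) :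
    IsStrip fl f f' := by
  refine ⟨h.le h' hS, fun j => ?_⟩
  cases fl with
  | true =>
    simp only [if_true] at hs ⊢
    by_contra hlt
    have h1 := (h' (f j + 1) j).1 (by omega)
    have h2 := (h (f j) j).2 (h1.trans_le (hs _))
    omega
  | false =>
    simp only [Bool.false_eq_true, if_false] at hs ⊢
    by_contra hlt
    have h1 := (h' (f j) (j + 1)).1 (by omega)
    have h2 := (h (f j) j).2 (by have := hs (f j); omega)
    omega

end Strips

/-! ### The correspondence is a bijection -/

section Bijection

variable {m n u v : ℕ}

/-- The column lengths of the part of a tableau with entries less than `c`. -/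
def restrictLens (U : List (List (Letter m n))) (c : ℕ) : ℕ → ℕ :=
  colLens (U.map (List.filter fun b => decide (b.val < c)))

theorem restrictLens_cons_zero (C : List (Letter m n)) (U : List (List (Letter m n))) (c : ℕ) :
    restrictLens (C :: U) c 0 = (C.filter fun b => decide (b.val < c)).length := rfl

theorem length_filter_succ (C : List (Letter m n)) (c : ℕ) (hc : c < m + n) :
    (C.filter fun b => decide (b.val < c + 1)).length =
      C.count (⟨c, hc⟩ : Letter m n) + (C.filter fun b => decide (b.val < c)).length :=
  (count_eq_length_filter C ⟨c, hc⟩).symm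

theorem restrictLens_mono (U : List (List (Letter m n))) {c : ℕ} (hc : c < m + n) (j : ℕ) :
    restrictLens U c j ≤ restrictLens U (c + 1) j := by
  induction U generalizing j with
  | nil => exact le_rfl
  | cons C U ih =>
    cases j with
    | zero => rw [restrictLens_cons_zero, restrictLens_cons_zero, length_filter_succ C c hc]; omega
    | succ j => exact ih j

theorem IsCol.count_le {C : List (Letter m n)} (h : IsCol (bumps m n) C) {b : Letter m n}
    (hb : b.val < m) : C.count b ≤ 1 := by
  by_contra hc
  have h1 : List.Sublist (List.replicate 2 b) C := List.replicate_sublist_iff.2 (by omega)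
  have h2 := List.Pairwise.sublist h1 h
  rw [List.pairwise_replicate, bumps_eq_false] at h2
  omega

/-- A barred letter occurs at most once in a column. -/
theorem IsTab.restrictLens_succ_le {U : List (List (Letter m n))} (hU : IsTab (bumps m n) U)
    {c : ℕ} (hc : c < m + n) (hcm : c < m) (j : ℕ) :
    restrictLens U (c + 1) j ≤ restrictLens U c j + 1 := by
  induction U generalizing j with
  | nil => exact Nat.zero_le _
  | cons C U ih =>
    cases j with
    | zero =>
      rw [restrictLens_cons_zero, restrictLens_cons_zero, length_filter_succ C c hc]
      have := hU.2.1.count_le (b := ⟨c, hc⟩) hcm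
      omega
    | succ j => exact ih hU.tail j

/-- For an unbarred letter `c`, the left neighbour of an entry at most `c` is less than `c`, since
unbarred letters increase strictly along rows. -/
theorem RowOK.length_filter_le {C D : List (Letter m n)} (h : RowOK (bumps m n) C D) {c : ℕ}
    (hcm : m ≤ c) : (D.filter fun b => decide (b.val < c + 1)).length ≤
      (C.filter fun b => decide (b.val < c)).length := by
  induction C generalizing D with
  | nil => cases D with
    | nil => rfl
    | cons d D => exact h.elim
  | cons a C ih =>
    cases D with
    | nil => exact Nat.zero_le _
    | cons d D =>
      have h1 := ih h.2
      have h2 := bumps_iff.1 h.1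
      rw [List.filter_cons, List.filter_cons]
      by_cases hd : d.val < c + 1
      · rw [if_pos (by simpa using hd), if_pos (by simp only [decide_eq_true_eq]; omega)]
        simpa using h1
      · rw [if_neg (by simpa using hd)]
        split_ifs
        · exact h1.trans (Nat.le_succ _)
        · exact h1

theorem IsTab.restrictLens_succ_succ_le {U : List (List (Letter m n))}
    (hU : IsTab (bumps m n) U) {c : ℕ} (hcm : m ≤ c) (j : ℕ) :
    restrictLens U (c + 1) (j + 1) ≤ restrictLens U c j := by
  induction U generalizing j with
  | nil => exact Nat.zero_le _
  | cons C U ih =>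
    cases j with
    | zero =>
      cases U with
      | nil => exact Nat.zero_le _
      | cons D U => exact hU.2.2.1.length_filter_le hcm
    | succ j => exact ih hU.tail j

/-- The restriction of a tableau is a tableau, being the insertion tableau of the restricted
reading; so its column lengths form a partition. -/
theorem IsTab.exists_conj_restrictLens {U : List (List (Letter m n))} (hU : IsTab (bumps m n) U)
    (c : ℕ) : ∃ f, Conj f (restrictLens U c) := by
  have h1 := restrictTab_wordTab (isBump_bumps (m := m) (n := n)) (isLower_lt c) (columnReading U)
  rw [wordTab_columnReading hU] at h1
  have h2 := isTab_wordTab (isBump_bumps (m := m) (n := n))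
    ((columnReading U).filter fun b => decide (b.val < c))
  rw [← h1] at h2
  have h3 : restrictLens U c = colLens (restrictTab (fun b => decide (b.val < c)) U) :=
    funext fun j => (colLens_restrictTab (isLower_lt c) hU j).symm
  rw [h3]
  exact exists_conj h2.antitone ((h2.colLens_eq_zero_iff _).2 le_rfl)

/-- The letters in positions less than `c`. -/
def initialLetters (u v c : ℕ) : List (Letter u v) :=
  (List.finRange (u + v)).filter fun b' => decide (b'.val < c)

theorem initialLetters_succ {c : ℕ} (hc : c < u + v) :
    initialLetters u v (c + 1) = initialLetters u v c ++ [⟨c, hc⟩] := by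
  have h1 : ∀ c, (initialLetters u v c).Pairwise fun a b => a.val < b.val := fun c =>
    (pairwise_finRange (u + v)).filter _
  have h2 : (initialLetters u v c ++ [(⟨c, hc⟩ : Letter u v)]).Pairwise fun a b => a.val < b.val := by
    rw [List.pairwise_append]
    refine ⟨h1 c, List.pairwise_singleton _ _, fun a ha b hb => ?_⟩
    rw [List.mem_singleton] at hb
    subst hb
    simpa [initialLetters] using ha
  have h3 : ∀ L : List (Letter u v), L.Pairwise (fun a b => a.val < b.val) → L.Nodup :=
    fun L h => h.imp fun h => by rintro rfl; exact lt_irrefl _ h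
  refine List.Perm.eq_of_pairwise (le := fun a b : Letter u v => a.val < b.val) ?_ (h1 _) h2 ?_
  · intro a b _ _ h h'; omega
  · rw [List.perm_ext_iff_of_nodup (h3 _ (h1 _)) (h3 _ h2)]
    intro a
    simp only [initialLetters, List.mem_filter, List.mem_finRange, true_and, decide_eq_true_eq,
      List.mem_append, List.mem_singleton, Fin.ext_iff]
    omega

theorem initialLetters_self : initialLetters u v (u + v) = List.finRange (u + v) :=
  List.filter_eq_self.2 fun b _ => by simp

theorem initialLetters_zero : initialLetters u v 0 = [] :=
  List.filter_eq_nil_iff.2 fun b _ => by simp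

theorem notMem_initialLetters {c k : ℕ} (hc : c < u + v) (hk : k ≤ c) :
    (⟨c, hc⟩ : Letter u v) ∉ initialLetters u v k := by
  simp only [initialLetters, List.mem_filter, decide_eq_true_eq, not_and]
  omega

theorem wordTab_initialLetters_succ {c : ℕ} (hc : c < u + v)
    (g : Letter u v → List (Letter m n)) :
    wordTab (bumps m n) ((initialLetters u v (c + 1)).flatMap g) =
      tabFold (bumps m n) (wordTab (bumps m n) ((initialLetters u v c).flatMap g)) (g ⟨c, hc⟩) := by
  rw [initialLetters_succ hc, List.flatMap_append, wordTab_eq_tabFold, tabFold_append]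
  simp [wordTab_eq_tabFold]

/-- The symmetry of shapes for the matrix truncated at `c`: the tableau `P(l)` is the transposed
recording tableau for the insertion of the blocks of `i`. -/
theorem conj_restrictLens (A : MSharp m n u v) (c : ℕ) :
    Conj (colLens (wordTab (bumps m n) ((initialLetters u v c).flatMap (block A))))
      (restrictLens (wordTab (bumps u v) (wordsStar A).2) c) := by
  have h := conj_words (truncCols A c)
  rw [words_truncCols, wordsStar_truncCols, ← restrictTab_wordTab isBump_bumps (isLower_lt c)] at h
  have h1 : restrictLens (wordTab (bumps u v) (wordsStar A).2) c =
      colLens (restrictTab (fun b => decide (b.val < c)) (wordTab (bumps u v) (wordsStar A).2)) :=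
    funext fun j => (colLens_restrictTab (isLower_lt c) (isTab_wordTab isBump_bumps _) j).symm
  rw [h1]; exact h

theorem isBlock_iff_isChain {b' : Letter u v} {w : List (Letter m n)} : IsBlock m n b' w ↔
    w.IsChain fun a b => bumps m n b a = decide (u ≤ b'.val) :=
  (isChain_iff_pairwise_bumps _).symm

/-- A matrix is determined by its two tableaux. -/
theorem matrix_ext {A B : MSharp m n u v}
    (h : wordTab (bumps m n) (words A).1 = wordTab (bumps m n) (words B).1)
    (h' : wordTab (bumps u v) (wordsStar A).2 = wordTab (bumps u v) (wordsStar B).2) : A = B := by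
  have key : ∀ c ≤ u + v,
      wordTab (bumps m n) ((initialLetters u v c).flatMap (block A)) =
        wordTab (bumps m n) ((initialLetters u v c).flatMap (block B)) →
      ∀ b' : Letter u v, b'.val < c → block A b' = block B b' := by
    intro c
    induction c with
    | zero => intro _ _ b' hb'; omega
    | succ c ih =>
      intro hc he b' hb'
      rw [wordTab_initialLetters_succ hc, wordTab_initialLetters_succ hc] at he
      -- Before the block of letter `c`, both tableaux have the shape conjugate to the same
      -- restriction of the second tableau. So the last block adds the same strip, and its insertion
      -- can be undone uniquely.
      have h1 := (conj_restrictLens A c).symm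
      have h2 := (conj_restrictLens B c).symm
      rw [h'] at h1
      obtain ⟨h3, h4⟩ := strip_unique isBump_bumps (isTab_wordTab isBump_bumps _)
        (isTab_wordTab isBump_bumps _) (isBlock_iff_isChain.1 (isBlock_block A ⟨c, hc⟩))
        (isBlock_iff_isChain.1 (isBlock_block B ⟨c, hc⟩)) he (h1.unique h2)
      rcases Nat.lt_succ_iff_lt_or_eq.1 hb' with hb | hb
      · exact ih (by omega) h3 b' hb
      · have : b' = ⟨c, hc⟩ := Fin.ext hb
        rw [this]; exact h4
  refine MSharp.ext_block fun b' => key (u + v) le_rfl ?_ b' b'.2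
  rwa [initialLetters_self, ← words_fst, ← words_fst]

/-- Every pair of tableaux of conjugate shapes comes from a matrix. -/
theorem exists_matrix {T : List (List (Letter m n))} {U : List (List (Letter u v))}
    (hT : IsTab (bumps m n) T) (hU : IsTab (bumps u v) U) (h : Conj (colLens T) (colLens U)) :
    ∃ A : MSharp m n u v, wordTab (bumps m n) (words A).1 = T ∧
      wordTab (bumps u v) (wordsStar A).2 = U := by
  have key : ∀ c ≤ u + v, ∀ T : List (List (Letter m n)), IsTab (bumps m n) T →
      Conj (colLens T) (restrictLens U c) →
      ∃ g : Letter u v → List (Letter m n), (∀ b', IsBlock m n b' (g b')) ∧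
        wordTab (bumps m n) ((initialLetters u v c).flatMap g) = T ∧
        ∀ k ≤ c, Conj (colLens (wordTab (bumps m n) ((initialLetters u v k).flatMap g)))
          (restrictLens U k) := by
    intro c
    induction c with
    | zero =>
      intro _ T hT hc
      have hz : ∀ j, restrictLens U 0 j = 0 := by
        intro j
        clear h hc hU
        induction U generalizing j with
        | nil => rfl
        | cons C U ih =>
          cases j with
          | zero => rw [restrictLens_cons_zero]; simp
          | succ j => exact ih j
      have hT0 : T = [] := by
        have h1 : colLens T 0 = 0 := by
          by_contra hne
          have := (hc 0 0).1 (by omega)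
          rw [hz] at this; omega
        simpa using (hT.colLens_eq_zero_iff 0).1 h1
      subst hT0
      refine ⟨fun _ => [], fun _ => List.Pairwise.nil, by rw [initialLetters_zero]; rfl,
        fun k hk => ?_⟩
      obtain rfl : k = 0 := by omega
      rw [initialLetters_zero]; exact hc
    | succ c ih =>
      intro hc T hT hconj
      -- The shape `f` is the one that has to be left when the block of letter `c` is taken out of
      -- `T`. The entries `c` of `U` form a strip, whose conjugate is a strip of the kind that such
      -- a block adds.
      obtain ⟨f, hf⟩ := hU.exists_conj_restrictLens c
      have hstrip : IsStrip (decide (u ≤ c)) f (colLens T) := by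
        refine hf.isStrip hconj (restrictLens_mono U hc) fun k => ?_
        by_cases hcu : u ≤ c
        · rw [if_pos (by simpa using hcu)]
          exact hU.restrictLens_succ_succ_le hcu k
        · rw [if_neg (by simpa using hcu)]
          exact hU.restrictLens_succ_le hc (by omega) k
      obtain ⟨T0, w, hT0, rfl, rfl, hw⟩ := strip_exists isBump_bumps hT hf.antitone hstrip
      obtain ⟨g, hg, rfl, hgk⟩ := ih (by omega) T0 hT0 hf
      have hpre : ∀ k ≤ c, (initialLetters u v k).flatMap (Function.update g ⟨c, hc⟩ w) =
          (initialLetters u v k).flatMap g := fun k hk =>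
        flatMap_update_of_notMem (notMem_initialLetters hc hk) g w
      have hlast : wordTab (bumps m n)
          ((initialLetters u v (c + 1)).flatMap (Function.update g ⟨c, hc⟩ w)) =
          tabFold (bumps m n) (wordTab (bumps m n) ((initialLetters u v c).flatMap g)) w := by
        rw [wordTab_initialLetters_succ hc, hpre c le_rfl, Function.update_self]
      refine ⟨Function.update g ⟨c, hc⟩ w, fun b' => ?_, hlast, fun k hk => ?_⟩
      · by_cases hb : b' = ⟨c, hc⟩
        · subst hb; rw [Function.update_self]; exact isBlock_iff_isChain.2 hw
        · rw [Function.update_of_ne hb]; exact hg b'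
      · rcases Nat.le_succ_iff.1 hk with hk | rfl
        · rw [hpre k hk]; exact hgk k hk
        · rw [hlast]; exact hconj
  have hfull : restrictLens U (u + v) = colLens U := by
    have : U.map (List.filter fun b => decide (b.val < u + v)) = U := by
      have : (List.filter fun b : Letter u v => decide (b.val < u + v)) = id := by
        funext C; exact List.filter_eq_self.2 fun b _ => by simp
      rw [this, List.map_id]
    rw [restrictLens, this]
  obtain ⟨g, hg, h1, h2⟩ := key (u + v) le_rfl T hT (by rw [hfull]; exact h)
  have hblock : block (matrixOf g hg) = g := funext (block_matrixOf hg)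
  refine ⟨matrixOf g hg, ?_, ?_⟩
  · rw [words_fst, hblock, ← initialLetters_self, h1]
  · refine eq_of_filter_lengths (isTab_wordTab isBump_bumps _) hU fun c j => ?_
    have h3 : ∀ c ≤ u + v, restrictLens (wordTab (bumps u v) (wordsStar (matrixOf g hg)).2) c =
        restrictLens U c := by
      intro c hc
      have h3 := conj_restrictLens (matrixOf g hg) c
      rw [hblock] at h3
      exact h3.unique (h2 c hc)
    by_cases hc : c ≤ u + v
    · exact congrFun (h3 c hc) j
    · have h4 : (fun b : Letter u v => decide (b.val < c)) = fun b => decide (b.val < u + v) := by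
        funext b
        have := b.2
        rw [Bool.eq_iff_iff, decide_eq_true_eq, decide_eq_true_eq]; omega
      rw [h4]
      exact congrFun (h3 _ le_rfl) j

end Bijection

end HookCrystal


namespace HookCrystal

/-! ### The isomorphism of bicrystals -/

section General

variable {m n : ℕ}

theorem isCrystal_directSum {ι : Type*} {B : ι → Type*} {C : ∀ k, CrystalData m n (B k)}
    (hC : ∀ k, (C k).IsCrystal) : (CrystalData.directSum C).IsCrystal where
  string i p h := (hC p.1).string i p.2 h
  odd_nonneg i p h := (hC p.1).odd_nonneg i p.2 h
  odd_string i p h := (hC p.1).odd_string i p.2 h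
  e_ε i p q h := by
    obtain ⟨b, hb, rfl⟩ := Option.map_eq_some_iff.1 h
    exact (hC p.1).e_ε i p.2 b hb
  e_φ i p q h := by
    obtain ⟨b, hb, rfl⟩ := Option.map_eq_some_iff.1 h
    exact (hC p.1).e_φ i p.2 b hb
  e_wt i p q h := by
    obtain ⟨b, hb, rfl⟩ := Option.map_eq_some_iff.1 h
    exact (hC p.1).e_wt i p.2 b hb
  f_ε i p q h := by
    obtain ⟨b, hb, rfl⟩ := Option.map_eq_some_iff.1 h
    exact (hC p.1).f_ε i p.2 b hb
  f_φ i p q h := by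
    obtain ⟨b, hb, rfl⟩ := Option.map_eq_some_iff.1 h
    exact (hC p.1).f_φ i p.2 b hb
  f_wt i p q h := by
    obtain ⟨b, hb, rfl⟩ := Option.map_eq_some_iff.1 h
    exact (hC p.1).f_wt i p.2 b hb
  f_iff_e i p q := by
    simp only [CrystalData.directSum, Option.map_eq_some_iff]
    constructor
    · rintro ⟨b, hb, rfl⟩; exact ⟨p.2, ((hC p.1).f_iff_e i _ _).1 hb, rfl⟩
    · rintro ⟨b, hb, rfl⟩; exact ⟨q.2, ((hC q.1).f_iff_e i _ _).2 hb, rfl⟩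

/-- In a crystal `e_i` is the partial inverse of `f_i`, so the arrows need to be checked for `f_i`
only. -/
theorem isCrystalIso_of_f {X Y : Type*} {C : CrystalData m n X} {D : CrystalData m n Y}
    (hC : C.IsCrystal) (hD : D.IsCrystal) (Φ : X ≃ Y) (hwt : ∀ x, D.wt (Φ x) = C.wt x)
    (hε : ∀ i x, D.ε i (Φ x) = C.ε i x) (hφ : ∀ i x, D.φ i (Φ x) = C.φ i x)
    (hf : ∀ i x y, D.f i (Φ x) = some (Φ y) ↔ C.f i x = some y) : IsCrystalIso C D Φ where
  wt := hwt
  ε := hε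
  φ := hφ
  e i x := by
    ext y
    obtain ⟨y, rfl⟩ := Φ.surjective y
    rw [← hD.f_iff_e, hf, hC.f_iff_e, Option.map_eq_some_iff]
    simp
  f i x := by
    ext y
    obtain ⟨y, rfl⟩ := Φ.surjective y
    rw [hf, Option.map_eq_some_iff]
    simp

/-- Partial maps commute if their images under an injective intertwiner do. This transports the
evident commutation on pairs of tableaux to matrices. -/
theorem bind_comm_of_injective {X Y : Type*} {Φ : X → Y} (hΦ : Function.Injective Φ)
    {p q : X → Option X} {p' q' : Y → Option Y} (hp : ∀ x, p' (Φ x) = (p x).map Φ)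
    (hq : ∀ x, q' (Φ x) = (q x).map Φ) (h : ∀ y, (p' y).bind q' = (q' y).bind p') (x : X) :
    (p x).bind q = (q x).bind p := by
  apply Option.map_injective hΦ
  have h1 := h (Φ x)
  rw [hp, hq, Option.bind_map, Option.bind_map] at h1
  rw [Option.map_bind, Option.map_bind]
  have e1 : q' ∘ Φ = Option.map Φ ∘ q := funext hq
  have e2 : p' ∘ Φ = Option.map Φ ∘ p := funext hp
  rw [e1, e2] at h1
  exact h1

end General

section Iso

variable {m n u v : ℕ}

theorem conj_colLen_rowLen (lam : YoungDiagram) : Conj lam.colLen lam.rowLen := fun i j => by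
  rw [← YoungDiagram.mem_iff_lt_colLen, ← YoungDiagram.mem_iff_lt_rowLen]

theorem transpose_mem_hookPartitions {lam : YoungDiagram} :
    lam.transpose ∈ hookPartitions u v ↔ lam ∈ hookPartitions v u := by
  change lam.transpose.rowLen u ≤ v ↔ lam.rowLen v ≤ u
  rw [YoungDiagram.rowLen_transpose]
  have := conj_colLen_rowLen lam v u
  omega

/-- Each tableau forces its own hook condition, and the shapes are conjugate, so the common shape
satisfies both conditions. -/
theorem exists_pair (A : MSharp m n u v) : ∃ x : TableauPairs m n u v,
    x.2.1.1 = wordTab (bumps m n) (words A).1 ∧ x.2.2.1 = wordTab (bumps u v) (wordsStar A).2 := by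
  have hT := isTab_wordTab (isBump_bumps (m := m) (n := n)) (words A).1
  have hU := isTab_wordTab (isBump_bumps (m := u) (n := v)) (wordsStar A).2
  obtain ⟨lam, hlam⟩ := hT.exists_shape
  have h1 : ∀ j, colLens (wordTab (bumps u v) (wordsStar A).2) j = lam.transpose.colLen j := by
    have h2 := conj_words A
    have h3 := conj_colLen_rowLen lam
    rw [funext hlam] at h3
    intro j
    rw [YoungDiagram.colLen_transpose, h3.unique h2]
  exact ⟨⟨⟨lam, mem_hookPartitions_of_isTab hT fun j => (hlam j).symm,
    transpose_mem_hookPartitions.1 (mem_hookPartitions_of_isTab hU h1)⟩,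
    ⟨_, mem_hookTableaux_iff.2 ⟨hT, fun j => (hlam j).symm⟩⟩,
    ⟨_, mem_hookTableaux_iff.2 ⟨hU, h1⟩⟩⟩, rfl, rfl⟩

/-- The pair of insertion tableaux of a matrix. -/
noncomputable def toPair (A : MSharp m n u v) : TableauPairs m n u v := (exists_pair A).choose

theorem toPair_fst (A : MSharp m n u v) :
    (toPair A).2.1.1 = wordTab (bumps m n) (words A).1 := (exists_pair A).choose_spec.1

theorem toPair_snd (A : MSharp m n u v) :
    (toPair A).2.2.1 = wordTab (bumps u v) (wordsStar A).2 := (exists_pair A).choose_spec.2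

theorem pair_ext {x y : TableauPairs m n u v} (h1 : x.2.1.1 = y.2.1.1)
    (h2 : x.2.2.1 = y.2.2.1) : x = y := by
  obtain ⟨⟨lam, hl⟩, ⟨T, hT⟩, ⟨U, hU⟩⟩ := x
  obtain ⟨⟨mu, hm⟩, ⟨T', hT'⟩, ⟨U', hU'⟩⟩ := y
  simp only at h1 h2
  subst h1 h2
  have : lam = mu := diagram_ext fun j => by
    rw [← (mem_hookTableaux_iff.1 hT).2, ← (mem_hookTableaux_iff.1 hT').2]
  subst this
  rfl

theorem toPair_bijective : Function.Bijective (toPair (m := m) (n := n) (u := u) (v := v)) := by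
  constructor
  · intro A B h
    refine matrix_ext ?_ ?_
    · rw [← toPair_fst, ← toPair_fst, h]
    · rw [← toPair_snd, ← toPair_snd, h]
  · intro x
    obtain ⟨hT, hT'⟩ := mem_hookTableaux_iff.1 x.2.1.2
    obtain ⟨hU, hU'⟩ := mem_hookTableaux_iff.1 x.2.2.2
    obtain ⟨A, h1, h2⟩ := exists_matrix hT hU (by
      intro i j
      rw [hT', hU', YoungDiagram.colLen_transpose]
      exact conj_colLen_rowLen _ i j)
    exact ⟨A, pair_ext (by rw [toPair_fst, h1]) (by rw [toPair_snd, h2])⟩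

/-- The map `π♯` as a bijection onto the pairs of tableaux. -/
noncomputable def pairEquiv (m n u v : ℕ) : MSharp m n u v ≃ TableauPairs m n u v :=
  Equiv.ofBijective toPair toPair_bijective

theorem pairEquiv_apply (A : MSharp m n u v) : pairEquiv m n u v A = toPair A := rfl

theorem matrixCrystal_f {i : Idx m n} {A B : MSharp m n u v} :
    (matrixCrystal m n u v).f i A = some B ↔
      wordF m n i (words A).1 = some (words B).1 ∧ (words A).2 = (words B).2 := by
  rw [matrixCrystal, pullback_f words_injective]
  simp only [biwordCrystal, CrystalData.onFst, wordCrystal, Option.map_eq_some_iff, Prod.ext_iff]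
  constructor
  · rintro ⟨w, hw, rfl, h⟩; exact ⟨hw, h⟩
  · rintro ⟨hw, h⟩; exact ⟨_, hw, rfl, h⟩

theorem matrixStarCrystal_f {i : Idx u v} {A B : MSharp m n u v} :
    (matrixStarCrystal m n u v).f i A = some B ↔
      wordF u v i (wordsStar A).2 = some (wordsStar B).2 ∧ (wordsStar A).1 = (wordsStar B).1 := by
  rw [matrixStarCrystal, pullback_f wordsStar_injective]
  simp only [biwordStarCrystal, CrystalData.onSnd, wordCrystal, Option.map_eq_some_iff,
    Prod.ext_iff]
  constructor
  · rintro ⟨w, hw, h, rfl⟩; exact ⟨hw, h⟩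
  · rintro ⟨hw, h⟩; exact ⟨_, hw, h, rfl⟩

/-- The shape need not be mentioned, since equal second tableaux already force equal shapes. -/
theorem pairsCrystal_f {i : Idx m n} {x y : TableauPairs m n u v} :
    (pairsCrystal m n u v).f i x = some y ↔
      wordF m n i (columnReading x.2.1.1) = some (columnReading y.2.1.1) ∧
        x.2.2.1 = y.2.2.1 := by
  simp only [pairsCrystal, CrystalData.directSum, CrystalData.onFst, Option.map_eq_some_iff]
  constructor
  · rintro ⟨_, ⟨T, hT, rfl⟩, rfl⟩
    exact ⟨(pullback_f (tableauWord_injective _)).1 hT, rfl⟩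
  · rintro ⟨h1, h2⟩
    obtain ⟨⟨lam, hl⟩, T, U⟩ := x
    obtain ⟨⟨mu, hm⟩, T', U'⟩ := y
    have : lam = mu := by
      have h3 : lam.transpose = mu.transpose := diagram_ext fun j => by
        rw [← (mem_hookTableaux_iff.1 U.2).2, ← (mem_hookTableaux_iff.1 U'.2).2]
        exact congrFun (congrArg colLens h2) j
      rw [← lam.transpose_transpose, h3, mu.transpose_transpose]
    subst this
    obtain rfl : U = U' := Subtype.ext h2
    exact ⟨(T', U), ⟨T', (pullback_f (tableauWord_injective _)).2 h1, rfl⟩, rfl⟩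

theorem pairsStarCrystal_f {i : Idx u v} {x y : TableauPairs m n u v} :
    (pairsStarCrystal m n u v).f i x = some y ↔
      wordF u v i (columnReading x.2.2.1) = some (columnReading y.2.2.1) ∧
        x.2.1.1 = y.2.1.1 := by
  simp only [pairsStarCrystal, CrystalData.directSum, CrystalData.onSnd, Option.map_eq_some_iff]
  constructor
  · rintro ⟨_, ⟨T, hT, rfl⟩, rfl⟩
    exact ⟨(pullback_f (tableauWord_injective _)).1 hT, rfl⟩
  · rintro ⟨h1, h2⟩
    obtain ⟨⟨lam, hl⟩, T, U⟩ := x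
    obtain ⟨⟨mu, hm⟩, T', U'⟩ := y
    have : lam = mu := diagram_ext fun j => by
      rw [← (mem_hookTableaux_iff.1 T.2).2, ← (mem_hookTableaux_iff.1 T'.2).2]
      exact congrFun (congrArg colLens h2) j
    subst this
    obtain rfl : T = T' := Subtype.ext h2
    exact ⟨(T, U'), ⟨U', (pullback_f (tableauWord_injective _)).2 h1, rfl⟩, rfl⟩

theorem isCrystal_matrixCrystal : (matrixCrystal m n u v).IsCrystal :=
  isSubcrystal_words.isCrystal

theorem isCrystal_matrixStarCrystal : (matrixStarCrystal m n u v).IsCrystal :=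
  isSubcrystal_wordsStar.isCrystal

theorem isCrystal_pairsCrystal : (pairsCrystal m n u v).IsCrystal :=
  isCrystal_directSum fun _ => isCrystal_onFst (isSubcrystal_tableauWord _).isCrystal _

theorem isCrystal_pairsStarCrystal : (pairsStarCrystal m n u v).IsCrystal :=
  isCrystal_directSum fun _ => isCrystal_onSnd (isSubcrystal_tableauWord _).isCrystal _

/-- An arrow between matrices gives one between pairs, because insertion commutes with `f_i` and the
second tableau does not change. Conversely, an arrow between pairs shows that `f_i` is defined on
the word of `A`; the resulting matrix has the same pair as `B`, hence equals `B` by injectivity. -/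
theorem isCrystalIso_pairEquiv :
    IsCrystalIso (matrixCrystal m n u v) (pairsCrystal m n u v) (pairEquiv m n u v) := by
  have hcol : ∀ A : MSharp m n u v,
      columnReading (toPair A).2.1.1 = normalForm m n (words A).1 := fun A => by
    rw [toPair_fst]; rfl
  have hmap : ∀ i (A B : MSharp m n u v), (matrixCrystal m n u v).f i A = some B →
      (pairsCrystal m n u v).f i (toPair A) = some (toPair B) := by
    intro i A B h
    rw [matrixCrystal_f] at h
    rw [pairsCrystal_f, hcol, hcol, wordF_normalForm, h.1, toPair_snd, toPair_snd]
    exact ⟨rfl, wordTab_wordsStar_of_wordF h.1 h.2⟩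
  refine isCrystalIso_of_f isCrystal_matrixCrystal isCrystal_pairsCrystal _ ?_ ?_ ?_ ?_
  · intro A
    change wordWt m n (columnReading (toPair A).2.1.1) = wordWt m n (words A).1
    rw [hcol, wordWt_normalForm]
  · intro i A
    change wordε m n i (columnReading (toPair A).2.1.1) = wordε m n i (words A).1
    rw [hcol, wordε_normalForm]
  · intro i A
    change wordφ m n i (columnReading (toPair A).2.1.1) = wordφ m n i (words A).1
    rw [hcol, wordφ_normalForm]
  · intro i A B
    refine ⟨fun h => ?_, hmap i A B⟩
    rw [pairEquiv_apply, pairEquiv_apply] at h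
    have h1 := (pairsCrystal_f.1 h).1
    rw [hcol, wordF_normalForm] at h1
    obtain ⟨w, hw, -⟩ := Option.map_eq_some_iff.1 h1
    rw [words_fst] at hw
    obtain ⟨B', h2, h3⟩ := wordF_block (List.nodup_finRange _) hw
    have h4 : (matrixCrystal m n u v).f i A = some B' := by
      rw [matrixCrystal_f, words_eq_of h2 h3, words_fst]; exact ⟨hw, rfl⟩
    have h5 := hmap i A B' h4
    rw [h, Option.some.injEq] at h5
    rw [h4, toPair_bijective.1 h5]

theorem isCrystalIso_star_pairEquiv :
    IsCrystalIso (matrixStarCrystal m n u v) (pairsStarCrystal m n u v) (pairEquiv m n u v) := by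
  have hcol : ∀ A : MSharp m n u v,
      columnReading (toPair A).2.2.1 = normalForm u v (wordsStar A).2 := fun A => by
    rw [toPair_snd]; rfl
  have hmap : ∀ i (A B : MSharp m n u v), (matrixStarCrystal m n u v).f i A = some B →
      (pairsStarCrystal m n u v).f i (toPair A) = some (toPair B) := by
    intro i A B h
    rw [matrixStarCrystal_f] at h
    rw [pairsStarCrystal_f, hcol, hcol, wordF_normalForm, h.1, toPair_fst, toPair_fst]
    exact ⟨rfl, wordTab_words_of_wordF h.1 h.2⟩
  refine isCrystalIso_of_f isCrystal_matrixStarCrystal isCrystal_pairsStarCrystal _ ?_ ?_ ?_ ?_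
  · intro A
    change wordWt u v (columnReading (toPair A).2.2.1) = wordWt u v (wordsStar A).2
    rw [hcol, wordWt_normalForm]
  · intro i A
    change wordε u v i (columnReading (toPair A).2.2.1) = wordε u v i (wordsStar A).2
    rw [hcol, wordε_normalForm]
  · intro i A
    change wordφ u v i (columnReading (toPair A).2.2.1) = wordφ u v i (wordsStar A).2
    rw [hcol, wordφ_normalForm]
  · intro i A B
    refine ⟨fun h => ?_, hmap i A B⟩
    rw [pairEquiv_apply, pairEquiv_apply] at h
    have h1 := (pairsStarCrystal_f.1 h).1
    rw [hcol, wordF_normalForm] at h1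
    obtain ⟨w, hw, -⟩ := Option.map_eq_some_iff.1 h1
    rw [wordsStar_snd] at hw
    obtain ⟨B', h2, h3⟩ := wordF_block (List.nodup_reverse.2 (List.nodup_finRange _)) hw
    have h4 : (matrixStarCrystal m n u v).f i A = some B'.transpose := by
      rw [matrixStarCrystal_f, wordsStar_eq_of h2 h3, wordsStar_snd]; exact ⟨hw, rfl⟩
    have h5 := hmap i A B'.transpose h4
    rw [h, Option.some.injEq] at h5
    rw [h4, toPair_bijective.1 h5]

theorem bind_comm_pairs {ι : Type*} {X Y : ι → Type*} (p : ∀ k, X k → Option (X k))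
    (q : ∀ k, Y k → Option (Y k)) (z : Σ k, X k × Y k) :
    let P : (Σ k, X k × Y k) → Option (Σ k, X k × Y k) := fun z =>
      ((p z.1 z.2.1).map fun x => (x, z.2.2)).map fun w => ⟨z.1, w⟩
    let Q : (Σ k, X k × Y k) → Option (Σ k, X k × Y k) := fun z =>
      ((q z.1 z.2.2).map fun y => (z.2.1, y)).map fun w => ⟨z.1, w⟩
    (P z).bind Q = (Q z).bind P := by
  obtain ⟨k, x, y⟩ := z
  intro P Q
  cases hx : p k x <;> cases hy : q k y <;> simp [P, Q, hx, hy]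

/-- On pairs of tableaux the two families act on different factors. -/
theorem isBicrystal_matrix :
    IsBicrystal (matrixCrystal m n u v) (matrixStarCrystal m n u v) where
  left := isCrystal_matrixCrystal
  right := isCrystal_matrixStarCrystal
  e_e i j := bind_comm_of_injective toPair_bijective.1 (isCrystalIso_pairEquiv.e i)
    (isCrystalIso_star_pairEquiv.e j) fun z => bind_comm_pairs
      (fun lam : CommonPartition m n u v => (tableauCrystal m n lam.1).e i)
      (fun lam : CommonPartition m n u v => (tableauCrystal u v lam.1.transpose).e j) z
  e_f i j := bind_comm_of_injective toPair_bijective.1 (isCrystalIso_pairEquiv.e i)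
    (isCrystalIso_star_pairEquiv.f j) fun z => bind_comm_pairs
      (fun lam : CommonPartition m n u v => (tableauCrystal m n lam.1).e i)
      (fun lam : CommonPartition m n u v => (tableauCrystal u v lam.1.transpose).f j) z
  f_e i j := bind_comm_of_injective toPair_bijective.1 (isCrystalIso_pairEquiv.f i)
    (isCrystalIso_star_pairEquiv.e j) fun z => bind_comm_pairs
      (fun lam : CommonPartition m n u v => (tableauCrystal m n lam.1).f i)
      (fun lam : CommonPartition m n u v => (tableauCrystal u v lam.1.transpose).e j) z
  f_f i j := bind_comm_of_injective toPair_bijective.1 (isCrystalIso_pairEquiv.f i)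
    (isCrystalIso_star_pairEquiv.f j) fun z => bind_comm_pairs
      (fun lam : CommonPartition m n u v => (tableauCrystal m n lam.1).f i)
      (fun lam : CommonPartition m n u v => (tableauCrystal u v lam.1.transpose).f j) z

theorem pairEquiv_eq_piSharp (A : MSharp m n u v) :
    (((pairEquiv m n u v A).2.1 : List (List (Letter m n))),
      ((pairEquiv m n u v A).2.2 : List (List (Letter u v)))) = piSharp A := by
  rw [pairEquiv_apply, piSharp, insertionTableau_eq, insertionTableau_eq, ← toPair_fst,
    ← toPair_snd]

end Iso

end HookCrystal


namespace HookCrystal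

/-! ### Tableaux with constant diagonals of letters, on the natural numbers -/

section NatWords

variable {u : ℕ}

/-- The bumping relation on positions. -/
def natBumps (u : ℕ) (a c : ℕ) : Bool := decide (a < c ∨ a = c ∧ a < u)

theorem natBumps_iff {a c : ℕ} : natBumps u a c = true ↔ a < c ∨ a = c ∧ a < u := by
  simp [natBumps]

theorem natBumps_eq_false {a c : ℕ} : natBumps u a c = false ↔ ¬ (a < c ∨ a = c ∧ a < u) := by
  simp [natBumps]

/-- The column `t` of height `h` of a highest weight tableau. -/
def highestColumn (u t h : ℕ) : List ℕ := List.range (min u h) ++ List.replicate (h - u) (u + t)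

/-- The columns from `t` on of a highest weight tableau with given column lengths. -/
def highestColumns (u : ℕ) : ℕ → List ℕ → List (List ℕ)
  | _, [] => []
  | t, h :: hs => if h = 0 then [] else highestColumn u t h :: highestColumns u (t + 1) hs

/-- The letters `u + t` for the columns longer than `u`, from right to left. -/
def longLetters (u : ℕ) : ℕ → List ℕ → List ℕ
  | _, [] => []
  | t, h :: hs => longLetters u (t + 1) hs ++ if u < h then [u + t] else []

/-- The letters `h - 1` for the columns of length `0 < h ≤ u`. -/
def shortLetters (u : ℕ) (hs : List ℕ) : List ℕ :=
  (hs.filter fun h => decide (0 < h ∧ h ≤ u)).map fun h => h - 1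

/-- The row word which adds one box at the end of each column. -/
def rowWord (u t : ℕ) (hs : List ℕ) : List ℕ := longLetters u t hs ++ shortLetters u hs

theorem colPass_append {α : Type*} {r : α → α → Bool} (w w' C : List α) :
    colPass r (w ++ w') C = ((colPass r w' (colPass r w C).1).1,
      (colPass r w C).2 ++ (colPass r w' (colPass r w C).1).2) := by
  induction w generalizing C with
  | nil => rfl
  | cons b w ih => simp only [List.cons_append, colPass, ih, List.append_assoc]

/-- The first letter goes to the bottom of the column, and each further letter replaces the one
before it there. Only the last letter stays. -/
theorem colPass_rowWord {α : Type*} {r : α → α → Bool} {w C : List α} {x : α}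
    (hw : (w ++ [x]).IsChain fun a b => r b a = true) (hC : ∀ a ∈ w ++ [x], ∀ c ∈ C, r a c = false) :
    colPass r (w ++ [x]) C = (C ++ [x], w) := by
  have key : ∀ (w : List α) (y : α), (y :: (w ++ [x])).IsChain (fun a b => r b a = true) →
      (∀ a ∈ w ++ [x], ∀ c ∈ C, r a c = false) →
      colPass r (w ++ [x]) (C ++ [y]) = (C ++ [x], y :: w) := by
    intro w
    induction w with
    | nil =>
      intro y hy hC
      have h1 : r x y = true := by simpa using hy
      rw [List.nil_append, colPass, colInsert_append_of_not (hC x (by simp))]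
      simp [colInsert, h1, colPass]
    | cons z w ih =>
      intro y hy hC
      rw [List.cons_append, List.isChain_cons_cons] at hy
      rw [List.cons_append, colPass, colInsert_append_of_not (hC z (by simp))]
      have h1 := ih z hy.2 fun a ha => hC a (by simp at ha ⊢; tauto)
      simp [colInsert, hy.1, h1]
  cases w with
  | nil =>
    rw [List.nil_append, colPass]
    have := colInsert_append_of_not (E := []) (hC x (by simp))
    rw [List.append_nil] at this
    rw [this]
    simp [colInsert, colPass]
  | cons y w =>
    rw [List.cons_append, colPass]
    have := colInsert_append_of_not (E := []) (hC y (by simp))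
    rw [List.append_nil] at this
    rw [this]
    simp [colInsert, key w y hw fun a ha => hC a (by simp at ha ⊢; tauto)]

/-- A barred letter that is already in the column replaces its own copy, so it passes on unchanged.
-/
theorem colInsert_range {b k : ℕ} {E : List ℕ} (hb : b < k) (hk : k ≤ u) :
    colInsert (natBumps u) b (List.range k ++ E) = (List.range k ++ E, some b) := by
  have h1 : List.range k = List.range b ++ b :: (List.range (k - b - 1)).map (b + 1 + ·) := by
    have : k = b + (1 + (k - b - 1)) := by omega
    conv_lhs => rw [this, List.range_add, List.range_add]
    simp [Function.comp_def, add_assoc]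
  rw [h1, List.append_assoc, colInsert_append_of_not]
  · have : natBumps u b b = true := natBumps_iff.2 (by omega)
    simp [colInsert, this]
  · intro x hx
    rw [List.mem_range] at hx
    rw [natBumps_eq_false]; omega

theorem colPass_range {w : List ℕ} {k : ℕ} {E : List ℕ} (hw : ∀ b ∈ w, b < k) (hk : k ≤ u) :
    colPass (natBumps u) w (List.range k ++ E) = (List.range k ++ E, w) := by
  induction w with
  | nil => rfl
  | cons b w ih =>
    rw [colPass, colInsert_range (hw b (by simp)) hk]
    simp [ih fun b hb => hw b (by simp [hb])]

theorem longLetters_eq_nil {t : ℕ} {hs : List ℕ} (h : ∀ x ∈ hs, x ≤ u) :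
    longLetters u t hs = [] := by
  induction hs generalizing t with
  | nil => rfl
  | cons a hs ih =>
    have := h a (by simp)
    simp only [longLetters, ih fun x hx => h x (by simp [hx])]
    rw [if_neg (by omega)]; rfl

theorem lt_of_mem_longLetters {t x : ℕ} {hs : List ℕ} (h : x ∈ longLetters u t hs) :
    u + t ≤ x := by
  induction hs generalizing t with
  | nil => simp [longLetters] at h
  | cons a hs ih =>
    rw [longLetters, List.mem_append] at h
    rcases h with h | h
    · have := ih h; omega
    · split_ifs at h <;> simp at h; omega

theorem pairwise_longLetters (t : ℕ) (hs : List ℕ) :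
    (longLetters u t hs).Pairwise fun a b => b < a := by
  induction hs generalizing t with
  | nil => exact List.Pairwise.nil
  | cons a hs ih =>
    rw [longLetters, List.pairwise_append]
    refine ⟨ih _, by split_ifs <;> simp, fun x hx y hy => ?_⟩
    have := lt_of_mem_longLetters hx
    split_ifs at hy <;> simp at hy
    omega

/-- If `u < h`, the long letters replace one another at the bottom and leave `u + t` there, and the
short letters pass through the barred part unchanged. If `h ≤ u`, there are no long letters, the
first short letter `h - 1` is appended, and the others pass through. -/
theorem colPass_highestColumn {t h : ℕ} {hs : List ℕ} (hh : 0 < h) (hhs : ∀ x ∈ hs, x ≤ h) :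
    colPass (natBumps u) (rowWord u t (h :: hs)) (highestColumn u t (h - 1)) =
      (highestColumn u t h, rowWord u (t + 1) hs) := by
  by_cases hu : u < h
  · have e1 : rowWord u t (h :: hs) =
        (longLetters u (t + 1) hs ++ [u + t]) ++ shortLetters u hs := by
      rw [rowWord, longLetters, if_pos hu]
      simp [shortLetters, hu]
    have e2 : ∀ k, u ≤ k → highestColumn u t k =
        List.range u ++ List.replicate (k - u) (u + t) := by
      intro k hk; rw [highestColumn, min_eq_left hk]
    rw [e1, colPass_append, colPass_rowWord, e2 _ (by omega), e2 _ hu.le]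
    · have e3 : List.range u ++ List.replicate (h - 1 - u) (u + t) ++ [u + t] =
          List.range u ++ List.replicate (h - u) (u + t) := by
        rw [List.append_assoc, ← List.replicate_succ']
        congr 2; omega
      simp only [e3]
      rw [colPass_range _ le_rfl]
      · rfl
      · intro b hb
        simp only [shortLetters, List.mem_map, List.mem_filter, decide_eq_true_eq] at hb
        obtain ⟨x, ⟨-, hx⟩, rfl⟩ := hb
        omega
    · refine List.Pairwise.isChain ?_
      rw [List.pairwise_append]
      refine ⟨(pairwise_longLetters _ _).imp fun hab => natBumps_iff.2 (Or.inl hab),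
        List.pairwise_singleton _ _, fun x hx y hy => ?_⟩
      have := lt_of_mem_longLetters hx
      rw [List.mem_singleton] at hy
      rw [natBumps_iff]; omega
    · intro a ha c hc
      have ha' : u + t ≤ a := by
        rcases List.mem_append.1 ha with ha | ha
        · have := lt_of_mem_longLetters ha; omega
        · rw [List.mem_singleton] at ha; omega
      have hc' : c ≤ u + t := by
        rcases List.mem_append.1 hc with hc | hc
        · rw [List.mem_range] at hc; omega
        · rw [List.eq_of_mem_replicate hc]
      rw [natBumps_eq_false]; omega
  · have e1 : rowWord u t (h :: hs) = (h - 1) :: shortLetters u hs := by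
      rw [rowWord, longLetters_eq_nil (by
        intro x hx
        rcases List.mem_cons.1 hx with rfl | hx
        · omega
        · have := hhs x hx; omega)]
      have : (0 < h ∧ h ≤ u) := ⟨hh, by omega⟩
      simp [shortLetters, this]
    have e2 : rowWord u (t + 1) hs = shortLetters u hs := by
      rw [rowWord, longLetters_eq_nil fun x hx => by have := hhs x hx; omega]; rfl
    have e3 : ∀ k, k ≤ u → highestColumn u t k = List.range k := by
      intro k hk
      rw [highestColumn, min_eq_right hk, Nat.sub_eq_zero_of_le hk]; simp
    rw [e1, e2, e3 _ (by omega), e3 _ (by omega), colPass]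
    have h1 := colInsert_append_of_not (r := natBumps u) (b := h - 1) (X := List.range (h - 1))
      (E := []) (by
        intro x hx
        rw [List.mem_range] at hx
        rw [natBumps_eq_false]; omega)
    rw [List.append_nil] at h1
    have h2 : List.range (h - 1) ++ [h - 1] = List.range h := by
      rw [← List.range_succ]; congr 1; omega
    have h3 := colPass_range (u := u) (w := shortLetters u hs) (k := h) (E := []) (by
      intro b hb
      simp only [shortLetters, List.mem_map, List.mem_filter, decide_eq_true_eq] at hb
      obtain ⟨x, ⟨hx, hx'⟩, rfl⟩ := hb
      have := hhs x hx
      omega) (by omega)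
    rw [List.append_nil] at h3
    rw [h1]
    simp only [colInsert, h2, h3]
    rfl

theorem highestColumns_eq_nil {t : ℕ} {hs : List ℕ} (h : ∀ x ∈ hs, x = 0) :
    highestColumns u t hs = [] := by
  cases hs with
  | nil => rfl
  | cons a hs => rw [highestColumns, if_pos (h a (by simp))]

theorem rowWord_eq_nil {t : ℕ} {hs : List ℕ} (h : ∀ x ∈ hs, x = 0) : rowWord u t hs = [] := by
  rw [rowWord, longLetters_eq_nil fun x hx => by rw [h x hx]; exact Nat.zero_le _]
  simp only [shortLetters, List.nil_append, List.map_eq_nil_iff, List.filter_eq_nil_iff]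
  intro x hx
  simp [h x hx]

theorem rowWord_ne_nil {t h : ℕ} {hs : List ℕ} (hh : 0 < h) : rowWord u t (h :: hs) ≠ [] := by
  by_cases hu : u < h
  · rw [rowWord, longLetters, if_pos hu]; simp
  · have : (0 < h ∧ h ≤ u) := ⟨hh, by omega⟩
    simp [rowWord, shortLetters, this]

theorem tabFold_rowWord {t : ℕ} {hs : List ℕ} (hhs : hs.Pairwise fun a b => b ≤ a) :
    tabFold (natBumps u) (highestColumns u t (hs.map fun h => h - 1)) (rowWord u t hs) =
      highestColumns u t hs := by
  induction hs generalizing t with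
  | nil => rfl
  | cons h hs ih =>
    rw [List.pairwise_cons] at hhs
    obtain ⟨h1, h2⟩ := hhs
    by_cases hh : h = 0
    · have h3 : ∀ x ∈ h :: hs, x = 0 := by
        intro x hx
        rcases List.mem_cons.1 hx with rfl | hx
        · exact hh
        · have := h1 x hx; omega
      rw [rowWord_eq_nil h3, highestColumns_eq_nil h3, highestColumns_eq_nil]
      · rfl
      · intro x hx
        obtain ⟨y, hy, rfl⟩ := List.mem_map.1 hx
        simp [h3 y hy]
    · have hpos : 0 < h := Nat.pos_of_ne_zero hh
      have h3 := colPass_highestColumn (u := u) (t := t) hpos h1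
      rw [highestColumns, if_neg hh, ← ih h2]
      -- A column of height one does not exist before the insertion, and the old tableau is empty,
      -- so `tabFold_cons` is not available.
      by_cases hone : h = 1
      · have h4 : ∀ x ∈ hs.map fun h => h - 1, x = 0 := by
          intro x hx
          obtain ⟨y, hy, rfl⟩ := List.mem_map.1 hx
          have := h1 y hy
          omega
        rw [highestColumns_eq_nil (t := t + 1) h4, List.map_cons, highestColumns, if_pos (by omega)]
        have h5 : highestColumn u t (h - 1) = [] := by subst hone; simp [highestColumn]
        rw [h5] at h3
        have h6 := wordTab_of_ne_nil (r := natBumps u) (rowWord_ne_nil (t := t) (hs := hs) (u := u) hpos)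
        rw [h3] at h6
        exact h6
      · rw [List.map_cons, highestColumns, if_neg (by omega), tabFold_cons, h3]

theorem length_highestColumn (t h : ℕ) : (highestColumn u t h).length = h := by
  simp only [highestColumn, List.length_append, List.length_range, List.length_replicate]
  omega

theorem isCol_highestColumn (t h : ℕ) : IsCol (natBumps u) (highestColumn u t h) := by
  rw [IsCol, highestColumn, List.pairwise_append]
  refine ⟨List.pairwise_lt_range.imp fun hab => natBumps_eq_false.2 (by omega), ?_, ?_⟩
  · rw [List.pairwise_replicate]; right; rw [natBumps_eq_false]; omega
  · intro a ha b hb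
    rw [List.mem_range] at ha
    rw [List.eq_of_mem_replicate hb, natBumps_eq_false]; omega

theorem getElem?_highestColumn {t h i : ℕ} (hi : i < h) :
    (highestColumn u t h)[i]? = some (if i < u then i else u + t) := by
  rw [highestColumn]
  by_cases hu : i < u
  · rw [List.getElem?_append_left (by simp; omega), if_pos hu, List.getElem?_range (by omega)]
  · rw [List.getElem?_append_right (by simp; omega), if_neg hu, List.getElem?_replicate,
      if_pos (by simp; omega)]

theorem rowOK_highestColumn {t h h' : ℕ} (hh : h' ≤ h) :
    RowOK (natBumps u) (highestColumn u t h) (highestColumn u (t + 1) h') := by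
  refine rowOK_of_getElem (by rw [length_highestColumn, length_highestColumn]; exact hh) ?_
  intro i c d hc hd
  have hi : i < h' := by
    have := (List.getElem?_eq_some_iff.1 hd).1
    rwa [length_highestColumn] at this
  rw [getElem?_highestColumn hi] at hd
  rw [getElem?_highestColumn (hi.trans_le hh)] at hc
  simp only [Option.some.injEq] at hc hd
  rw [natBumps_iff]
  split_ifs at hc hd <;> omega

theorem isTab_highestColumns {t : ℕ} {hs : List ℕ} (hhs : hs.Pairwise fun a b => b ≤ a) :
    IsTab (natBumps u) (highestColumns u t hs) := by
  induction hs generalizing t with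
  | nil => trivial
  | cons h hs ih =>
    rw [List.pairwise_cons] at hhs
    rw [highestColumns]
    split_ifs with hh
    · trivial
    · refine ⟨?_, isCol_highestColumn t h, ?_, ih hhs.2⟩
      · intro h0
        have := length_highestColumn (u := u) t h
        rw [h0] at this
        exact hh this.symm
      · cases hs with
        | nil => simp [highestColumns]
        | cons h' hs =>
          rw [highestColumns]
          split_ifs
          · simp
          · exact rowOK_highestColumn (hhs.1 h' (by simp))

theorem tabFold_highestColumn {t h : ℕ} {hs : List ℕ}
    (hhs : (h :: hs).Pairwise fun a b => b ≤ a) :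
    tabFold (natBumps u) (highestColumns u (t + 1) hs) (highestColumn u t h) =
      highestColumns u t (h :: hs) := by
  have h1 := isTab_highestColumns (u := u) (t := t) hhs
  rw [highestColumns] at h1 ⊢
  split_ifs at h1 ⊢ with hh
  · subst hh
    rw [List.pairwise_cons] at hhs
    rw [highestColumns_eq_nil fun x hx => Nat.le_zero.1 (hhs.1 x hx)]
    simp [highestColumn, tabFold]
  · exact tabFold_column h1

/-- The column lengths `g t, g (t + 1), …`. -/
def heights (g : ℕ → ℕ) (N t : ℕ) : List ℕ := (List.range N).map fun i => g (t + i)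

theorem pairwise_heights {g : ℕ → ℕ} (hg : Antitone g) (N t : ℕ) :
    (heights g N t).Pairwise fun a b => b ≤ a := by
  rw [heights, List.pairwise_map]
  exact List.pairwise_lt_range.imp fun hab => hg (by omega)

theorem heights_succ (g : ℕ → ℕ) (N t : ℕ) :
    heights g (N + 1) t = g t :: heights g N (t + 1) := by
  simp only [heights, List.range_succ_eq_map, List.map_cons, List.map_map, Nat.add_zero]
  congr 1
  apply List.map_congr_left
  intro i _
  simp only [Function.comp]
  congr 1; omega

/-- The word for `s` raises the heights from `g i - (s + 1)` to `g i - s`; by truncation it affects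
only the columns with `s < g i`. -/
theorem tabFold_rowWords {g : ℕ → ℕ} (hg : Antitone g) (N t n : ℕ) :
    tabFold (natBumps u) (highestColumns u t (heights (fun i => g i - n) N t))
      ((List.range n).reverse.flatMap fun s => rowWord u t (heights (fun i => g i - s) N t)) =
      highestColumns u t (heights g N t) := by
  induction n with
  | zero => rfl
  | succ n ih =>
    rw [List.range_succ, List.reverse_append, List.reverse_singleton, List.singleton_append,
      List.flatMap_cons, tabFold_append]
    have h1 : heights (fun i => g i - (n + 1)) N t =
        (heights (fun i => g i - n) N t).map fun h => h - 1 := by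
      simp only [heights, List.map_map]
      rfl
    rw [h1, tabFold_rowWord, ih]
    exact pairwise_heights (fun a b hab => Nat.sub_le_sub_right (hg hab) n) N t

theorem tabFold_highestColumn_words {g : ℕ → ℕ} (hg : Antitone g) (N m : ℕ) :
    tabFold (natBumps u) (highestColumns u m (heights g N m))
      ((List.range m).reverse.flatMap fun k => highestColumn u k (g k)) =
      highestColumns u 0 (heights g (N + m) 0) := by
  induction m generalizing N with
  | zero => rfl
  | succ m ih =>
    rw [List.range_succ, List.reverse_append, List.reverse_singleton, List.singleton_append,
      List.flatMap_cons, tabFold_append]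
    have h1 := pairwise_heights hg (N + 1) m
    rw [heights_succ] at h1
    rw [tabFold_highestColumn h1, ← heights_succ, ih]
    congr 2; omega

/-- Since `g m ≤ n`, the row words start from the empty tableau and build the columns from `m` on.
The column words then put the columns `m - 1, …, 0` in front, each pushing the others to the right.
-/
theorem wordTab_rowWords {g : ℕ → ℕ} (hg : Antitone g) (N m n : ℕ) (hn : g m ≤ n) :
    wordTab (natBumps u)
      (((List.range n).reverse.flatMap fun s => rowWord u m (heights (fun i => g i - s) N m)) ++
        (List.range m).reverse.flatMap fun k => highestColumn u k (g k)) =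
      highestColumns u 0 (heights g (N + m) 0) := by
  have h1 : highestColumns u m (heights (fun i => g i - n) N m) = [] := by
    apply highestColumns_eq_nil
    intro x hx
    obtain ⟨i, -, rfl⟩ := List.mem_map.1 hx
    have := hg (Nat.le_add_right m i)
    change g (m + i) - n = 0
    omega
  have h2 := tabFold_rowWords (u := u) hg N m n
  rw [h1] at h2
  rw [wordTab_eq_tabFold, tabFold_append, h2, tabFold_highestColumn_words hg]

end NatWords

end HookCrystal


namespace HookCrystal

/-! ### The highest weight elements -/

section Counts

variable {u : ℕ}

theorem isBump_natBumps : IsBump (natBumps u) where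
  trans x y z := by simp only [natBumps_iff]; omega
  left x y z := by simp only [natBumps_iff, natBumps_eq_false]; omega
  total x y := by simp only [natBumps_iff]; omega

theorem countP_range_Ico (a b N : ℕ) (hb : b ≤ N) :
    (List.range N).countP (fun i => decide (a ≤ i ∧ i < b)) = b - a := by
  have key : ∀ N, (List.range N).countP (fun i => decide (a ≤ i ∧ i < b)) = min b N - a := by
    intro N
    induction N with
    | zero => simp
    | succ N ih =>
      rw [List.range_succ, List.countP_append, ih, List.countP_singleton]
      simp only [decide_eq_true_eq]
      split_ifs <;> omega
  rw [key, min_eq_left hb]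

theorem mem_longLetters {t x : ℕ} {hs : List ℕ} :
    x ∈ longLetters u t hs ↔ u + t ≤ x ∧ u < hs.getD (x - u - t) 0 := by
  induction hs generalizing t with
  | nil => simp [longLetters]
  | cons a hs ih =>
    rw [longLetters, List.mem_append, ih]
    rcases lt_trichotomy x (u + t) with h | rfl | h
    · split_ifs <;> simp <;> omega
    · have e : u + t - u - t = 0 := by omega
      rw [e, List.getD_cons_zero]
      split_ifs <;> simp <;> omega
    · obtain ⟨d, rfl⟩ : ∃ d, x = u + t + (d + 1) := ⟨x - (u + t) - 1, by omega⟩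
      have e1 : u + t + (d + 1) - u - t = d + 1 := by omega
      have e2 : u + t + (d + 1) - u - (t + 1) = d := by omega
      rw [e1, e2, List.getD_cons_succ]
      have e3 : ¬ u + t + (d + 1) ∈ (if u < a then [u + t] else []) := by
        split_ifs <;> simp
      simp only [e3, or_false]
      constructor <;> rintro ⟨-, h⟩ <;> exact ⟨by omega, h⟩

theorem count_longLetters (t x : ℕ) (hs : List ℕ) : (longLetters u t hs).count x =
    if u + t ≤ x ∧ u < hs.getD (x - u - t) 0 then 1 else 0 := by
  rw [List.Nodup.count ((pairwise_longLetters t hs).imp fun h => by omega)]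
  simp only [mem_longLetters]

theorem count_shortLetters (x : ℕ) (hs : List ℕ) :
    (shortLetters u hs).count x = if x < u then hs.count (x + 1) else 0 := by
  induction hs with
  | nil => simp [shortLetters]
  | cons a hs ih =>
    rw [shortLetters, List.filter_cons]
    rw [shortLetters] at ih
    split_ifs at ih ⊢ with h1 h2 h2
    · rw [List.map_cons, List.count_cons, List.count_cons, ih]
      simp only [decide_eq_true_eq] at h1
      congr 1
      have : (a - 1 = x) ↔ (a = x + 1) := by omega
      simp [this]
    · rw [List.map_cons, List.count_cons, ih]
      simp only [decide_eq_true_eq] at h1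
      simp; omega
    · rw [ih, List.count_cons]
      simp only [decide_eq_true_eq] at h1
      simp; omega
    · exact ih

theorem length_rowWord (t : ℕ) (hs : List ℕ) :
    (rowWord u t hs).length = hs.countP fun h => decide (0 < h) := by
  induction hs generalizing t with
  | nil => rfl
  | cons a hs ih =>
    have h1 := ih (t + 1)
    rw [rowWord, List.length_append] at h1 ⊢
    rw [List.countP_cons, ← h1, longLetters, shortLetters, List.filter_cons]
    simp only [decide_eq_true_eq, shortLetters, List.length_map, List.length_append]
    split_ifs <;> simp <;> omega

theorem pairwise_shortLetters {hs : List ℕ} (hhs : hs.Pairwise fun a b => b ≤ a) :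
    (shortLetters u hs).Pairwise fun a b => b ≤ a := by
  rw [shortLetters, List.pairwise_map]
  exact (hhs.filter _).imp fun h => by omega

theorem pairwise_rowWord {t : ℕ} {hs : List ℕ} (hhs : hs.Pairwise fun a b => b ≤ a) :
    (rowWord u t hs).Pairwise fun a b => b ≤ a := by
  rw [rowWord, List.pairwise_append]
  refine ⟨(pairwise_longLetters t hs).imp fun h => h.le, pairwise_shortLetters hhs, ?_⟩
  intro a ha b hb
  have := lt_of_mem_longLetters ha
  simp only [shortLetters, List.mem_map, List.mem_filter, decide_eq_true_eq] at hb
  obtain ⟨x, ⟨-, hx⟩, rfl⟩ := hb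
  omega

theorem pairwise_highestColumn (t h : ℕ) :
    (highestColumn u t h).Pairwise fun a b => a ≤ b := by
  rw [highestColumn, List.pairwise_append]
  refine ⟨List.pairwise_lt_range.imp fun h => h.le, ?_, ?_⟩
  · rw [List.pairwise_replicate]; right; exact le_rfl
  · intro a ha b hb
    rw [List.mem_range] at ha
    rw [List.eq_of_mem_replicate hb]; omega

theorem count_highestColumn (t h x : ℕ) : (highestColumn u t h).count x =
    (if x < min u h then 1 else 0) + if x = u + t then h - u else 0 := by
  rw [highestColumn, List.count_append, List.Nodup.count List.nodup_range, List.count_replicate]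
  have e : (u + t == x) = true ↔ x = u + t := by rw [beq_iff_eq, eq_comm]
  simp only [List.mem_range, e]

theorem getD_heights (g : ℕ → ℕ) {N t i : ℕ} (hi : i < N) : (heights g N t).getD i 0 = g (t + i) := by
  rw [heights, List.getD_eq_getElem?_getD, List.getElem?_map, List.getElem?_range hi]; rfl

theorem countP_heights (g : ℕ → ℕ) (N t : ℕ) (p : ℕ → Bool) :
    (heights g N t).countP p = (List.range N).countP fun i => p (g (t + i)) := by
  rw [heights, List.countP_map]; rfl

theorem highestColumns_heights {g : ℕ → ℕ} {K N t : ℕ} (hK : ∀ i, i < K ↔ 0 < g (t + i))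
    (hN : K ≤ N) : highestColumns u t (heights g N t) =
      (List.range K).map fun i => highestColumn u (t + i) (g (t + i)) := by
  induction N generalizing K t with
  | zero => obtain rfl : K = 0 := by omega
            rfl
  | succ N ih =>
    rw [heights_succ, highestColumns]
    have h0 := hK 0
    rw [Nat.add_zero] at h0
    split_ifs with h
    · obtain rfl : K = 0 := by omega
      rfl
    · obtain ⟨K, rfl⟩ : ∃ K', K = K' + 1 := ⟨K - 1, by omega⟩
      rw [ih (K := K) (fun i => by
        have := hK (i + 1)
        rw [← add_assoc, add_right_comm] at this
        omega) (by omega), List.range_succ_eq_map, List.map_cons, List.map_map, Nat.add_zero]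
      congr 1
      apply List.map_congr_left
      intro i _
      simp only [Function.comp, Nat.succ_eq_add_one, add_assoc, add_comm 1 i]

end Counts

/-! ### The two tableaux of the matrices `A♯_λ`. -/

section HighestWeight

variable {m n u v : ℕ}

theorem rowLen_antitone (lam : YoungDiagram) : Antitone lam.rowLen :=
  fun _ _ h => lam.rowLen_anti _ _ h

theorem map_highestTableau {lam : YoungDiagram} (h : lam ∈ hookPartitions m n) :
    (highestTableau m n lam h).map (List.map Fin.val) =
      (List.range (lam.rowLen 0)).map fun j => highestColumn m j (lam.colLen j) := by
  refine List.ext_getElem (by simp [highestTableau]) fun j h1 h2 => ?_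
  simp only [highestTableau, List.getElem_map, List.getElem_ofFn, List.getElem_range]
  refine List.ext_getElem (by simp [length_highestColumn]) fun i h3 h4 => ?_
  rw [length_highestColumn] at h4
  have h5 := getElem?_highestColumn (u := m) (t := j) h4
  rw [List.getElem?_eq_getElem (by rwa [length_highestColumn]), Option.some.injEq] at h5
  rw [h5, List.getElem_map, List.getElem_ofFn]
  split_ifs <;> rfl

theorem colLens_highestTableau {lam : YoungDiagram} (h : lam ∈ hookPartitions m n) (j : ℕ) :
    colLens (highestTableau m n lam h) j = lam.colLen j := by
  have h1 := conj_colLen_rowLen lam 0 j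
  rw [← colLens_map (π := Fin.val), map_highestTableau, colLens_eq, List.getElem?_map]
  by_cases hj : j < lam.rowLen 0
  · rw [List.getElem?_range hj]; simp [length_highestColumn]
  · rw [List.getElem?_eq_none (by simpa using hj)]
    simp; omega

/-- A block is monotone, so it can be recognised by its content. -/
theorem map_val_block_eq {B : MSharp m n u v} {c : Letter u v} {w : List ℕ}
    (hw : w.Pairwise fun a b => if c.val < u then a ≤ b else b ≤ a)
    (hlt : ∀ x ∈ w, x < m + n) (hc : ∀ b : Letter m n, w.count b.val = B.1 b c) :
    (block B c).map Fin.val = w := by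
  have hb : ((block B c).map Fin.val).Pairwise fun a b => if c.val < u then a ≤ b else b ≤ a := by
    rw [List.pairwise_map]
    refine (isBlock_block B c).imp ?_
    intro x y h
    rw [bumps_eq_iff, decide_eq_true_eq] at h
    split_ifs <;> omega
  refine List.Perm.eq_of_pairwise (le := fun a b => if c.val < u then a ≤ b else b ≤ a)
    (fun a b _ _ h h' => by split_ifs at h h' <;> omega) hb hw ?_
  rw [List.perm_iff_count]
  intro x
  by_cases hx : x < m + n
  · rw [hc ⟨x, hx⟩, ← count_block]
    exact List.count_map_of_injective _ _ Fin.val_injective (⟨x, hx⟩ : Letter m n)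
  · rw [List.count_eq_zero_of_not_mem fun h => hx (hlt x h), List.count_eq_zero]
    intro h
    obtain ⟨b, -, rfl⟩ := List.mem_map.1 h
    exact hx b.2

/-- The ones of this row are the barred entries of column `k` of the highest weight tableau of `λ'`,
and the diagonal entry counts the copies of its unbarred letter. The hook condition for `(v, u)`
ensures that this letter exists when it is needed. -/
theorem map_val_block_barred {lam : YoungDiagram} (hlam : lam ∈ hookPartitions v u) (k : Fin m) :
    (block (aSharp m n u v lam).transpose (barred m n k)).map Fin.val =
      highestColumn u k (lam.rowLen k) := by
  have hv : lam.rowLen v ≤ u := hlam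
  have hkv : u < lam.rowLen k → k.val < v := fun h => by
    by_contra h'
    have := lam.rowLen_anti v k (not_lt.1 h')
    omega
  refine map_val_block_eq ?_ ?_ ?_
  · refine (pairwise_highestColumn _ _).imp fun h => ?_
    rw [if_pos (by exact k.2)]; exact h
  · intro x hx
    rw [highestColumn, List.mem_append, List.mem_range] at hx
    rcases hx with hx | hx
    · omega
    · obtain ⟨h1, rfl⟩ := List.mem_replicate.1 hx
      have := hkv (by omega)
      omega
  · intro b
    rw [count_highestColumn]
    refine Fin.addCases (fun l => ?_) (fun t => ?_) b
    · simp [MSharp.transpose, aSharp, barred]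
      have := l.2
      have h1 : ¬ l.val = u + k := by omega
      simp [h1]
    · simp [MSharp.transpose, aSharp, barred, eq_comm]
      split_ifs with h
      · rw [h]
      · rfl

/-- The barred letter `l` is needed once for each row of `λ` from row `m` on whose length is exactly
`s + l + 1`, and `nu` counts these rows. The unbarred letter `t` is needed if row `t`, with `m ≤ t`,
is longer than `u + s`. The bound `N` only has to exceed the number of rows. -/
theorem map_val_block_unbarred {lam : YoungDiagram} (hlam : lam ∈ hookPartitions v u) (s : Fin n)
    {N : ℕ} (hN : lam.colLen 0 ≤ N) :
    (block (aSharp m n u v lam).transpose (unbarred m n s)).map Fin.val =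
      rowWord u m (heights (fun i => lam.rowLen i - s) N m) := by
  have hv : lam.rowLen v ≤ u := hlam
  have hanti : Antitone fun i => lam.rowLen i - s :=
    fun i j h => Nat.sub_le_sub_right (rowLen_antitone lam h) s
  have hlong : ∀ i, u < lam.rowLen i → i < v := fun i h => by
    by_contra h'
    have := lam.rowLen_anti v i (not_lt.1 h')
    omega
  have hget : ∀ i, (heights (fun i => lam.rowLen i - s) N m).getD i 0 = lam.rowLen (m + i) - s := by
    intro i
    by_cases hi : i < N
    · rw [getD_heights _ hi]
    · rw [List.getD_eq_default _ _ (by simpa [heights] using hi)]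
      have h1 := conj_colLen_rowLen lam (m + i) 0
      omega
  refine map_val_block_eq ?_ ?_ ?_
  · refine (pairwise_rowWord (pairwise_heights hanti N m)).imp fun h => ?_
    rw [if_neg (by simp [unbarred])]; exact h
  · intro x hx
    rw [rowWord, List.mem_append, mem_longLetters, hget] at hx
    rcases hx with ⟨h1, h2⟩ | hx
    · have := hlong (m + (x - u - m)) (by omega)
      omega
    · simp only [shortLetters, List.mem_map, List.mem_filter, decide_eq_true_eq] at hx
      obtain ⟨x, ⟨-, hx⟩, rfl⟩ := hx
      omega
  · intro b
    rw [rowWord, List.count_append, count_longLetters, count_shortLetters, hget]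
    refine Fin.addCases (fun l => ?_) (fun t => ?_) b
    · have hl := l.2
      have h1 : ¬ u + m ≤ l.val := by omega
      simp only [Fin.val_castAdd, h1, false_and, if_false, hl, if_true, zero_add]
      simp only [MSharp.transpose, aSharp, unbarred, Matrix.transpose_apply, Matrix.of_apply,
        Fin.addCases_left, Fin.addCases_right, nu]
      rw [List.count, countP_heights]
      have h2 := lam.colLen_anti 0 (s + l) (Nat.zero_le _)
      rw [show lam.colLen (s + l) - m - (lam.colLen (s + l + 1) - m) =
        (lam.colLen (s + l) - m) - (lam.colLen (s + l + 1) - m) from rfl,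
        ← countP_range_Ico (lam.colLen (s + l + 1) - m) _ N (by omega)]
      refine List.countP_congr fun i _ => ?_
      have h3 := conj_colLen_rowLen lam (m + i) (s + l)
      have h4 := conj_colLen_rowLen lam (m + i) (s + l + 1)
      simp only [beq_iff_eq, decide_eq_true_eq]
      omega
    · simp only [Fin.val_natAdd, MSharp.transpose, aSharp, unbarred, Matrix.transpose_apply,
        Matrix.of_apply, Fin.addCases_right]
      rw [if_neg (show ¬ u + t.val < u by omega), add_zero]
      by_cases hm : m ≤ t.val
      · have e : m + (u + t.val - u - m) = t.val := by omega
        refine if_congr ?_ rfl rfl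
        rw [e]
        omega
      · rw [if_neg (by omega), if_neg (by omega)]

theorem flatMap_reverse_finRange {β : Type*} (f : Letter m n → List β) (g h : ℕ → List β)
    (hg : ∀ k : Fin m, f (barred m n k) = g k) (hh : ∀ s : Fin n, f (unbarred m n s) = h s) :
    (List.finRange (m + n)).reverse.flatMap f =
      (List.range n).reverse.flatMap h ++ (List.range m).reverse.flatMap g := by
  have e : List.finRange (m + n) =
      (List.finRange m).map (barred m n) ++ (List.finRange n).map (unbarred m n) := by
    rw [List.finRange, List.ofFn_add]
    simp only [List.finRange, List.map_ofFn]
    rfl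
  rw [e, List.reverse_append, List.flatMap_append, ← List.map_coe_finRange_eq_range,
    ← List.map_coe_finRange_eq_range, ← List.map_reverse, ← List.map_reverse, ← List.map_reverse,
    ← List.map_reverse, List.flatMap_map, List.flatMap_map, List.flatMap_map, List.flatMap_map]
  simp only [hg, hh]

theorem wordTab_wordsStar_aSharp {lam : YoungDiagram} (hl : lam ∈ hookPartitions m n)
    (hlam : lam ∈ hookPartitions v u) (hmu : lam.transpose ∈ hookPartitions u v) :
    wordTab (bumps u v) (wordsStar (aSharp m n u v lam)).2 =
      highestTableau u v lam.transpose hmu := by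
  apply List.map_injective_iff.2 (List.map_injective_iff.2 Fin.val_injective)
  rw [map_highestTableau, wordTab_map isBump_bumps isBump_natBumps
    (List.pairwise_of_forall fun x y => by
      rw [Bool.eq_iff_iff, bumps_iff, natBumps_iff]), wordsStar_snd, List.map_flatMap,
    flatMap_reverse_finRange _ (fun k => highestColumn u k (lam.rowLen k))
      (fun s => rowWord u m (heights (fun i => lam.rowLen i - s) (lam.colLen 0) m))
      (map_val_block_barred hlam) (fun s => map_val_block_unbarred hlam s le_rfl),
    wordTab_rowWords (rowLen_antitone lam) _ _ _ hl, YoungDiagram.rowLen_transpose]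
  simp only [YoungDiagram.colLen_transpose]
  rw [highestColumns_heights (K := lam.colLen 0) (fun i => ?_) (by omega)]
  · simp only [zero_add]
  · rw [zero_add]; exact conj_colLen_rowLen lam i 0

theorem sum_map_orderedLetters (k : ℕ) (f : Letter m n → ℕ) :
    ((orderedLetters m n k).map f).sum = ∑ b, f b := by
  rw [Fin.sum_univ_def]
  refine (List.Perm.map f ?_).sum_eq
  unfold orderedLetters
  split_ifs
  · exact List.Perm.refl _
  · exact List.reverse_perm _

theorem length_block (A : MSharp m n u v) (b' : Letter u v) :
    (block A b').length = ∑ b, A.1 b b' := by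
  simp only [block, List.length_flatMap, List.length_replicate, sum_map_orderedLetters]

theorem count_words_fst (A : MSharp m n u v) (b : Letter m n) :
    (words A).1.count b = ∑ b', A.1 b b' := by
  rw [words_fst, List.count_flatMap, Fin.sum_univ_def]
  simp only [Function.comp_def, count_block]

theorem count_wordsStar_snd (A : MSharp m n u v) (b' : Letter u v) :
    (wordsStar A).2.count b' = ∑ b, A.1 b b' := by
  rw [wordsStar_snd, List.count_flatMap, Fin.sum_univ_def]
  refine ((List.reverse_perm _).map _).sum_eq.trans ?_
  simp only [Function.comp_def, count_block]
  rfl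

theorem eq_of_forall₂_le : ∀ {l l' : List ℕ}, List.Forall₂ (· ≤ ·) l l' → l'.sum ≤ l.sum → l = l'
  | _, _, .nil, _ => rfl
  | _, _, .cons (a := a) (b := b) (l₁ := l) (l₂ := l') hab h, hs => by
    have h1 : l.sum ≤ l'.sum := h.sum_le_sum
    rw [List.sum_cons, List.sum_cons] at hs
    rw [eq_of_forall₂_le h (by omega), show a = b by omega]

theorem count_highestTableau {lam : YoungDiagram} (h : lam ∈ hookPartitions m n)
    (b : Letter m n) : (highestTableau m n lam h).flatten.count b =
      if b.val < m then lam.rowLen b else lam.colLen (b - m) - m := by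
  rw [← List.count_map_of_injective _ _ Fin.val_injective, List.map_flatten, map_highestTableau,
    List.count_flatten, List.map_map]
  change ∑ j ∈ Finset.range (lam.rowLen 0), (highestColumn m j (lam.colLen j)).count b.val = _
  simp only [count_highestColumn, Finset.sum_add_distrib]
  split_ifs with hb
  · have h1 : ∀ j, ¬ b.val = m + j := fun j => by omega
    simp only [h1, if_false, Finset.sum_const_zero, add_zero, Finset.sum_boole, Nat.cast_id]
    have h2 := lam.rowLen_anti 0 b (Nat.zero_le _)
    rw [← Finset.card_range (lam.rowLen b)]
    congr 1
    ext j
    have h3 := conj_colLen_rowLen lam b j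
    simp only [Finset.mem_filter, Finset.mem_range]
    omega
  · have h1 : ∀ h', ¬ b.val < min m h' := fun h' => by omega
    have h2 : ∀ j, b.val = m + j ↔ b.val - m = j := fun j => by omega
    simp only [h1, if_false, Finset.sum_const_zero, zero_add, h2, Finset.sum_ite_eq,
      Finset.mem_range]
    have h3 := conj_colLen_rowLen lam 0 (b.val - m)
    split_ifs <;> omega

/-- By `IsTab.le_entry` each entry is at least the corresponding entry of the highest weight
tableau. Equal contents give equal sums of positions, so no entry can be larger. -/
theorem eq_highestTableau {lam : YoungDiagram} (h : lam ∈ hookPartitions m n)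
    {T : List (List (Letter m n))} (hT : IsTab (bumps m n) T)
    (hlen : ∀ j, colLens T j = lam.colLen j)
    (hc : ∀ b, T.flatten.count b = (highestTableau m n lam h).flatten.count b) :
    T = highestTableau m n lam h := by
  have hlen2 : T.map List.length = (highestTableau m n lam h).map List.length := by
    refine map_length_eq_of_colLens hT.nil_notMem ?_ fun j => by
      rw [hlen, colLens_highestTableau]
    intro h0
    have h1 := List.mem_map_of_mem (f := List.map Fin.val) h0
    rw [map_highestTableau] at h1
    obtain ⟨j, hj, h1⟩ := List.mem_map.1 h1
    have h2 := length_highestColumn (u := m) j (lam.colLen j)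
    have h3 := conj_colLen_rowLen lam 0 j
    rw [h1] at h2
    rw [List.mem_range] at hj
    simp only [List.map_nil, List.length_nil] at h2
    omega
  have hle : List.Forall₂ (List.Forall₂ (· ≤ ·)) ((highestTableau m n lam h).map (List.map Fin.val))
      (T.map (List.map Fin.val)) := by
    rw [List.forall₂_iff_get]
    have hl := congrArg List.length hlen2
    simp only [List.length_map] at hl
    refine ⟨by simpa using hl.symm, fun j h1 h2 => ?_⟩
    simp only [map_highestTableau, List.get_eq_getElem, List.getElem_map, List.getElem_range]
    rw [List.length_map] at h2
    have hcol : T[j].length = lam.colLen j := by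
      rw [← hlen, colLens_eq, List.getElem?_eq_getElem h2]; rfl
    rw [List.forall₂_iff_get]
    refine ⟨by rw [length_highestColumn, List.length_map, hcol], fun i h3 h4 => ?_⟩
    rw [length_highestColumn] at h3
    have h5 := getElem?_highestColumn (u := m) (t := j) h3
    rw [List.getElem?_eq_getElem (by rwa [length_highestColumn]), Option.some.injEq] at h5
    rw [List.get_eq_getElem, h5, List.get_eq_getElem, List.getElem_map]
    apply hT.le_entry
    rw [entry, List.getElem?_eq_getElem h2, Option.bind_some, List.getElem?_eq_getElem]
  have hsum : (T.map (List.map Fin.val)).flatten.sum =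
      ((highestTableau m n lam h).map (List.map Fin.val)).flatten.sum := by
    rw [← List.map_flatten, ← List.map_flatten]
    exact ((List.perm_iff_count.2 hc).map _).sum_eq
  have hflat := eq_of_forall₂_le (List.rel_flatten hle) hsum.le
  rw [← List.map_flatten, ← List.map_flatten] at hflat
  exact List.eq_iff_flatten_eq.2 ⟨List.map_injective_iff.2 Fin.val_injective hflat.symm, hlen2⟩

/-- No second computation of insertions is needed: the shape comes from the symmetry with the other
tableau and the content from the row sums of the matrix. -/
theorem wordTab_words_aSharp {lam : YoungDiagram} (hl : lam ∈ hookPartitions m n)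
    (hlam : lam ∈ hookPartitions v u) :
    wordTab (bumps m n) (words (aSharp m n u v lam)).1 = highestTableau m n lam hl := by
  have h1 := conj_words (aSharp m n u v lam)
  rw [wordTab_wordsStar_aSharp hl hlam (transpose_mem_hookPartitions.2 hlam)] at h1
  have h2 := (conj_colLen_rowLen lam).symm
  have h3 : colLens (highestTableau u v lam.transpose (transpose_mem_hookPartitions.2 hlam)) =
      lam.rowLen := funext fun j => by
    rw [colLens_highestTableau, YoungDiagram.colLen_transpose]
  rw [h3] at h1
  refine eq_highestTableau hl (isTab_wordTab isBump_bumps _)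
    (fun j => congrFun (h1.symm.unique h2) j) fun b => ?_
  rw [(wordTab_perm _).count_eq, count_words_fst, count_highestTableau]
  have h4 : ∑ b', (aSharp m n u v lam).1 b b' =
      ((block (aSharp m n u v lam).transpose b).map Fin.val).length := by
    rw [List.length_map, length_block]; rfl
  rw [h4]
  refine Fin.addCases (fun k => ?_) (fun s => ?_) b
  · change ((block (aSharp m n u v lam).transpose (barred m n k)).map Fin.val).length = _
    rw [map_val_block_barred hlam, length_highestColumn, if_pos (by simp)]
    rfl
  · change ((block (aSharp m n u v lam).transpose (unbarred m n s)).map Fin.val).length = _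
    rw [map_val_block_unbarred hlam s le_rfl, length_rowWord, countP_heights, if_neg (by simp)]
    have h5 : (Fin.natAdd m s).val - m = s := by simp
    rw [h5]
    have h6 := lam.colLen_anti 0 s (Nat.zero_le _)
    rw [← Nat.sub_zero (lam.colLen s - m), ← countP_range_Ico 0 _ (lam.colLen 0) (by omega)]
    refine List.countP_congr fun i _ => ?_
    have h7 := conj_colLen_rowLen lam (m + i) s
    simp only [decide_eq_true_eq]
    omega

/-- The symmetry of shapes forces the second partition to be `λ'`. Then the matrix has the same two
tableaux as `A♯_λ`, so it equals `A♯_λ`. -/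
theorem highestWeightElements_eq :
    highestWeightElements m n u v =
      aSharp m n u v '' (hookPartitions m n ∩ hookPartitions v u) := by
  ext A
  simp only [highestWeightElements, piSharp, insertionTableau_eq, Set.mem_ofPred_eq, Prod.mk.injEq]
  constructor
  · rintro ⟨lam, hl, mu, hm, h1, h2⟩
    have h3 := conj_words A
    rw [h1, h2, funext (colLens_highestTableau hl), funext (colLens_highestTableau hm)] at h3
    have h4 : mu = lam.transpose := diagram_ext fun j => by
      rw [YoungDiagram.colLen_transpose]
      exact congrFun (h3.unique (conj_colLen_rowLen lam)) j
    subst h4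
    have hlam := transpose_mem_hookPartitions.1 hm
    refine ⟨lam, ⟨hl, hlam⟩, matrix_ext ?_ ?_⟩
    · rw [h1, wordTab_words_aSharp hl hlam]
    · rw [h2, wordTab_wordsStar_aSharp hl hlam hm]
  · rintro ⟨lam, ⟨hl, hlam⟩, rfl⟩
    exact ⟨lam, hl, lam.transpose, transpose_mem_hookPartitions.2 hlam,
      wordTab_words_aSharp hl hlam, wordTab_wordsStar_aSharp hl hlam _⟩

end HighestWeight

end HookCrystal


namespace HookCrystal

/-! ### The dual Cauchy identity -/

section GeneratingFunctions

open MvPowerSeries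

variable {σ ι : Type*} [Fintype ι] (e : ι → σ →₀ ℕ)

/-- The monomial of a family of exponents. -/
noncomputable def monomialOf (a : ι → ℕ) : MvPowerSeries σ ℤ := ∏ i, monomial (e i) (1 : ℤ) ^ a i

theorem monomialOf_eq (a : ι → ℕ) : monomialOf e a = monomial (∑ i, a i • e i) 1 := by
  simp only [monomialOf, monomial_pow, one_pow, prod_monomial, Finset.prod_const_one]

variable {e}

/-- No exponent vanishes, so each multiplicity is bounded by the degree of the monomial, and only
finitely many families contribute to a given coefficient. -/
theorem summable_indicator_monomialOf (he : ∀ i, e i ≠ 0) (M : Set (ι → ℕ)) :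
    Summable (M.indicator (monomialOf e)) := by
  classical
  rw [WithPiTopology.summable_iff_summable_coeff]
  intro d
  refine summable_of_hasFiniteSupport ?_
  refine (Set.finite_Iic (fun _ : ι => d.degree)).subset fun a ha => ?_
  have h1 : d = ∑ i, a i • e i := by
    by_contra h
    apply ha
    change coeff d (M.indicator (monomialOf e) a) = 0
    by_cases hM : a ∈ M
    · rw [Set.indicator_of_mem hM, monomialOf_eq, coeff_monomial_ne h]
    · rw [Set.indicator_of_notMem hM, map_zero]
  rw [Set.mem_Iic]
  intro i
  obtain ⟨s, hs⟩ := Finsupp.ne_iff.1 (he i)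
  rw [Finsupp.coe_zero, Pi.zero_apply] at hs
  calc a i ≤ a i * e i s := Nat.le_mul_of_pos_right _ (Nat.pos_of_ne_zero hs)
    _ ≤ ∑ i, a i * e i s :=
      Finset.single_le_sum (f := fun i => a i * e i s) (fun _ _ => Nat.zero_le _) (Finset.mem_univ i)
    _ = d s := by rw [h1]; simp [Finsupp.finsetSum_apply]
    _ ≤ d.degree := Finsupp.le_degree s d

variable [DecidableEq ι]

theorem monomialOf_add_single (a : ι → ℕ) (p : ι) :
    monomialOf e (a + Pi.single p 1) = monomialOf e a * monomial (e p) 1 := by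
  simp only [monomialOf, Pi.add_apply, pow_add, Finset.prod_mul_distrib]
  congr 1
  rw [Finset.prod_eq_single p (fun i _ hi => by rw [Pi.single_eq_of_ne hi, pow_zero]) (by simp),
    Pi.single_eq_same, pow_one]

/-- The families in `M'` are split according to whether the entry at `p` vanishes. Those with entry
zero make up `M`, and the others come from `M''` by raising that entry by one. -/
theorem sum_eq_add_mul {M M' M'' : Set (ι → ℕ)} {S S' S'' : MvPowerSeries σ ℤ} (p : ι)
    (hS : HasSum (M.indicator (monomialOf e)) S) (hS' : HasSum (M'.indicator (monomialOf e)) S')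
    (hS'' : HasSum (M''.indicator (monomialOf e)) S'')
    (h0 : ∀ a : ι → ℕ, a p = 0 → (a ∈ M ↔ a ∈ M')) (h1 : ∀ a : ι → ℕ, (a + Pi.single p 1 : ι → ℕ) ∉ M)
    (h2 : ∀ a : ι → ℕ, (a + Pi.single p 1 : ι → ℕ) ∈ M' ↔ a ∈ M'') : S' = S + S'' * monomial (e p) 1 := by
  have h3 := hS'.sub hS
  have hinj : Function.Injective fun a : ι → ℕ => a + Pi.single p 1 := add_left_injective _
  rw [← hinj.hasSum_iff] at h3
  · have h4 := hS''.mul_right (monomial (e p) 1)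
    have h5 : ((fun a => M'.indicator (monomialOf e) a - M.indicator (monomialOf e) a) ∘
        fun a : ι → ℕ => a + Pi.single p 1) =
        fun a => M''.indicator (monomialOf e) a * monomial (e p) 1 := by
      funext a
      simp only [Function.comp, Set.indicator_of_notMem (h1 a), sub_zero]
      by_cases ha : a ∈ M''
      · rw [Set.indicator_of_mem ha, Set.indicator_of_mem ((h2 a).2 ha), monomialOf_add_single]
      · rw [Set.indicator_of_notMem ha, Set.indicator_of_notMem fun h => ha ((h2 a).1 h), zero_mul]
    rw [h5] at h3
    rw [← h3.unique h4]
    ring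
  · intro a ha
    have hp : a p = 0 := by
      by_contra hp
      refine ha ⟨a - Pi.single p 1, ?_⟩
      refine tsub_add_cancel_of_le fun i => ?_
      by_cases hi : i = p
      · subst hi; rw [Pi.single_eq_same]; exact Nat.one_le_iff_ne_zero.2 hp
      · rw [Pi.single_eq_of_ne hi]; exact Nat.zero_le _
    have := h0 a hp
    by_cases hM : a ∈ M
    · rw [Set.indicator_of_mem hM, Set.indicator_of_mem (this.1 hM), sub_self]
    · rw [Set.indicator_of_notMem hM, Set.indicator_of_notMem fun h => hM (this.2 h), sub_self]

/-- Induction on the index set with `sum_eq_add_mul`. A new bounded entry multiplies the sum by `1 +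
x^{e p}`. For a new free entry the raised families are all families again, which gives `S' = S + S'
x^{e p}`. Multiplying out the denominator avoids inverses of power series. -/
theorem hasSum_monomialOf (he : ∀ i, e i ≠ 0) (c : ι → Prop) [DecidablePred c] (P : Finset ι) :
    ∃ S, HasSum ({a : ι → ℕ | (∀ i ∉ P, a i = 0) ∧ ∀ i, c i → a i ≤ 1}.indicator (monomialOf e)) S ∧
      S * ∏ i ∈ P with ¬ c i, (1 - monomial (e i) 1) = ∏ i ∈ P with c i, (1 + monomial (e i) 1) := by
  induction P using Finset.induction_on with
  | empty =>
    refine ⟨1, ?_, by simp⟩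
    have h1 : (1 : MvPowerSeries σ ℤ) = monomialOf e 0 := by simp [monomialOf]
    rw [h1]
    convert hasSum_single (0 : ι → ℕ) ?_ using 1
    · rw [Set.indicator_of_mem]; simp
    · intro a ha
      rw [Set.indicator_of_notMem]
      rintro ⟨h, -⟩
      exact ha (funext fun i => h i (Finset.notMem_empty i))
  | insert p P hp ih =>
    obtain ⟨S, hS, hS2⟩ := ih
    obtain ⟨S', hS'⟩ := summable_indicator_monomialOf he
      {a : ι → ℕ | (∀ i ∉ insert p P, a i = 0) ∧ ∀ i, c i → a i ≤ 1}
    refine ⟨S', hS', ?_⟩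
    have hsame : ∀ a : ι → ℕ, (a + Pi.single p 1 : ι → ℕ) p = a p + 1 := fun a => by simp
    have hne : ∀ (a : ι → ℕ) i, i ≠ p → (a + Pi.single p 1 : ι → ℕ) i = a i := fun a i hi => by
      simp [hi]
    have h0 : ∀ a : ι → ℕ, a p = 0 →
        (a ∈ {a : ι → ℕ | (∀ i ∉ P, a i = 0) ∧ ∀ i, c i → a i ≤ 1} ↔
          a ∈ {a : ι → ℕ | (∀ i ∉ insert p P, a i = 0) ∧ ∀ i, c i → a i ≤ 1}) := by
      intro a ha
      simp only [Set.mem_ofPred_eq, Finset.mem_insert, not_or]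
      refine and_congr_left fun _ => ⟨fun h i hi => h i hi.2, fun h i hi => ?_⟩
      by_cases hip : i = p
      · rw [hip, ha]
      · exact h i ⟨hip, hi⟩
    have h1 : ∀ a : ι → ℕ, (a + Pi.single p 1 : ι → ℕ) ∉
        {a : ι → ℕ | (∀ i ∉ P, a i = 0) ∧ ∀ i, c i → a i ≤ 1} := by
      rintro a ⟨h, -⟩
      have := h p hp
      rw [hsame] at this
      omega
    by_cases hc : c p
    · have h3 := sum_eq_add_mul p hS hS' hS h0 h1 (by
        intro a
        simp only [Set.mem_ofPred_eq, Finset.mem_insert, not_or]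
        constructor
        · rintro ⟨h, h'⟩
          have hp0 : a p = 0 := by
            have := h' p hc; rw [hsame] at this; omega
          refine ⟨fun i hi => ?_, fun i hi => ?_⟩
          · by_cases hip : i = p
            · rw [hip, hp0]
            · rw [← hne a i hip]; exact h i ⟨hip, hi⟩
          · by_cases hip : i = p
            · rw [hip, hp0]; exact Nat.zero_le _
            · rw [← hne a i hip]; exact h' i hi
        · rintro ⟨h, h'⟩
          refine ⟨fun i hi => by rw [hne a i hi.1]; exact h i hi.2, fun i hi => ?_⟩
          by_cases hip : i = p
          · rw [hip, hsame, h p hp]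
          · rw [hne a i hip]; exact h' i hi)
      rw [Finset.filter_insert, Finset.filter_insert, if_neg (by simpa using hc), if_pos hc,
        Finset.prod_insert (by simp [hp]), ← hS2, h3]
      ring
    · have h3 := sum_eq_add_mul p hS hS' hS' h0 h1 (by
        intro a
        simp only [Set.mem_ofPred_eq, Finset.mem_insert, not_or]
        refine and_congr ?_ ?_
        · exact forall_congr' fun i => imp_congr_right fun hi => by rw [hne a i hi.1]
        · refine forall_congr' fun i => imp_congr_right fun hi => ?_
          rw [hne a i fun h => hc (h ▸ hi)])
      rw [Finset.filter_insert, Finset.filter_insert, if_pos hc, if_neg hc,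
        Finset.prod_insert (by simp [hp]), ← hS2, ← mul_assoc]
      congr 1
      rw [mul_sub, mul_one]
      exact sub_eq_of_eq_add h3

end GeneratingFunctions

/-! ### The two expansions of the sum over all matrices. -/

section Cauchy

variable {m n u v : ℕ}

/-- The exponent of `x_b y_{b'}`. -/
noncomputable def pairExponent (p : Letter m n × Letter u v) : (Letter m n ⊕ Letter u v) →₀ ℕ :=
  Finsupp.single (Sum.inl p.1) 1 + Finsupp.single (Sum.inr p.2) 1

theorem pairExponent_ne_zero (p : Letter m n × Letter u v) : pairExponent p ≠ 0 := by
  intro h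
  have := DFunLike.congr_fun h (Sum.inl p.1)
  simp [pairExponent] at this

theorem xVar_mul_yVar (p : Letter m n × Letter u v) :
    xVar m n u v p.1 * yVar m n u v p.2 = MvPowerSeries.monomial (pairExponent p) 1 := by
  rw [xVar, yVar, MvPowerSeries.X, MvPowerSeries.X, MvPowerSeries.monomial_mul_monomial, one_mul]
  rfl

/-- The monomial of a matrix. -/
noncomputable def matrixMonomial (A : MSharp m n u v) : Series m n u v :=
  (∏ b, xVar m n u v b ^ (words A).1.count b) * ∏ b', yVar m n u v b' ^ (wordsStar A).2.count b'

theorem matrixMonomial_eq (A : MSharp m n u v) :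
    matrixMonomial A = monomialOf pairExponent fun p => A.1 p.1 p.2 := by
  simp only [matrixMonomial, monomialOf, count_words_fst, count_wordsStar_snd, ← xVar_mul_yVar,
    mul_pow, Finset.prod_mul_distrib]
  congr 1
  · rw [Fintype.prod_prod_type]
    simp only [Finset.prod_pow_eq_pow_sum]
  · rw [Fintype.prod_prod_type_right]
    simp only [Finset.prod_pow_eq_pow_sum]

theorem exists_hasSum_matrixMonomial : ∃ S : Series m n u v,
    HasSum (matrixMonomial (m := m) (n := n) (u := u) (v := v)) S ∧
      S * cauchyDenominator m n u v = cauchyNumerator m n u v := by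
  obtain ⟨S, hS, h⟩ := hasSum_monomialOf (e := pairExponent (m := m) (n := n) (u := u) (v := v))
    pairExponent_ne_zero (fun p => deg m n p.1 = deg u v p.2) Finset.univ
  refine ⟨S, ?_, ?_⟩
  · have hinj : Function.Injective
        fun (A : MSharp m n u v) (p : Letter m n × Letter u v) => A.1 p.1 p.2 := by
      intro A B h
      apply Subtype.ext
      ext b b'
      exact congrFun h (b, b')
    rw [← hinj.hasSum_iff] at hS
    · convert hS using 1
      funext A
      rw [Function.comp, Set.indicator_of_mem, matrixMonomial_eq]
      exact ⟨by simp, fun p hp => A.2 p.1 p.2 hp⟩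
    · intro a ha
      rw [Set.indicator_of_notMem]
      rintro ⟨-, h⟩
      exact ha ⟨⟨fun b b' => a (b, b'), fun b b' hb => h (b, b') hb⟩, rfl⟩
  · simpa only [cauchyDenominator, cauchyNumerator, xVar_mul_yVar] using h

theorem hookSchur_eq_sum (lam : YoungDiagram) [Fintype (hookTableaux m n lam)] {R : Type*}
    [CommRing R] (x : Letter m n → R) :
    hookSchur m n lam x = ∑ T : hookTableaux m n lam, ∏ b, x b ^ T.1.flatten.count b := by
  rw [hookSchur, ← finsum_set_coe_eq_finsum_mem, finsum_eq_sum_of_fintype]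

/-- A tableau `P(w)` has the content of `w`, so the monomial of a matrix is the product of the
weights of its two tableaux. Grouping the matrices by their common shape through `pairEquiv` turns
the sum into products of hook Schur functions. -/
theorem exists_hasSum_hookSchur : ∃ S : Series m n u v,
    HasSum (fun lam : CommonPartition m n u v =>
      hookSchur m n lam.1 (xVar m n u v) *
        hookSchur u v lam.1.transpose (yVar m n u v)) S ∧
    S * cauchyDenominator m n u v = cauchyNumerator m n u v := by
  obtain ⟨S, hS, h⟩ := exists_hasSum_matrixMonomial (m := m) (n := n) (u := u) (v := v)
  refine ⟨S, ?_, h⟩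
  rw [← (pairEquiv m n u v).symm.hasSum_iff] at hS
  refine hS.sigma fun lam => ?_
  have : Fintype (hookTableaux m n lam.1) := (hookTableaux_finite m n lam.1).fintype
  have : Fintype (hookTableaux u v lam.1.transpose) :=
    (hookTableaux_finite u v lam.1.transpose).fintype
  rw [hookSchur_eq_sum, hookSchur_eq_sum, Finset.sum_mul_sum, ← Fintype.sum_prod_type']
  convert hasSum_fintype _ using 1
  refine Finset.sum_congr rfl fun q _ => ?_
  obtain ⟨A, hA⟩ := (pairEquiv m n u v).surjective ⟨lam, q⟩
  rw [Function.comp, ← hA, Equiv.symm_apply_apply, matrixMonomial]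
  rw [pairEquiv_apply] at hA
  have h1 := toPair_fst A
  have h2 := toPair_snd A
  rw [hA] at h1 h2
  simp only at h1 h2
  rw [h1, h2]
  simp only [(wordTab_perm _).count_eq]

end Cauchy

end HookCrystal

theorem theorem4p2 (m n u v : ℕ) (hmn : 0 < m + n) (huv : 0 < u + v) :
    -- the set `M♯` is a bicrystal through its two biword readings
    (IsSubcrystal (biwordCrystal m n u v) (words (m := m) (n := n) (u := u) (v := v)) ∧
      IsSubcrystal (biwordStarCrystal m n u v) (wordsStar (m := m) (n := n) (u := u) (v := v)) ∧
      IsBicrystal (matrixCrystal m n u v) (matrixStarCrystal m n u v)) ∧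
    -- the tableaux form subcrystals of the words
    (∀ lam ∈ hookPartitions m n ∩ hookPartitions v u,
      IsSubcrystal (wordCrystal m n) (tableauWord m n lam) ∧
      IsSubcrystal (wordCrystal u v) (tableauWord u v lam.transpose)) ∧
    -- the highest weight elements
    highestWeightElements m n u v =
      aSharp m n u v '' (hookPartitions m n ∩ hookPartitions v u) ∧
    -- `π♯` is an isomorphism of bicrystals
    (∃ Φ : MSharp m n u v ≃ TableauPairs m n u v,
      (∀ A, (((Φ A).2.1 : List (List (Letter m n))), ((Φ A).2.2 : List (List (Letter u v)))) =
        piSharp A) ∧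
      IsCrystalIso (matrixCrystal m n u v) (pairsCrystal m n u v) Φ ∧
      IsCrystalIso (matrixStarCrystal m n u v) (pairsStarCrystal m n u v) Φ) ∧
    -- the dual Cauchy identity
    (∃ S : Series m n u v,
      HasSum (fun lam : CommonPartition m n u v =>
        hookSchur m n lam.1 (xVar m n u v) *
          hookSchur u v lam.1.transpose (yVar m n u v)) S ∧
      S * cauchyDenominator m n u v = cauchyNumerator m n u v) := by
  refine ⟨⟨isSubcrystal_words, isSubcrystal_wordsStar, isBicrystal_matrix⟩,
    fun lam _ => ⟨isSubcrystal_tableauWord lam, isSubcrystal_tableauWord lam.transpose⟩,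
    highestWeightElements_eq, ⟨pairEquiv m n u v, pairEquiv_eq_piSharp, isCrystalIso_pairEquiv,
      isCrystalIso_star_pairEquiv⟩, exists_hasSum_hookSchur⟩
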